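/- **Setting.** Let $(\Sigma_1,g_1)$, $(\Sigma_2,g_2)$ be Riemannian surfaces with smooth oriented orthonormal frames $(e_1,e_2)$ and $(e_3,e_4)$ (shrink the surfaces, if necessary, so that the frames below are globally defined), and write $[e_1,e_2]=a_1e_1+a_2e_2$, $[e_3,e_4]=a_3e_3+a_4e_4$. Let $\kappa,\lambda$ be the Gaussian curvatures, $$\kappa=e_1(a_2)-e_2(a_1)-a_1^2-a_2^2,\qquad \lambda=e_3(a_4)-e_4(a_3)-a_3^2-a_4^2 .$$ Assume that * $g_1$ has a Killing vector field $K=h\,e_2$ with a positive function $h$ (this forces $a_1=0$, $e_2(a_2)=0$, $e_2(\kappa)=0$); * $\lambda$ is constant, and the frame $(e_3,e_4)$ is chosen so that $a_3=0$; * $\kappa\neq\lambda$ at every point. Put $\kappa_1=e_1(\kappa)$, $\kappa_{11}=e_1(e_1(\kappa))$, and extend $e_1,\dots,e_4$ trivially to $M=\Sigma_1\times\Sigma_2$ with the metric $g=g_1\oplus(-g_2)$. The twistor space $\mathbb T(M)$ has the points $(y,\phi)$, $y\in M$, $\phi$ an angular coordinate (all statements are local, so $\phi$ is taken in $\mathbb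 R$, the universal cover of the circle), where $(y,\phi)$ stands for the totally null plane $$N(y,\phi)=\mathrm{Span}(e_1+\cos\phi\, e_3+\sin\phi\, e_4,\ e_2-\sin\phi\, e_3+\cos\phi\, e_4)\subset T_yM .$$ The twistor distribution $\mathcal D$ on $\mathbb T(M)$ is, at $(y,\phi)$, the space of horizontal lifts of the vectors of $N(y,\phi)$, a vector being horizontal if the planes are transported parallelly along it by the Levi-Civita connection of $g$. Let $\sigma^1,\dots,\sigma^4,d\phi$ be the coframe on $\mathbb T(M)$ dual to $e_1,\dots,e_4,\partial_\phi$. *Associated conformal class.* For a rank two distribution $\mathcal D$ on a 5-manifold, invariant forms of $\mathcal D$ are smooth coframes $(\theta^1,\dots,\theta^5)$ with $\theta^1,\theta^2,\theta^3$ vanishing on $\mathcal D$, for which there are smooth 1-forms $\Omega_1,\dots,\Omega_7$ with $$\begin{aligned} d\theta^1&=\theta^1\wedge(2\Omega_1+\Omega_4)+\theta^2\wedge\Omega_2+\theta^3\wedge\theta^4,\\ d\theta^2&=\theta^1\wedge\Omega_3+\theta^2\wedge(\Omega_1+2\Omega_4)+\theta^3\wedge\theta^5,\\ d\theta^3&=\theta^1\wedge\Omega_5+\theta^2\wedge\Omega_6+\theta^3\wedge(\Omega_1+\Omega_4)+\theta^4\wedge\theta^5,\\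 d\theta^4&=\theta^1\wedge\Omega_7+\tfrac43\theta^3\wedge\Omega_6+\theta^4\wedge\Omega_1+\theta^5\wedge\Omega_2,\\ d\theta^5&=\theta^2\wedge\Omega_7-\tfrac43\theta^3\wedge\Omega_5+\theta^4\wedge\Omega_3+\theta^5\wedge\Omega_4 . \end{aligned}$$ The class $[\tilde g]$ associated with $\mathcal D$ consists of all metrics $f\,\tilde g_\theta$, with $f$ a positive smooth function, $\theta$ any invariant forms of $\mathcal D$, and $$\tilde g_\theta=\theta^1\otimes\theta^5+\theta^5\otimes\theta^1-\theta^2\otimes\theta^4-\theta^4\otimes\theta^2+\tfrac43\,\theta^3\otimes\theta^3 .$$ *The frame.* Let $B=\frac{\kappa_1}{\lambda-\kappa}+a_4\cos\phi$ and $$\begin{aligned} \tilde X_1&=e_1+\cos\phi\, e_3+\sin\phi\, e_4+a_4\sin\phi\,\partial_\phi,\\ \tilde X_2&=e_2-\sin\phi\, e_3+\cos\phi\, e_4+(-a_2+a_4\cos\phi)\,\partial_\phi,\\ \tilde X_3&=a_2\tilde X_2+(\lambda-\kappa)\partial_\phi,\\ \tilde X_4&=(\kappa+a_2^2+a_2B)\tilde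 X_2-B\tilde X_3+(\lambda-\kappa)(\sin\phi\, e_3-\cos\phi\, e_4),\\ \tilde X_5&=-a_2a_4\sin\phi\,\tilde X_2+a_4\sin\phi\,\tilde X_3+(\lambda-\kappa)(\cos\phi\, e_3+\sin\phi\, e_4). \end{aligned}$$ **Proposition.** The twistor distribution $\mathcal D$ is spanned by $\tilde X_1,\tilde X_2$, and $[\tilde X_1,\tilde X_2]=\tilde X_3$, $[\tilde X_1,\tilde X_3]=\tilde X_4+a_2\tilde X_3$, $[\tilde X_2,\tilde X_3]=\tilde X_5$. The dual coframe of $\tilde X_1,\dots,\tilde X_5$, i.e. $\omega_i(\tilde X_j)=\delta_{ij}$, is, with $q=a_2^2\kappa+\kappa^2-a_2\kappa_1-a_2^2\lambda-\kappa\lambda$, $$\begin{aligned} \omega_1&=\sigma^1,\\ \omega_2&=\frac{(2a_2^2\kappa+2\kappa^2-a_2\kappa_1-2a_2^2\lambda-3\kappa\lambda+\lambda^2)\,\sigma^2+q\sin\phi\,\sigma^3-\big(a_2a_4(\kappa-\lambda)+q\cos\phi\big)\sigma^4}{(\kappa-\lambda)^2}+\frac{a_2\,d\phi}{\kappa-\lambda},\\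 \omega_3&=\frac{(-a_2(\kappa-\lambda)+\kappa_1)\,\sigma^2+\kappa_1\sin\phi\,\sigma^3+\big(a_4(\kappa-\lambda)-\kappa_1\cos\phi\big)\sigma^4}{(\kappa-\lambda)^2}-\frac{d\phi}{\kappa-\lambda},\\ \omega_4&=\frac{-\sigma^2-\sin\phi\,\sigma^3+\cos\phi\,\sigma^4}{\kappa-\lambda},\qquad \omega_5=\frac{\sigma^1-\cos\phi\,\sigma^3-\sin\phi\,\sigma^4}{\kappa-\lambda}. \end{aligned}$$ The forms $$\begin{aligned} \theta^1&=\omega_4-\omega_5,\qquad \theta^2=\omega_5,\qquad \theta^3=-\omega_3,\\ \theta^4&=-\omega_1+\omega_2+\Big(a_2+\frac{\kappa_1}{\lambda-\kappa}\Big)\omega_3+\Big(a_2^2+\tfrac85\kappa-\tfrac75\lambda+\tfrac1{10}\frac{\kappa_{11}-a_2\kappa_1}{\kappa-\lambda}-\tfrac12\frac{\kappa_1^2}{(\kappa-\lambda)^2}\Big)\omega_4,\\ \theta^5&=-\omega_2-\Big(a_2+\frac{\kappa_1}{\lambda-\kappa}\Big)\omega_3-\Big(a_2^2+\tfrac{13}{10}\kappa-\tfrac7{10}\lambda+\tfrac1{10}\frac{\kappa_{11}}{\kappa-\lambda}-\tfrac12\frac{\kappa_1^2}{(\kappa-\lambda)^2}\Big)\omega_4\\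 &\quad+\Big(\tfrac3{10}\kappa-\tfrac7{10}\lambda+\tfrac1{10}\frac{a_2\kappa_1}{\lambda-\kappa}\Big)\omega_5 \end{aligned}$$ are invariant forms of $\mathcal D$, and the class of metrics associated with $\mathcal D$ is represented by the corresponding metric $$\tilde g=\theta^1\otimes\theta^5+\theta^5\otimes\theta^1-\theta^2\otimes\theta^4-\theta^4\otimes\theta^2+\tfrac43\,\theta^3\otimes\theta^3,$$ that is, $[\tilde g]=\{f\tilde g: f \text{ a positive smooth function}\}$. -/

import Mathlib

open scoped Manifold ContDiff
open VectorField Bundle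

noncomputable section

namespace RollingSurfaces

/-! ### Vector fields, one-forms and exterior derivatives on a manifold -/

section General

variable {E : Type*} [NormedAddCommGroup E] [NormedSpace ℝ E] {H : Type*} [TopologicalSpace H]
  (I : ModelWithCorners ℝ E H) {M : Type*} [TopologicalSpace M] [ChartedSpace H M]

/-- Vector fields on `M` (no regularity). -/
abbrev VF := Π p : M, TangentSpace I p

/-- One-forms on `M` (no regularity). -/
abbrev OneForm := Π p : M, TangentSpace I p →L[ℝ] ℝ

/-- Fields of bilinear expressions on tangent vectors of `M` (two-forms, metrics; no regularity). -/
abbrev TwoTensor := Π p : M, TangentSpace I p → TangentSpace I p → ℝ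

variable {I}

/-- The vector field `X` is smooth at `p`. -/
def SmoothVFAt [IsManifold I 1 M] (X : VF I (M := M)) (p : M) : Prop :=
  ContMDiffAt I I.tangent ∞ (fun q => (⟨q, X q⟩ : TangentBundle I M)) p

/-- The vector field `X` is smooth. -/
def SmoothVF [IsManifold I 1 M] (X : VF I (M := M)) : Prop := ∀ p, SmoothVFAt X p

/-- The derivative `X ⌟ df` of the function `f` in the direction of the vector field `X`. -/
def dirDeriv (X : VF I (M := M)) (f : M → ℝ) (p : M) : ℝ := mfderiv I 𝓘(ℝ, ℝ) f p (X p)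

/-- A one-form is smooth if it takes smooth values on all (local) smooth vector fields. -/
def SmoothForm [IsManifold I 1 M] (θ : OneForm I (M := M)) : Prop :=
  ∀ (p : M) (X : VF I (M := M)), SmoothVFAt X p →
    ContMDiffAt I 𝓘(ℝ, ℝ) ∞ (fun q => θ q (X q)) p

/-- The wedge product of two one-forms. -/
def wedge (α β : OneForm I (M := M)) : TwoTensor I (M := M) :=
  fun p v w => α p v * β p w - α p w * β p v

/-- `dθ = Φ`, by the invariant formula `dθ(X,Y) = X(θ(Y)) - Y(θ(X)) - θ([X,Y])`
for all (local) smooth vector fields `X`, `Y`. -/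
def HasExtDeriv [IsManifold I 1 M] (θ : OneForm I (M := M)) (Φ : TwoTensor I (M := M)) : Prop :=
  ∀ (p : M) (X Y : VF I (M := M)), SmoothVFAt X p → SmoothVFAt Y p →
    Φ p (X p) (Y p) = dirDeriv X (fun q => θ q (Y q)) p - dirDeriv Y (fun q => θ q (X q)) p
      - θ p (mlieBracket I X Y p)

/-! ### The conformal class of a rank two distribution in dimension five -/

/-- Cartan's exterior differential system for the five forms `θ¹, …, θ⁵` (here `θ 0, …, θ 4`)
and the seven forms `Ω₁, …, Ω₇` (here `Ω 0, …, Ω 6`). -/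
def CartanSystem [IsManifold I 1 M] (θ : Fin 5 → OneForm I (M := M))
    (Ω : Fin 7 → OneForm I (M := M)) : Prop :=
  HasExtDeriv (θ 0)
    (wedge (θ 0) ((2 : ℝ) • Ω 0 + Ω 3) + wedge (θ 1) (Ω 1) + wedge (θ 2) (θ 3)) ∧
  HasExtDeriv (θ 1)
    (wedge (θ 0) (Ω 2) + wedge (θ 1) (Ω 0 + (2 : ℝ) • Ω 3) + wedge (θ 2) (θ 4)) ∧
  HasExtDeriv (θ 2)
    (wedge (θ 0) (Ω 4) + wedge (θ 1) (Ω 5) + wedge (θ 2) (Ω 0 + Ω 3) + wedge (θ 3) (θ 4)) ∧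
  HasExtDeriv (θ 3)
    (wedge (θ 0) (Ω 6) + (4 / 3 : ℝ) • wedge (θ 2) (Ω 5) + wedge (θ 3) (Ω 0)
      + wedge (θ 4) (Ω 1)) ∧
  HasExtDeriv (θ 4)
    (wedge (θ 1) (Ω 6) - (4 / 3 : ℝ) • wedge (θ 2) (Ω 4) + wedge (θ 3) (Ω 2)
      + wedge (θ 4) (Ω 3))

/-- `θ¹, …, θ⁵` are invariant forms of the distribution `D`: a smooth coframe (for `M` of
dimension five) in which `θ¹, θ², θ³` annihilate `D`, that satisfies Cartan's system with some
smooth one-forms `Ω₁, …, Ω₇`. -/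
structure IsInvariantCoframe [IsManifold I 1 M] (D : Π p : M, Set (TangentSpace I p))
    (θ : Fin 5 → OneForm I (M := M)) : Prop where
  smooth : ∀ i, SmoothForm (θ i)
  linearIndependent : ∀ p, LinearIndependent ℝ (fun i => θ i p)
  annihilates : ∀ p, ∀ v ∈ D p, θ 0 p v = 0 ∧ θ 1 p v = 0 ∧ θ 2 p v = 0
  system : ∃ Ω : Fin 7 → OneForm I (M := M), (∀ a, SmoothForm (Ω a)) ∧ CartanSystem θ Ω

/-- The bilinear form
`θ¹⊗θ⁵ + θ⁵⊗θ¹ - θ²⊗θ⁴ - θ⁴⊗θ² + (4/3) θ³⊗θ³`. -/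
def cartanMetric (θ : Fin 5 → OneForm I (M := M)) : TwoTensor I (M := M) := fun p v w =>
  θ 0 p v * θ 4 p w + θ 4 p v * θ 0 p w - θ 1 p v * θ 3 p w - θ 3 p v * θ 1 p w
    + 4 / 3 * (θ 2 p v * θ 2 p w)

/-- The conformal class of a metric: all its multiples by smooth positive functions. -/
def conformalClass (g : TwoTensor I (M := M)) : Set (TwoTensor I (M := M)) :=
  {g' | ∃ f : M → ℝ, ContMDiff I 𝓘(ℝ, ℝ) ∞ f ∧ (∀ p, 0 < f p) ∧
    ∀ p v w, g' p v w = f p * g p v w}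

/-- The class of metrics associated with the distribution `D`: all metrics conformal to
`cartanMetric θ` for some choice of the invariant forms `θ` of `D`. -/
def distributionClass [IsManifold I 1 M] (D : Π p : M, Set (TangentSpace I p)) :
    Set (TwoTensor I (M := M)) :=
  {g | ∃ θ : Fin 5 → OneForm I (M := M), IsInvariantCoframe D θ ∧
    g ∈ conformalClass (cartanMetric θ)}

/-- Connection coefficients `Γⁱ_{jk}` of the Levi-Civita connection of a pseudo-Riemannian metric
`g`, in a frame `e` with `g(e_i,e_j) = η_i δ_ij`, `η_i = ±1`: `∇_{e_k} e_j = ∑ᵢ Γⁱ_{jk} e_i`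
(Koszul's formula). -/
def connCoeff {n : ℕ} (g : TwoTensor I (M := M)) (η : Fin n → ℝ) (e : Fin n → VF I (M := M))
    (i j k : Fin n) (y : M) : ℝ :=
  η i / 2 * (g y (mlieBracket I (e k) (e j) y) (e i y) - g y (mlieBracket I (e j) (e i) y) (e k y)
    + g y (mlieBracket I (e i) (e k) y) (e j y))

end General

/-! ### Surfaces with an orthonormal frame -/

/-- A smooth Riemannian metric on a surface. -/
abbrev SurfaceMetric (S : Type*) [TopologicalSpace S]
    [ChartedSpace (EuclideanSpace ℝ (Fin 2)) S] [IsManifold (𝓡 2) ∞ S] :=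
  ContMDiffRiemannianMetric (𝓡 2) ∞ (EuclideanSpace ℝ (Fin 2))
    (fun x : S => TangentSpace (𝓡 2) x)

section Surface

variable {S : Type*} [TopologicalSpace S]
  [ChartedSpace (EuclideanSpace ℝ (Fin 2)) S] [IsManifold (𝓡 2) ∞ S]

/-- `K` is a Killing vector field of `g`: it is smooth, and `L_K g = 0`, that is
`K(g(X,Y)) = g([K,X],Y) + g(X,[K,Y])` for all (local) smooth vector fields `X`, `Y`. -/
def IsKilling (g : SurfaceMetric S) (K : VF (𝓡 2) (M := S)) : Prop :=
  SmoothVF K ∧ ∀ (x : S) (X Y : VF (𝓡 2) (M := S)), SmoothVFAt X x → SmoothVFAt Y x →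
    dirDeriv K (fun q => g.inner q (X q) (Y q)) x =
      g.inner x (mlieBracket (𝓡 2) K X x) (Y x) + g.inner x (X x) (mlieBracket (𝓡 2) K Y x)

variable (S) in
/-- A Riemannian surface with a smooth orthonormal frame `e 0`, `e 1`. -/
structure FramedSurface where
  metric : SurfaceMetric S
  e : Fin 2 → VF (𝓡 2) (M := S)
  smooth : ∀ i, SmoothVF (e i)
  orthonormal : ∀ x i j, metric.inner x (e i x) (e j x) = if i = j then 1 else 0

namespace FramedSurface

variable (F : FramedSurface S)

/-- The structure functions of the frame: `[e 0, e 1] = a 0 • e 0 + a 1 • e 1`. -/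
def a (i : Fin 2) (x : S) : ℝ := F.metric.inner x (mlieBracket (𝓡 2) (F.e 0) (F.e 1) x) (F.e i x)

/-- The Gaussian curvature, computed in the orthonormal frame. -/
def curv (x : S) : ℝ :=
  dirDeriv (F.e 0) (F.a 1) x - dirDeriv (F.e 1) (F.a 0) x - F.a 0 x ^ 2 - F.a 1 x ^ 2

end FramedSurface

end Surface

/-! ### The twistor space of two rolling surfaces -/

section Twistor

variable {S₁ S₂ : Type*}
  [TopologicalSpace S₁] [ChartedSpace (EuclideanSpace ℝ (Fin 2)) S₁] [IsManifold (𝓡 2) ∞ S₁]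
  [TopologicalSpace S₂] [ChartedSpace (EuclideanSpace ℝ (Fin 2)) S₂] [IsManifold (𝓡 2) ∞ S₂]
  (F₁ : FramedSurface S₁) (F₂ : FramedSurface S₂)

/-- The model of the 4-manifold `S₁ × S₂`. -/
abbrev I4 := (𝓡 2).prod (𝓡 2)

/-- The model of the twistor space. -/
abbrev I5 := (𝓡 2).prod ((𝓡 2).prod 𝓘(ℝ, ℝ))

/-- The metric `g₁ ⊕ (-g₂)` on `S₁ × S₂`. -/
def splitMetric : TwoTensor I4 (M := S₁ × S₂) := fun y v w =>
  F₁.metric.inner y.1 v.1 w.1 - F₂.metric.inner y.2 v.2 w.2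

/-- The orthonormal frame `e₁, e₂, e₃, e₄` of `g₁ ⊕ (-g₂)`, obtained by extending the frames of
the two surfaces trivially to the product. -/
def frame4 : Fin 4 → VF I4 (M := S₁ × S₂) :=
  ![fun y => (F₁.e 0 y.1, 0), fun y => (F₁.e 1 y.1, 0),
    fun y => (0, F₂.e 0 y.2), fun y => (0, F₂.e 1 y.2)]

/-- The squared lengths of the frame vectors. -/
def sign4 : Fin 4 → ℝ := ![1, 1, -1, -1]

/-- Components, in the orthonormal frame, of the vectors `e₁ + cos φ e₃ + sin φ e₄` and
`e₂ - sin φ e₃ + cos φ e₄`, which span the graph of the rotation `A_φ`. -/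
def nullVec (φ : ℝ) : Fin 2 → Fin 4 → ℝ :=
  ![![1, 0, Real.cos φ, Real.sin φ], ![0, 1, -Real.sin φ, Real.cos φ]]

/-- The totally null plane `N(φ)` (the graph of `A_φ`), in components. -/
def nullPlane (φ : ℝ) : Submodule ℝ (Fin 4 → ℝ) := Submodule.span ℝ (Set.range (nullVec φ))

/-- The twistor space, in the coordinates `(x, x̂, φ)`: the point `(x, x̂, φ)` stands for the
totally null plane `N(φ)` in the tangent space of `S₁ × S₂` at `(x, x̂)`; `φ` is the angular
coordinate on the fibre, with values in the universal cover of the circle. -/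
abbrev Twistor (S₁ S₂ : Type*) := S₁ × (S₂ × ℝ)

/-- Components in the orthonormal frame of the projection of the tangent vector `u` of the twistor
space to the tangent space of `S₁ × S₂`. -/
def baseComp (p : Twistor S₁ S₂) (u : TangentSpace I5 p) : Fin 4 → ℝ := fun k =>
  sign4 k * splitMetric F₁ F₂ (p.1, p.2.1) (u.1, u.2.1) (frame4 F₁ F₂ k (p.1, p.2.1))

/-- Components of the Levi-Civita covariant derivative, along a curve through `p` with velocity
`u`, of the section `nullVec φ j` of the moving plane `N(φ)`. -/
def covDerivNullVec (p : Twistor S₁ S₂) (u : TangentSpace I5 p) (j : Fin 2) : Fin 4 → ℝ := fun i =>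
  u.2.2 * deriv (fun t => nullVec t j i) p.2.2
    + ∑ l, ∑ k, connCoeff (splitMetric F₁ F₂) sign4 (frame4 F₁ F₂) i l k (p.1, p.2.1)
        * nullVec p.2.2 j l * baseComp F₁ F₂ p u k

/-- The twistor distribution: at `(x, x̂, φ)` it consists of the horizontal lifts of the vectors of
the plane `N(φ)`. A vector is horizontal if moving along it transports the plane `N(φ)` parallelly
for the Levi-Civita connection, that is, if the covariant derivatives of the spanning sections
of the plane stay in the plane. -/
def twistorDistribution (p : Twistor S₁ S₂) : Set (TangentSpace I5 p) :=
  {u | baseComp F₁ F₂ p u ∈ nullPlane p.2.2 ∧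
    ∀ j, covDerivNullVec F₁ F₂ p u j ∈ nullPlane p.2.2}

/-! #### The frame `e₁, e₂, e₃, e₄, ∂_φ` and its dual coframe on the twistor space -/

/-- The frame vectors of the first surface, on the twistor space (`e₁`, `e₂`). -/
def lift₁ (i : Fin 2) : VF I5 (M := Twistor S₁ S₂) := fun p => (F₁.e i p.1, (0, 0))

/-- The frame vectors of the second surface, on the twistor space (`e₃`, `e₄`). -/
def lift₂ (i : Fin 2) : VF I5 (M := Twistor S₁ S₂) := fun p => (0, (F₂.e i p.2.1, 0))

/-- The vertical vector field `∂_φ`. -/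
def dφ : VF I5 (M := Twistor S₁ S₂) := fun _ => (0, (0, 1))

/-- The forms `σ¹`, `σ²`. -/
def σ₁ (i : Fin 2) : OneForm I5 (M := Twistor S₁ S₂) := fun p =>
  (F₁.metric.inner p.1 (F₁.e i p.1)).comp
    (mfderiv I5 (𝓡 2) (fun q : Twistor S₁ S₂ => q.1) p)

/-- The forms `σ³`, `σ⁴`. -/
def σ₂ (i : Fin 2) : OneForm I5 (M := Twistor S₁ S₂) := fun p =>
  (F₂.metric.inner p.2.1 (F₂.e i p.2.1)).comp
    (mfderiv I5 (𝓡 2) (fun q : Twistor S₁ S₂ => q.2.1) p)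

/-- The form `dφ`. -/
def formφ : OneForm I5 (M := Twistor S₁ S₂) := fun p =>
  mfderiv I5 𝓘(ℝ, ℝ) (fun q : Twistor S₁ S₂ => q.2.2) p

/-! #### The frame `X̃₁, …, X̃₅` (here `X 0, …, X 4`), for `a₁ = a₃ = 0` and `λ` constant -/

/-- `X̃₁ = e₁ + cos φ e₃ + sin φ e₄ + (-a₁ + a₃ cos φ + a₄ sin φ) ∂_φ`. -/
def X₁ : VF I5 (M := Twistor S₁ S₂) := fun p =>
  lift₁ F₁ 0 p + Real.cos p.2.2 • lift₂ F₂ 0 p + Real.sin p.2.2 • lift₂ F₂ 1 p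
    + (-F₁.a 0 p.1 + F₂.a 0 p.2.1 * Real.cos p.2.2 + F₂.a 1 p.2.1 * Real.sin p.2.2) • dφ p

/-- `X̃₂ = e₂ - sin φ e₃ + cos φ e₄ + (-a₂ - a₃ sin φ + a₄ cos φ) ∂_φ`. -/
def X₂ : VF I5 (M := Twistor S₁ S₂) := fun p =>
  lift₁ F₁ 1 p - Real.sin p.2.2 • lift₂ F₂ 0 p + Real.cos p.2.2 • lift₂ F₂ 1 p
    + (-F₁.a 1 p.1 - F₂.a 0 p.2.1 * Real.sin p.2.2 + F₂.a 1 p.2.1 * Real.cos p.2.2) • dφ p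

/-- `κ`, as a function on the twistor space. -/
def κ : Twistor S₁ S₂ → ℝ := fun p => F₁.curv p.1

/-- `κ₁ = e₁(κ)`, as a function on the twistor space. -/
def κ₁ : Twistor S₁ S₂ → ℝ := fun p => dirDeriv (F₁.e 0) F₁.curv p.1

/-- `κ₁₁ = e₁(e₁(κ))`, as a function on the twistor space. -/
def κ₁₁ : Twistor S₁ S₂ → ℝ := fun p => dirDeriv (F₁.e 0) (dirDeriv (F₁.e 0) F₁.curv) p.1

/-- `a₂`, as a function on the twistor space. -/
def a₂ : Twistor S₁ S₂ → ℝ := fun p => F₁.a 1 p.1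

/-- `a₄`, as a function on the twistor space. -/
def a₄ : Twistor S₁ S₂ → ℝ := fun p => F₂.a 1 p.2.1

variable (lam : ℝ)

/-- `X̃₃ = a₂ X̃₂ + (λ - κ) ∂_φ`. -/
def X₃ : VF I5 (M := Twistor S₁ S₂) := fun p =>
  a₂ F₁ p • X₂ F₁ F₂ p + (lam - κ F₁ p) • dφ p

/-- `X̃₄ = (κ + a₂² + a₂ B) X̃₂ - B X̃₃ + (λ - κ)(sin φ e₃ - cos φ e₄)`
with `B = κ₁ / (λ - κ) + a₄ cos φ`. -/
def X₄ : VF I5 (M := Twistor S₁ S₂) := fun p =>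
  (κ F₁ p + a₂ F₁ p ^ 2
      + a₂ F₁ p * (κ₁ F₁ p / (lam - κ F₁ p) + a₄ F₂ p * Real.cos p.2.2)) • X₂ F₁ F₂ p
    - (κ₁ F₁ p / (lam - κ F₁ p) + a₄ F₂ p * Real.cos p.2.2) • X₃ F₁ F₂ lam p
    + (lam - κ F₁ p) • (Real.sin p.2.2 • lift₂ F₂ 0 p - Real.cos p.2.2 • lift₂ F₂ 1 p)

/-- `X̃₅ = -a₂ a₄ sin φ X̃₂ + a₄ sin φ X̃₃ + (λ - κ)(cos φ e₃ + sin φ e₄)`. -/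
def X₅ : VF I5 (M := Twistor S₁ S₂) := fun p =>
  -(a₂ F₁ p * a₄ F₂ p * Real.sin p.2.2) • X₂ F₁ F₂ p
    + (a₄ F₂ p * Real.sin p.2.2) • X₃ F₁ F₂ lam p
    + (lam - κ F₁ p) • (Real.cos p.2.2 • lift₂ F₂ 0 p + Real.sin p.2.2 • lift₂ F₂ 1 p)

/-- The fields `X̃₁, …, X̃₅`. -/
def X : Fin 5 → VF I5 (M := Twistor S₁ S₂) :=
  ![X₁ F₁ F₂, X₂ F₁ F₂, X₃ F₁ F₂ lam, X₄ F₁ F₂ lam, X₅ F₁ F₂ lam]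

/-! #### The explicit forms `ω₁, …, ω₅` and `θ¹, …, θ⁵` -/

/-- The form `ω₁`. -/
def ω₁ : OneForm I5 (M := Twistor S₁ S₂) := σ₁ F₁ 0

/-- The form `ω₂`. -/
def ω₂ : OneForm I5 (M := Twistor S₁ S₂) := fun p =>
  let k := κ F₁ p;
  let k₁ := κ₁ F₁ p;
  let a := a₂ F₁ p;
  let q := a ^ 2 * k + k ^ 2 - a * k₁ - a ^ 2 * lam - k * lam;
  ((2 * a ^ 2 * k + 2 * k ^ 2 - a * k₁ - 2 * a ^ 2 * lam - 3 * k * lam + lam ^ 2)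
      / (k - lam) ^ 2) • σ₁ F₁ 1 p
    + (q * Real.sin p.2.2 / (k - lam) ^ 2) • σ₂ F₂ 0 p
    - ((a * a₄ F₂ p * (k - lam) + q * Real.cos p.2.2) / (k - lam) ^ 2) • σ₂ F₂ 1 p
    + (a / (k - lam)) • formφ p

/-- The form `ω₃`. -/
def ω₃ : OneForm I5 (M := Twistor S₁ S₂) := fun p =>
  let k := κ F₁ p;
  let k₁ := κ₁ F₁ p;
  ((-a₂ F₁ p * (k - lam) + k₁) / (k - lam) ^ 2) • σ₁ F₁ 1 p
    + (k₁ * Real.sin p.2.2 / (k - lam) ^ 2) • σ₂ F₂ 0 p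
    + ((a₄ F₂ p * (k - lam) - k₁ * Real.cos p.2.2) / (k - lam) ^ 2) • σ₂ F₂ 1 p
    - (1 / (k - lam)) • formφ p

/-- The form `ω₄`. -/
def ω₄ : OneForm I5 (M := Twistor S₁ S₂) := fun p =>
  let k := κ F₁ p;
  -((1 / (k - lam)) • σ₁ F₁ 1 p) - (Real.sin p.2.2 / (k - lam)) • σ₂ F₂ 0 p
    + (Real.cos p.2.2 / (k - lam)) • σ₂ F₂ 1 p

/-- The form `ω₅`. -/
def ω₅ : OneForm I5 (M := Twistor S₁ S₂) := fun p =>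
  let k := κ F₁ p;
  (1 / (k - lam)) • σ₁ F₁ 0 p - (Real.cos p.2.2 / (k - lam)) • σ₂ F₂ 0 p
    - (Real.sin p.2.2 / (k - lam)) • σ₂ F₂ 1 p

/-- The forms `ω₁, …, ω₅`. -/
def omegaForm : Fin 5 → OneForm I5 (M := Twistor S₁ S₂) :=
  ![ω₁ F₁, ω₂ F₁ F₂ lam, ω₃ F₁ F₂ lam, ω₄ F₁ F₂ lam, ω₅ F₁ F₂ lam]

/-- The form `θ⁴`. -/
def θ₄ : OneForm I5 (M := Twistor S₁ S₂) := fun p =>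
  let k := κ F₁ p;
  let k₁ := κ₁ F₁ p;
  let k₁₁ := κ₁₁ F₁ p;
  let a := a₂ F₁ p;
  -ω₁ F₁ p + ω₂ F₁ F₂ lam p + (a + k₁ / (lam - k)) • ω₃ F₁ F₂ lam p
    + (a ^ 2 + 8 / 5 * k - 7 / 5 * lam + 1 / 10 * ((k₁₁ - a * k₁) / (k - lam))
        - 1 / 2 * (k₁ ^ 2 / (k - lam) ^ 2)) • ω₄ F₁ F₂ lam p

/-- The form `θ⁵`. -/
def θ₅ : OneForm I5 (M := Twistor S₁ S₂) := fun p =>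
  let k := κ F₁ p;
  let k₁ := κ₁ F₁ p;
  let k₁₁ := κ₁₁ F₁ p;
  let a := a₂ F₁ p;
  -ω₂ F₁ F₂ lam p - (a + k₁ / (lam - k)) • ω₃ F₁ F₂ lam p
    - (a ^ 2 + 13 / 10 * k - 7 / 10 * lam + 1 / 10 * (k₁₁ / (k - lam))
        - 1 / 2 * (k₁ ^ 2 / (k - lam) ^ 2)) • ω₄ F₁ F₂ lam p
    + (3 / 10 * k - 7 / 10 * lam + 1 / 10 * (a * k₁ / (lam - k))) • ω₅ F₁ F₂ lam p

/-- The forms `θ¹, …, θ⁵`. -/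
def thetaForm : Fin 5 → OneForm I5 (M := Twistor S₁ S₂) :=
  ![ω₄ F₁ F₂ lam - ω₅ F₁ F₂ lam, ω₅ F₁ F₂ lam, -ω₃ F₁ F₂ lam, θ₄ F₁ F₂ lam, θ₅ F₁ F₂ lam]

end Twistor

end RollingSurfaces

end

/-! Existence. Evaluated on the frame `Z` dual to `θ`, Cartan's system becomes a linear system for
the 35 numbers `Ω a (Z j)`, with the structure functions of `Z` as data. Its compatibility
conditions are the seventeen linear relations `CartanRelations`, and `cartanSolution` is an explicit
solution. Invariance of a coframe is thus a finite list of identities between structure functions.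

These identities become accessible in the frame consisting of the horizontal lifts of e₁, e₂ and of
the rotated vectors cos φ e₃ + sin φ e₄, -sin φ e₃ + cos φ e₄, together with ∂_φ. Its brackets
involve only a₂, κ, λ and constants: φ and a₄ disappear (`horizontalBracket_eq`). In this frame the
fields X̃ and the forms ω, θ have coefficients rational in a₂, κ, κ₁, κ₁₁, λ. The Killing field
forces a₁ = 0 and e₂(a₂) = e₂(κ) = 0, so all these coefficients vary along e₁ only, with e₁(a₂) = κ
+ a₂². Every bracket is then pure algebra (`radialBracket`), and the commutators, the dualities and
the seventeen relations (`cartanRelations_dualBracket`) are rational identities.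

The distribution itself is cut out by the equations of the graph of the rotation and by dφ = a₄σ⁴ -
a₂σ² (`mem_twistorDistribution_iff`); X̃₁ and X̃₂ span the solutions.

Uniqueness of the class is `CartanSystem.conformal`. Let `T` be the transition matrix between two
solutions of Cartan's system with the same distribution, and give θ⁴, θ⁵ weight one, θ³ weight two,
θ¹, θ² weight three. If `C` is the block of `T` on θ⁴, θ⁵, then in weight zero `T` acts on θ³ by det
C and on θ¹, θ² by (det C)·C. In the next two weights the values of the forms Ω can be eliminated
(`transition_first_order`, `transition_second_order_left`, `transition_second_order_right`). This
fixes the remaining entries relevant to the metric up to two parameters and one trace, and a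
transition of this kind multiplies the metric by (det C)². -/

set_option linter.unusedSectionVars false
set_option linter.unusedSimpArgs false

noncomputable section

namespace RollingSurfaces

/-! ### Derivations, Lie brackets and tangent vectors on a manifold. -/

section Calculus

variable {E : Type*} [NormedAddCommGroup E] [NormedSpace ℝ E] {H : Type*} [TopologicalSpace H]
  {I : ModelWithCorners ℝ E H} {M : Type*} [TopologicalSpace M] [ChartedSpace H M]

/-! ### Directional derivatives -/

section DirDeriv

variable {X : VF I (M := M)} {f g : M → ℝ} {p : M}

theorem dirDeriv_eq_mvfderiv (X : VF I (M := M)) (f : M → ℝ) (p : M) :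
    dirDeriv X f p = mvfderiv I f p (X p) := rfl

theorem dirDeriv_const (X : VF I (M := M)) (c : ℝ) (p : M) :
    dirDeriv X (fun _ => c) p = 0 := by
  rw [dirDeriv_eq_mvfderiv, mvfderiv_const]; rfl

theorem dirDeriv_fun_add (hf : MDifferentiableAt I 𝓘(ℝ, ℝ) f p)
    (hg : MDifferentiableAt I 𝓘(ℝ, ℝ) g p) :
    dirDeriv X (fun q => f q + g q) p = dirDeriv X f p + dirDeriv X g p := by
  have : (fun q => f q + g q) = f + g := rfl
  rw [this, dirDeriv_eq_mvfderiv, mvfderiv_add hf hg]; rfl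

theorem dirDeriv_fun_neg : dirDeriv X (fun q => -f q) p = -dirDeriv X f p := by
  have : (fun q => -f q) = -f := rfl
  rw [this, dirDeriv_eq_mvfderiv, mvfderiv_neg]; rfl

theorem dirDeriv_fun_sub (hf : MDifferentiableAt I 𝓘(ℝ, ℝ) f p)
    (hg : MDifferentiableAt I 𝓘(ℝ, ℝ) g p) :
    dirDeriv X (fun q => f q - g q) p = dirDeriv X f p - dirDeriv X g p := by
  have : (fun q => f q - g q) = f - g := rfl
  rw [this, dirDeriv_eq_mvfderiv, mvfderiv_sub hf hg]; rfl

theorem dirDeriv_fun_mul (hf : MDifferentiableAt I 𝓘(ℝ, ℝ) f p)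
    (hg : MDifferentiableAt I 𝓘(ℝ, ℝ) g p) :
    dirDeriv X (fun q => f q * g q) p = f p * dirDeriv X g p + g p * dirDeriv X f p := by
  have : (fun q => f q * g q) = f * g := rfl
  rw [this, dirDeriv_eq_mvfderiv, mvfderiv_mul hf hg]; rfl

theorem dirDeriv_comp_real {F : ℝ → ℝ} {F' : ℝ} (hF : HasDerivAt F F' (f p))
    (hf : MDifferentiableAt I 𝓘(ℝ, ℝ) f p) :
    dirDeriv X (fun q => F (f q)) p = F' * dirDeriv X f p := by
  have h1 : HasMFDerivAt 𝓘(ℝ, ℝ) 𝓘(ℝ, ℝ) F (f p)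
      (ContinuousLinearMap.toSpanSingleton ℝ F') := hF.hasFDerivAt.hasMFDerivAt
  have h := (h1.comp p hf.hasMFDerivAt).mfderiv
  have h2 : dirDeriv X (fun q => F (f q)) p = mfderiv I 𝓘(ℝ, ℝ) (F ∘ f) p (X p) := rfl
  rw [h2, h]
  exact mul_comm (dirDeriv X f p) F'

theorem dirDeriv_congr_field {X Y : VF I (M := M)} (h : X p = Y p) :
    dirDeriv X f p = dirDeriv Y f p := by
  simp only [dirDeriv_eq_mvfderiv, h]

theorem dirDeriv_sum_smul {ι : Type*} [Fintype ι] (u : ι → M → ℝ) (Z : ι → VF I (M := M)) :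
    dirDeriv (fun q => ∑ i, u i q • Z i q) f p = ∑ i, u i p * dirDeriv (Z i) f p := by
  simp only [dirDeriv_eq_mvfderiv, map_sum, map_smul, smul_eq_mul]

end DirDeriv

/-! ### Smooth vector fields -/

variable [IsManifold I ∞ M]

theorem SmoothVFAt.mdifferentiableAt {X : VF I (M := M)} {p : M}
    (hX : SmoothVFAt X p) :
    MDifferentiableAt I I.tangent (fun q => (⟨q, X q⟩ : TangentBundle I M)) p :=
  ContMDiffAt.mdifferentiableAt hX (by simp)

theorem SmoothVFAt.smul {f : M → ℝ} {X : VF I (M := M)} {p : M}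
    (hf : ContMDiffAt I 𝓘(ℝ, ℝ) ∞ f p)
    (hX : SmoothVFAt X p) : SmoothVFAt (fun q => f q • X q) p :=
  ContMDiffAt.smul_section hf hX

theorem SmoothVFAt.sum_smul {ι : Type*} [Fintype ι] {u : ι → M → ℝ}
    {Z : ι → VF I (M := M)}
    {p : M} (hu : ∀ i, ContMDiffAt I 𝓘(ℝ, ℝ) ∞ (u i) p) (hZ : ∀ i, SmoothVFAt (Z i) p) :
    SmoothVFAt (fun q => ∑ i, u i q • Z i q) p :=
  ContMDiffAt.sum_section fun i _ => SmoothVFAt.smul (hu i) (hZ i)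

theorem SmoothVFAt.bracket [CompleteSpace E] {X Y : VF I (M := M)} {p : M}
    (hX : SmoothVFAt X p) (hY : SmoothVFAt Y p) : SmoothVFAt (mlieBracket I X Y) p := by
  have : IsManifold I (minSmoothness ℝ 2) M := by
    rw [minSmoothness_of_isRCLikeNormedField]; infer_instance
  have : IsManifold I (((⊤ : ℕ∞) : WithTop ℕ∞) + 1) M := by
    simpa using ‹IsManifold I ∞ M›
  exact ContMDiffAt.mlieBracket_vectorField (m := ⊤) (n := ⊤) hX hY
    (by rw [minSmoothness_of_isRCLikeNormedField]; simp)

/-- The differential of `f` applied to `X` is a smooth section, along `f`, of the tangent bundle of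
the line; the derivative is its fibre coordinate. -/
theorem SmoothVFAt.dirDeriv {X : VF I (M := M)} {f : M → ℝ} {p : M}
    (hX : SmoothVFAt X p)
    (hf : ContMDiffAt I 𝓘(ℝ, ℝ) ∞ f p) : ContMDiffAt I 𝓘(ℝ, ℝ) ∞ (dirDeriv X f) p := by
  have h1 := hf.mfderiv_const (m := ∞) (by simp)
  have h2 := ContMDiffAt.clm_apply_of_inCoordinates (F₁ := E) (F₂ := ℝ)
    (E₁ := fun q : M => TangentSpace I q) (E₂ := fun q : ℝ => TangentSpace 𝓘(ℝ, ℝ) q)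
    (ϕ := fun m => mfderiv I 𝓘(ℝ, ℝ) f m) (b₁ := id) (b₂ := f) (v := fun m => X m)
    (m₀ := p) h1 hX hf
  exact (contMDiff_snd_tangentBundle_modelSpace ℝ 𝓘(ℝ, ℝ)).contMDiffAt.comp p h2

/-! ### Lie brackets -/

section Bracket

variable [CompleteSpace E]

theorem mlieBracket_fun_smul_right {X Y : VF I (M := M)} {f : M → ℝ} {p : M}
    (hf : MDifferentiableAt I 𝓘(ℝ, ℝ) f p) (hY : SmoothVFAt Y p) :
    mlieBracket I X (fun q => f q • Y q) p = dirDeriv X f p • Y p + f p • mlieBracket I X Y p :=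
  mlieBracket_smul_right hf hY.mdifferentiableAt

theorem mlieBracket_fun_smul_left {X Y : VF I (M := M)} {f : M → ℝ} {p : M}
    (hf : MDifferentiableAt I 𝓘(ℝ, ℝ) f p) (hX : SmoothVFAt X p) :
    mlieBracket I (fun q => f q • X q) Y p = -dirDeriv Y f p • X p + f p • mlieBracket I X Y p :=
  mlieBracket_smul_left hf hX.mdifferentiableAt

theorem mlieBracket_fun_add_right {X Y Z : VF I (M := M)} {p : M}
    (hY : SmoothVFAt Y p) (hZ : SmoothVFAt Z p) :
    mlieBracket I X (fun q => Y q + Z q) p = mlieBracket I X Y p + mlieBracket I X Z p :=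
  mlieBracket_add_right hY.mdifferentiableAt hZ.mdifferentiableAt

theorem mlieBracket_finset_sum_smul_right {ι : Type*} (s : Finset ι)
    {u : ι → M → ℝ}
    {X : VF I (M := M)} {Z : ι → VF I (M := M)} {p : M}
    (hu : ∀ i, ContMDiffAt I 𝓘(ℝ, ℝ) ∞ (u i) p) (hZ : ∀ i, SmoothVFAt (Z i) p) :
    mlieBracket I X (fun q => ∑ i ∈ s, u i q • Z i q) p =
      ∑ i ∈ s, (dirDeriv X (u i) p • Z i p + u i p • mlieBracket I X (Z i) p) := by
  classical
  induction s using Finset.induction_on with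
  | empty =>
    have : (fun q : M => ∑ i ∈ (∅ : Finset ι), u i q • Z i q) = (0 : VF I (M := M)) := by
      funext q; simp
    rw [this, mlieBracket_zero_right]; simp
  | insert a s ha ih =>
    have : (fun q : M => ∑ i ∈ insert a s, u i q • Z i q) =
        fun q => u a q • Z a q + ∑ i ∈ s, u i q • Z i q := by
      funext q; rw [Finset.sum_insert ha]
    rw [this, mlieBracket_fun_add_right (SmoothVFAt.smul (hu a) (hZ a))
      (ContMDiffAt.sum_section fun i _ => SmoothVFAt.smul (hu i) (hZ i)), ih,
      mlieBracket_fun_smul_right ((hu a).mdifferentiableAt (by simp)) (hZ a),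
      Finset.sum_insert ha]

/-- The bracket of two fields expanded in a family of smooth fields. -/
theorem mlieBracket_sum_smul {ι : Type*} [Fintype ι] {u v : ι → M → ℝ}
    {Z : ι → VF I (M := M)}
    {p : M} (hu : ∀ i, ContMDiffAt I 𝓘(ℝ, ℝ) ∞ (u i) p)
    (hv : ∀ i, ContMDiffAt I 𝓘(ℝ, ℝ) ∞ (v i) p) (hZ : ∀ i, SmoothVFAt (Z i) p) :
    mlieBracket I (fun q => ∑ i, u i q • Z i q) (fun q => ∑ i, v i q • Z i q) p =
      ∑ k, (∑ i, (u i p * dirDeriv (Z i) (v k) p - v i p * dirDeriv (Z i) (u k) p)) • Z k p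
        + ∑ i, ∑ j, (u i p * v j p) • mlieBracket I (Z i) (Z j) p := by
  rw [mlieBracket_finset_sum_smul_right _ hv hZ]
  -- Antisymmetry carries the expansion in the right argument over to the left one.
  have h2 : ∀ j, mlieBracket I (fun q => ∑ i, u i q • Z i q) (Z j) p =
      ∑ i, (-(dirDeriv (Z j) (u i) p • Z i p) + u i p • mlieBracket I (Z i) (Z j) p) := by
    intro j
    rw [mlieBracket_swap_apply, mlieBracket_finset_sum_smul_right _ hu hZ,
      ← Finset.sum_neg_distrib]
    refine Finset.sum_congr rfl fun i _ => ?_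
    rw [mlieBracket_swap_apply (V := Z j), smul_neg]; abel
  simp only [h2, dirDeriv_sum_smul, Finset.sum_sub_distrib, sub_smul, Finset.sum_add_distrib,
    Finset.smul_sum, smul_add, smul_neg, smul_smul, Finset.sum_smul, Finset.sum_neg_distrib]
  rw [sub_eq_add_neg, add_assoc]
  congr 2
  · rw [Finset.sum_comm]
  · rw [Finset.sum_comm]
    exact Finset.sum_congr rfl fun i _ => Finset.sum_congr rfl fun j _ => by rw [mul_comm]

/-- The bracket acts on functions as the commutator of derivations. The auxiliary field `W` is any
smooth field that does not vanish at the point. -/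
theorem dirDeriv_mlieBracket {X Y W : VF I (M := M)} {f : M → ℝ} {p : M}
    (hX : SmoothVFAt X p) (hY : SmoothVFAt Y p) (hW : SmoothVFAt W p) (hWp : W p ≠ 0)
    (hf : ContMDiffAt I 𝓘(ℝ, ℝ) ∞ f p) :
    dirDeriv (mlieBracket I X Y) f p =
      dirDeriv X (dirDeriv Y f) p - dirDeriv Y (dirDeriv X f) p := by
  have : IsManifold I (minSmoothness ℝ 3) M := by
    rw [minSmoothness_of_isRCLikeNormedField]
    exact IsManifold.of_le (n := ∞) ENat.LEInfty.out
  have two : (minSmoothness ℝ 2) ≤ (∞ : WithTop ℕ∞) := by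
    rw [minSmoothness_of_isRCLikeNormedField]; exact ENat.LEInfty.out
  have hd : ∀ {g : M → ℝ}, ContMDiffAt I 𝓘(ℝ, ℝ) ∞ g p → MDifferentiableAt I 𝓘(ℝ, ℝ) g p :=
    fun h => h.mdifferentiableAt (by simp)
  -- The Leibniz rule is needed on a neighbourhood, since the bracket that it computes is bracketed
  -- once more.
  have ev : ∀ {A B : VF I (M := M)}, SmoothVFAt B p →
      mlieBracket I A (fun q => f q • B q) =ᶠ[nhds p]
        fun q => dirDeriv A f q • B q + f q • mlieBracket I A B q := by
    intro A B hB
    have e1 : ∀ᶠ q in nhds p, ContMDiffAt I 𝓘(ℝ, ℝ) 1 f q :=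
      (contMDiffAt_iff_contMDiffAt_nhds (by simp)).1 (hf.of_le ENat.LEInfty.out)
    have e2 : ∀ᶠ q in nhds p,
        ContMDiffAt I I.tangent 1 (fun q => (⟨q, B q⟩ : TangentBundle I M)) q :=
      (contMDiffAt_iff_contMDiffAt_nhds (by simp)).1 (ContMDiffAt.of_le hB ENat.LEInfty.out)
    filter_upwards [e1, e2] with q h1 h2
    exact mlieBracket_smul_right (h1.mdifferentiableAt (by simp))
      (h2.mdifferentiableAt (by simp))
  -- Jacobi's identity for X, Y, fW, with the one for X, Y, W inserted, leaves only a multiple of `W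
  -- p`. Its coefficient is the difference of the two sides of the claim.
  have jac := leibniz_identity_mlieBracket_apply (I := I) (U := X) (V := Y)
    (W := fun q => f q • W q)
    (ContMDiffAt.of_le hX two) (ContMDiffAt.of_le hY two)
    (ContMDiffAt.of_le (SmoothVFAt.smul hf hW) two)
  have jac0 := leibniz_identity_mlieBracket_apply (I := I) (U := X) (V := Y) (W := W)
    (ContMDiffAt.of_le hX two) (ContMDiffAt.of_le hY two) (ContMDiffAt.of_le hW two)
  have eX := Filter.EventuallyEq.mlieBracket_vectorField_eq (I := I)
    (Filter.EventuallyEq.refl (nhds p) X) (ev (A := Y) hW)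
  have eY := Filter.EventuallyEq.mlieBracket_vectorField_eq (I := I)
    (Filter.EventuallyEq.refl (nhds p) Y) (ev (A := X) hW)
  rw [eX, eY,
    mlieBracket_fun_add_right (SmoothVFAt.smul (hY.dirDeriv hf) hW)
      (SmoothVFAt.smul hf (hY.bracket hW)),
    mlieBracket_fun_add_right (SmoothVFAt.smul (hX.dirDeriv hf) hW)
      (SmoothVFAt.smul hf (hX.bracket hW)),
    mlieBracket_fun_smul_right (hd (hY.dirDeriv hf)) hW,
    mlieBracket_fun_smul_right (hd (hX.dirDeriv hf)) hW,
    mlieBracket_fun_smul_right (hd hf) (hY.bracket hW),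
    mlieBracket_fun_smul_right (hd hf) (hX.bracket hW),
    mlieBracket_fun_smul_right (hd hf) hW, jac0] at jac
  have key : (dirDeriv (mlieBracket I X Y) f p -
      (dirDeriv X (dirDeriv Y f) p - dirDeriv Y (dirDeriv X f) p)) • W p = 0 := by
    rw [sub_smul, sub_smul, sub_eq_zero]
    rw [smul_add] at jac
    rw [← sub_eq_zero] at jac ⊢
    rw [← neg_eq_zero, ← jac]
    abel
  rcases smul_eq_zero.1 key with h | h
  · exact sub_eq_zero.1 h
  · exact absurd h hWp

end Bracket

/-- A tangent vector that annihilates all functions smooth at the point vanishes. -/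
theorem eq_zero_of_mfderiv_eq_zero {p : M} (v : TangentSpace I p)
    (h : ∀ f : M → ℝ, ContMDiffAt I 𝓘(ℝ, ℝ) ∞ f p → mfderiv I 𝓘(ℝ, ℝ) f p v = 0) : v = 0 := by
  have hc : ContMDiffAt I 𝓘(ℝ, E) ∞ (extChartAt I p) p := contMDiffAt_extChartAt
  have hinv : (mfderiv I 𝓘(ℝ, E) (extChartAt I p) p).IsInvertible :=
    isInvertible_mfderiv_extChartAt (mem_extChartAt_source p)
  have hz : mfderiv I 𝓘(ℝ, E) (extChartAt I p) p v = 0 := by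
    -- The test functions are linear functionals composed with the chart: they separate vectors, and
    -- the differential of the chart is invertible.
    refine SeparatingDual.eq_zero_of_forall_dual_eq_zero (R := ℝ) (V := E) fun ℓ => ?_
    have hl : ContMDiff 𝓘(ℝ, E) 𝓘(ℝ, ℝ) ∞ ℓ := ℓ.contMDiff
    have := h (ℓ ∘ extChartAt I p) (hl.contMDiffAt.comp p hc)
    rw [mfderiv_comp p (hl.contMDiffAt.mdifferentiableAt (by simp))
      (hc.mdifferentiableAt (by simp))] at this
    rw [ContinuousLinearMap.mfderiv_eq] at this
    exact this
  obtain ⟨e, he⟩ := hinv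
  rw [← he] at hz
  exact e.map_eq_zero_iff.1 hz

end Calculus

/-! ### Coframes, structure functions and Cartan's system on a frame. -/

section Coframes

variable {E : Type*} [NormedAddCommGroup E] [NormedSpace ℝ E] {H : Type*} [TopologicalSpace H]
  {I : ModelWithCorners ℝ E H} {M : Type*} [TopologicalSpace M] [ChartedSpace H M]
  [IsManifold I ∞ M]

/-! ### Smooth one-forms -/

theorem SmoothForm.sum_smul {ι : Type*} [Fintype ι] {f : ι → M → ℝ} {α : ι → OneForm I (M := M)}
    (hf : ∀ i, ContMDiff I 𝓘(ℝ, ℝ) ∞ (f i)) (hα : ∀ i, SmoothForm (α i)) :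
    SmoothForm (fun p => ∑ i, f i p • α i p) := by
  intro p X hX
  have : (fun q => (∑ i, f i q • α i q) (X q)) = fun q => ∑ i, f i q * α i q (X q) := by
    funext q
    simp only [sum_apply, smul_apply, smul_eq_mul]
  rw [this]
  exact contMDiffAt_finsetSum fun i _ => (hf i p).mul (hα i p X hX)

/-! ### Dual frames and exterior derivatives -/

/-- `Z` is a smooth frame and `θ` is its smooth dual coframe. -/
structure IsDualFrame {ι : Type*} [Fintype ι] [DecidableEq ι] (θ : ι → OneForm I (M := M))
    (Z : ι → VF I (M := M)) : Prop where
  smoothForm : ∀ i, SmoothForm (θ i)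
  smoothVF : ∀ i, SmoothVF (Z i)
  dual : ∀ i j p, θ i p (Z j p) = if i = j then 1 else 0
  expand : ∀ p (v : TangentSpace I p), ∑ i, θ i p v • Z i p = v

/-- A field of expressions in two tangent vectors that is determined bilinearly by its values on
the frame `Z` with dual coframe `θ`. -/
def IsBilinearIn {ι : Type*} [Fintype ι] (θ : ι → OneForm I (M := M))
    (Z : ι → VF I (M := M)) (Φ : TwoTensor I (M := M)) : Prop :=
  ∀ p v w, Φ p v w = ∑ j, ∑ k, θ j p v * θ k p w * Φ p (Z j p) (Z k p)

namespace IsDualFrame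

variable {ι : Type*} [Fintype ι] [DecidableEq ι] {θ : ι → OneForm I (M := M)}
  {Z : ι → VF I (M := M)} {Φ Ψ : TwoTensor I (M := M)}

theorem _root_.RollingSurfaces.IsBilinearIn.add (h : IsBilinearIn θ Z Φ)
    (h' : IsBilinearIn θ Z Ψ) : IsBilinearIn θ Z (Φ + Ψ) := by
  intro p v w
  simp only [Pi.add_apply, mul_add, Finset.sum_add_distrib]
  rw [← h, ← h']

theorem _root_.RollingSurfaces.IsBilinearIn.smul (c : ℝ) (h : IsBilinearIn θ Z Φ) :
    IsBilinearIn θ Z (c • Φ) := by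
  intro p v w
  simp only [Pi.smul_apply, smul_eq_mul, mul_left_comm _ c, ← Finset.mul_sum]
  rw [← h]

theorem _root_.RollingSurfaces.IsBilinearIn.sub (h : IsBilinearIn θ Z Φ)
    (h' : IsBilinearIn θ Z Ψ) : IsBilinearIn θ Z (Φ - Ψ) := by
  intro p v w
  simp only [Pi.sub_apply, mul_sub, Finset.sum_sub_distrib]
  rw [← h, ← h']

theorem apply_eq_sum (h : IsDualFrame θ Z) (α : OneForm I (M := M)) (p : M)
    (v : TangentSpace I p) : α p v = ∑ j, θ j p v * α p (Z j p) := by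
  conv_lhs => rw [← h.expand p v]
  simp only [map_sum, map_smul, smul_eq_mul]

theorem isBilinearIn_wedge (h : IsDualFrame θ Z) (α β : OneForm I (M := M)) :
    IsBilinearIn θ Z (wedge α β) := by
  intro p v w
  simp only [wedge]
  rw [h.apply_eq_sum α p v, h.apply_eq_sum β p w, h.apply_eq_sum α p w, h.apply_eq_sum β p v,
    Finset.sum_mul_sum, mul_comm (∑ j, θ j p w * α p (Z j p)), Finset.sum_mul_sum,
    ← Finset.sum_sub_distrib]
  refine Finset.sum_congr rfl fun j _ => ?_
  rw [← Finset.sum_sub_distrib]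
  exact Finset.sum_congr rfl fun k _ => by ring

variable [CompleteSpace E]

/-- The structure functions `θ i ([Z j, Z k])`. -/
def structureFun (θ : ι → OneForm I (M := M)) (Z : ι → VF I (M := M)) (i j k : ι) (p : M) : ℝ :=
  θ i p (mlieBracket I (Z j) (Z k) p)

theorem contMDiff_structureFun (h : IsDualFrame θ Z) (i j k : ι) :
    ContMDiff I 𝓘(ℝ, ℝ) ∞ (structureFun θ Z i j k) := fun p =>
  h.smoothForm i p _ ((h.smoothVF j p).bracket (h.smoothVF k p))

theorem structureFun_swap (i j k : ι) (p : M) :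
    structureFun θ Z i j k p = -structureFun θ Z i k j p := by
  simp only [structureFun]
  rw [mlieBracket_swap_apply, map_neg]

/-- The exterior derivatives of the dual coframe are given by the structure functions. -/
theorem hasExtDeriv (h : IsDualFrame θ Z) (i : ι) (hΦ : IsBilinearIn θ Z Φ)
    (hc : ∀ p j k, Φ p (Z j p) (Z k p) = -structureFun θ Z i j k p) : HasExtDeriv (θ i) Φ := by
  intro p X Y hX hY
  -- The right-hand side of the formula for dθ is tensorial: once `X` and `Y` are expanded in `Z`,
  -- the derivatives of their components cancel and only the brackets of the `Z j` survive.
  have hXe : X = fun q => ∑ j, θ j q (X q) • Z j q := funext fun q => (h.expand q (X q)).symm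
  have hYe : Y = fun q => ∑ j, θ j q (Y q) • Z j q := funext fun q => (h.expand q (Y q)).symm
  have hb : mlieBracket I X Y p = mlieBracket I (fun q => ∑ j, θ j q (X q) • Z j q)
      (fun q => ∑ j, θ j q (Y q) • Z j q) p := by rw [← hXe, ← hYe]
  rw [hb, mlieBracket_sum_smul (fun j => h.smoothForm j p X hX) (fun j => h.smoothForm j p Y hY)
    (fun j => h.smoothVF j p), hΦ p]
  have d1 : dirDeriv X (fun q => θ i q (Y q)) p =
      ∑ j, θ j p (X p) * dirDeriv (Z j) (fun q => θ i q (Y q)) p := by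
    rw [dirDeriv_congr_field (Y := fun q => ∑ j, θ j q (X q) • Z j q) (h.expand p (X p)).symm,
      dirDeriv_sum_smul]
  have d2 : dirDeriv Y (fun q => θ i q (X q)) p =
      ∑ j, θ j p (Y p) * dirDeriv (Z j) (fun q => θ i q (X q)) p := by
    rw [dirDeriv_congr_field (Y := fun q => ∑ j, θ j q (Y q) • Z j q) (h.expand p (Y p)).symm,
      dirDeriv_sum_smul]
  simp only [d1, d2, map_add, map_sum, map_smul, smul_eq_mul, h.dual, mul_ite, mul_one, mul_zero,
    Finset.sum_ite_eq, Finset.mem_univ, if_true, hc, Finset.sum_sub_distrib]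
  simp only [structureFun, mul_neg, Finset.sum_neg_distrib]
  ring

end IsDualFrame

/-! ### Cartan's system in a frame -/

/-- The two-forms on the right-hand sides of Cartan's system. -/
def cartanForm (θ : Fin 5 → OneForm I (M := M)) (Ω : Fin 7 → OneForm I (M := M)) :
    Fin 5 → TwoTensor I (M := M) :=
  ![wedge (θ 0) ((2 : ℝ) • Ω 0 + Ω 3) + wedge (θ 1) (Ω 1) + wedge (θ 2) (θ 3),
    wedge (θ 0) (Ω 2) + wedge (θ 1) (Ω 0 + (2 : ℝ) • Ω 3) + wedge (θ 2) (θ 4),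
    wedge (θ 0) (Ω 4) + wedge (θ 1) (Ω 5) + wedge (θ 2) (Ω 0 + Ω 3) + wedge (θ 3) (θ 4),
    wedge (θ 0) (Ω 6) + (4 / 3 : ℝ) • wedge (θ 2) (Ω 5) + wedge (θ 3) (Ω 0) + wedge (θ 4) (Ω 1),
    wedge (θ 1) (Ω 6) - (4 / 3 : ℝ) • wedge (θ 2) (Ω 4) + wedge (θ 3) (Ω 2) + wedge (θ 4) (Ω 3)]

theorem cartanSystem_iff (θ : Fin 5 → OneForm I (M := M)) (Ω : Fin 7 → OneForm I (M := M)) :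
    CartanSystem θ Ω ↔ ∀ i, HasExtDeriv (θ i) (cartanForm θ Ω i) := by
  simp only [Fin.forall_fin_succ, IsEmpty.forall_iff, and_true]
  exact Iff.rfl

/-- The values of the two-forms of Cartan's system, in terms of the values `x`, `y` of the coframe
and the values `u`, `v` of the forms `Ω` on two vectors. -/
def cartanExpr (x y : Fin 5 → ℝ) (u v : Fin 7 → ℝ) : Fin 5 → ℝ :=
  ![(x 0 * (2 * v 0 + v 3) - y 0 * (2 * u 0 + u 3)) + (x 1 * v 1 - y 1 * u 1)
      + (x 2 * y 3 - y 2 * x 3),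
    (x 0 * v 2 - y 0 * u 2) + (x 1 * (v 0 + 2 * v 3) - y 1 * (u 0 + 2 * u 3))
      + (x 2 * y 4 - y 2 * x 4),
    (x 0 * v 4 - y 0 * u 4) + (x 1 * v 5 - y 1 * u 5) + (x 2 * (v 0 + v 3) - y 2 * (u 0 + u 3))
      + (x 3 * y 4 - y 3 * x 4),
    (x 0 * v 6 - y 0 * u 6) + 4 / 3 * (x 2 * v 5 - y 2 * u 5) + (x 3 * v 0 - y 3 * u 0)
      + (x 4 * v 1 - y 4 * u 1),
    (x 1 * v 6 - y 1 * u 6) - 4 / 3 * (x 2 * v 4 - y 2 * u 4) + (x 3 * v 2 - y 3 * u 2)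
      + (x 4 * v 3 - y 4 * u 3)]

theorem cartanForm_apply (θ : Fin 5 → OneForm I (M := M)) (Ω : Fin 7 → OneForm I (M := M))
    (i : Fin 5) (p : M) (v w : TangentSpace I p) :
    cartanForm θ Ω i p v w =
      cartanExpr (fun j => θ j p v) (fun j => θ j p w) (fun a => Ω a p v) (fun a => Ω a p w) i := by
  fin_cases i <;> rfl

theorem isBilinearIn_cartanForm {θ : Fin 5 → OneForm I (M := M)} {Z : Fin 5 → VF I (M := M)}
    (h : IsDualFrame θ Z) (Ω : Fin 7 → OneForm I (M := M)) (i : Fin 5) :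
    IsBilinearIn θ Z (cartanForm θ Ω i) := by
  have w := h.isBilinearIn_wedge
  fin_cases i
  · exact ((w _ _).add (w _ _)).add (w _ _)
  · exact ((w _ _).add (w _ _)).add (w _ _)
  · exact (((w _ _).add (w _ _)).add (w _ _)).add (w _ _)
  · exact (((w _ _).add ((w _ _).smul _)).add (w _ _)).add (w _ _)
  · exact (((w _ _).sub ((w _ _).smul _)).add (w _ _)).add (w _ _)

end Coframes

/-! ### Solvability of Cartan's system in terms of structure functions. -/

section CartanOfStructure

/-- The linear relations among the structure functions `c i j k = θ i ([Z j, Z k])` of a frame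
`Z` that are equivalent to the solvability of Cartan's system for the dual coframe. -/
structure CartanRelations (c : Fin 5 → Fin 5 → Fin 5 → ℝ) : Prop where
  c024 : c 0 2 4 = 0
  c234 : c 2 3 4 = -1
  c123 : c 1 2 3 = 0
  c034 : c 0 3 4 = 0
  c134 : c 1 3 4 = 0
  c124 : c 1 2 4 = -1
  c023 : c 0 2 3 = -1
  c323 : c 3 2 3 = -2 / 3 * c 0 0 2 + 1 / 3 * c 1 1 2 + 4 / 3 * c 2 1 3
  c324 : c 3 2 4 = -c 0 1 2 + 4 / 3 * c 2 1 4
  c334 : c 3 3 4 = c 0 0 4 - c 0 1 3 - c 2 2 4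
  c423 : c 4 2 3 = -c 1 0 2 - 4 / 3 * c 2 0 3
  c424 : c 4 2 4 = 1 / 3 * c 0 0 2 - 2 / 3 * c 1 1 2 - 4 / 3 * c 2 0 4
  c434 : c 4 3 4 = c 0 0 3 + c 1 0 4 - 2 * c 2 2 3
  c223 : 3 * c 2 2 3 = c 0 0 3 + c 1 1 3
  c224 : 3 * c 2 2 4 = c 0 0 4 + c 1 1 4
  c101 : c 1 0 1 = c 3 0 3 + 2 * c 4 0 4 - c 4 1 3
  c001 : c 0 0 1 = c 3 0 4 - 2 * c 3 1 3 - c 4 1 4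

/-- A solution `Ω a (Z j)` of Cartan's system, in terms of the structure functions. -/
def cartanSolution (c : Fin 5 → Fin 5 → Fin 5 → ℝ) : Fin 7 → Fin 5 → ℝ :=
  ![![c 3 0 3, c 3 1 3, -2 / 3 * c 0 0 2 + 1 / 3 * c 1 1 2, -c 0 0 3 + c 2 2 3,
      -c 0 0 4 + c 2 2 4],
    ![c 3 0 4, c 3 1 4, -c 0 1 2, -c 0 1 3, -c 0 1 4],
    ![c 4 0 3, c 4 1 3, -c 1 0 2, -c 1 0 3, -c 1 0 4],
    ![c 4 0 4, c 4 1 4, 1 / 3 * c 0 0 2 - 2 / 3 * c 1 1 2, c 0 0 3 - 2 * c 2 2 3,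
      c 0 0 4 - 2 * c 2 2 4],
    ![-3 / 4 * c 4 0 2, -1 / 2 * c 2 0 1 + 3 / 8 * c 3 0 2 - 3 / 8 * c 4 1 2,
      -c 2 0 2 + c 3 0 3 + c 4 0 4, -c 2 0 3, -c 2 0 4],
    ![1 / 2 * c 2 0 1 + 3 / 8 * c 3 0 2 - 3 / 8 * c 4 1 2, 3 / 4 * c 3 1 2,
      -c 2 1 2 + c 3 1 3 + c 4 1 4, -c 2 1 3, -c 2 1 4],
    -- The two zeros are a choice: the homogeneous system has a two-dimensional solution space,
    -- parametrised by the values of Ω₇ on `Z 3` and `Z 4`.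
    ![c 4 0 1, -c 3 0 1, 2 / 3 * c 2 0 1 - 1 / 2 * c 3 0 2 - 1 / 2 * c 4 1 2, 0, 0]]

-- Ten pairs of frame fields and five forms give fifty linear equations in 35 unknowns. The solution
-- space has two parameters, so the rank is 33, and the 17 remaining conditions are the hypotheses.
set_option maxHeartbeats 2000000 in
theorem CartanRelations.cartanExpr_eq_of_lt {c : Fin 5 → Fin 5 → Fin 5 → ℝ}
    (h : CartanRelations c) (i j k : Fin 5) (hjk : j < k) :
    cartanExpr (fun l => if l = j then 1 else 0) (fun l => if l = k then 1 else 0)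
      (fun a => cartanSolution c a j) (fun a => cartanSolution c a k) i = -c i j k := by
  obtain ⟨c024, c234, c123, c034, c134, c124, c023, c323, c324, c334, c423, c424, c434, c223,
    c224, c101, c001⟩ := h
  fin_cases j <;> fin_cases k <;> first | (exact absurd hjk (by decide)) | skip
  all_goals fin_cases i <;> simp [cartanExpr, cartanSolution] <;> first | ring1 | linarith

theorem cartanExpr_swap (x y : Fin 5 → ℝ) (u v : Fin 7 → ℝ) (i : Fin 5) :
    cartanExpr x y u v i = -cartanExpr y x v u i := by
  fin_cases i <;> simp [cartanExpr] <;> ring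

theorem CartanRelations.cartanExpr_eq {c : Fin 5 → Fin 5 → Fin 5 → ℝ}
    (h : CartanRelations c) (hc : ∀ i j k, c i j k = -c i k j) (i j k : Fin 5) :
    cartanExpr (fun l => if l = j then 1 else 0) (fun l => if l = k then 1 else 0)
      (fun a => cartanSolution c a j) (fun a => cartanSolution c a k) i = -c i j k := by
  rcases lt_trichotomy j k with hjk | rfl | hjk
  · exact h.cartanExpr_eq_of_lt i j k hjk
  -- Both sides are antisymmetric in `j`, `k`, so they vanish on the diagonal.
  · have h1 := hc i j j
    have h2 := cartanExpr_swap (fun l => if l = j then 1 else 0) (fun l => if l = j then 1 else 0)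
      (fun a => cartanSolution c a j) (fun a => cartanSolution c a j) i
    linarith
  · rw [cartanExpr_swap, h.cartanExpr_eq_of_lt i k j hjk, hc i j k]

variable {E : Type*} [NormedAddCommGroup E] [NormedSpace ℝ E] [CompleteSpace E]
  {H : Type*} [TopologicalSpace H]
  {I : ModelWithCorners ℝ E H} {M : Type*} [TopologicalSpace M] [ChartedSpace H M]
  [IsManifold I ∞ M]

/-- The components of the Ω are combinations of structure functions with constant coefficients,
hence smooth; by bilinearity the system need only be checked on pairs of frame fields. -/
theorem IsDualFrame.exists_cartanSystem {θ : Fin 5 → OneForm I (M := M)}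
    {Z : Fin 5 → VF I (M := M)} (h : IsDualFrame θ Z)
    (hc : ∀ p, CartanRelations fun i j k => IsDualFrame.structureFun θ Z i j k p) :
    ∃ Ω : Fin 7 → OneForm I (M := M), (∀ a, SmoothForm (Ω a)) ∧ CartanSystem θ Ω := by
  refine ⟨fun a p => ∑ j, cartanSolution (fun i j k => structureFun θ Z i j k p) a j • θ j p,
    fun a => SmoothForm.sum_smul (f := fun j p =>
      cartanSolution (fun i j k => structureFun θ Z i j k p) a j) (fun j => ?_) h.smoothForm, ?_⟩
  · have s := h.contMDiff_structureFun
    have m : ∀ (r : ℝ) {f : M → ℝ}, ContMDiff I 𝓘(ℝ, ℝ) ∞ f →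
        ContMDiff I 𝓘(ℝ, ℝ) ∞ fun p => r * f p := fun r f hf => contMDiff_const.mul hf
    fin_cases a
    · fin_cases j
      exacts [s _ _ _, s _ _ _, (m _ (s _ _ _)).add (m _ (s _ _ _)), (s _ _ _).neg.add (s _ _ _),
        (s _ _ _).neg.add (s _ _ _)]
    · fin_cases j
      exacts [s _ _ _, s _ _ _, (s _ _ _).neg, (s _ _ _).neg, (s _ _ _).neg]
    · fin_cases j
      exacts [s _ _ _, s _ _ _, (s _ _ _).neg, (s _ _ _).neg, (s _ _ _).neg]
    · fin_cases j
      exacts [s _ _ _, s _ _ _, (m _ (s _ _ _)).sub (m _ (s _ _ _)),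
        (s _ _ _).sub (m _ (s _ _ _)), (s _ _ _).sub (m _ (s _ _ _))]
    · fin_cases j
      exacts [m _ (s _ _ _), ((m _ (s _ _ _)).add (m _ (s _ _ _))).sub (m _ (s _ _ _)),
        ((s _ _ _).neg.add (s _ _ _)).add (s _ _ _), (s _ _ _).neg, (s _ _ _).neg]
    · fin_cases j
      exacts [((m _ (s _ _ _)).add (m _ (s _ _ _))).sub (m _ (s _ _ _)), m _ (s _ _ _),
        ((s _ _ _).neg.add (s _ _ _)).add (s _ _ _), (s _ _ _).neg, (s _ _ _).neg]
    · fin_cases j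
      exacts [s _ _ _, (s _ _ _).neg, ((m _ (s _ _ _)).sub (m _ (s _ _ _))).sub (m _ (s _ _ _)),
        contMDiff_const, contMDiff_const]
  · rw [cartanSystem_iff]
    intro i
    refine h.hasExtDeriv i (isBilinearIn_cartanForm h _ i) fun p j k => ?_
    rw [cartanForm_apply, ← (hc p).cartanExpr_eq (fun i j k => structureFun_swap i j k p) i j k]
    simp only [h.dual, sum_apply, smul_apply, smul_eq_mul,
      mul_ite, mul_one, mul_zero, Finset.sum_ite_eq', Finset.mem_univ, if_true]

end CartanOfStructure

section Uniqueness

/-! ### Two solutions of Cartan's system: pointwise algebra -/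

/-- The first step in the comparison of two adapted coframes: the weight one parts of the transition
matrix are related through the derivatives of its diagonal blocks. -/
theorem transition_first_order {D C11 C12 C21 C22 d1 d2 b1 b2 : ℝ}
    {b t t' c' C11' C12' C21' C22' n11 n12 n21 n22 m11 m12 m21 m22 Cx Cy : ℝ}
    (hC : D ≠ 0) (hD : D = C11 * C22 - C12 * C21)
    (hc' : c' = C11' * C22 + C11 * C22' - C12' * C21 - C12 * C21')
    (ht : t = n11 + n22) (ht' : t' = m11 + m22)
    (hb : D * b = b1 * (C22 * Cx - C12 * Cy) + b2 * (C11 * Cy - C21 * Cx))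
    (h3 : D * t' + (d1 * Cy - d2 * Cx) =
      -c' + D * t + b)
    (h11 : D * (C11 * (m11 + t') + C21 * m12) + b1 * Cx =
      -(c' * C11 + D * C11')
        + D * (C11 * (n11 + t) + C12 * n21))
    (h12 : D * (C12 * (m11 + t') + C22 * m12) + b2 * Cx =
      -(c' * C12 + D * C12')
        + D * (C11 * n12 + C12 * (n22 + t)))
    (h21 : D * (C11 * m21 + C21 * (m22 + t')) + b1 * Cy =
      -(c' * C21 + D * C21')
        + D * (C21 * (n11 + t) + C22 * n21))
    (h22 : D * (C12 * m21 + C22 * (m22 + t')) + b2 * Cy =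
      -(c' * C22 + D * C22')
        + D * (C21 * n12 + C22 * (n22 + t))) :
    d1 * Cy - d2 * Cx = 4 / 3 * b := by
  subst hc' ht ht' hD
  apply mul_left_cancel₀ hC
  -- Contracting `h11`, ..., `h22` with the cofactors of `C` gives an equation containing the traces
  -- `t`, `t'` and the derivative `c'` three times. A third of it cancels them in `h3`, and its
  -- terms in `b1`, `b2` turn the coefficient of `b` from 1 into 4/3.
  linear_combination (C11 * C22 - C12 * C21) * h3 - 1 / 3 * (C22 * h11 - C21 * h12 - C12 * h21
    + C11 * h22) - 1 / 3 * hb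

set_option maxHeartbeats 1000000 in
/-- The second step in the comparison of two adapted coframes: the weight two part of the transition
matrix, first column. -/
theorem transition_second_order_left
    {D C11 C12 C21 C22 p q d1 d2 b1 b2 f11 f12 f21 f22 e11 e12 e21 e22 : ℝ}
    {c' C11' C12' C21' C22' cz C11z C12z C21z C22z d1' d2' b1' b2' n11 n12 n21 n22 m11 m12 m21
      m22 nz11 nz12 nz21 nz22 mz11 mz12 mz21 mz22 w1 w2 v1 v2 : ℝ}
    (hC : D ≠ 0) (hD : D = C11 * C22 - C12 * C21)
    (hd1 : d1 = C11 * p + C12 * q) (hd2 : d2 = C21 * p + C22 * q)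
    (hb1 : b1 = -(3 / 4) * D * q) (hb2 : b2 = 3 / 4 * D * p)
    (he11 : e11 = C11 * f11 + C12 * f21) (he12 : e12 = C11 * f12 + C12 * f22)
    (he21 : e21 = C21 * f11 + C22 * f21) (he22 : e22 = C21 * f12 + C22 * f22)
    (hc' : c' = C11' * C22 + C11 * C22' - C12' * C21 - C12 * C21')
    (hcz : cz = C11z * C22 + C11 * C22z - C12z * C21 - C12 * C21z)
    (hb1' : 4 / 3 * b1' = d1' * C21 + d1 * C21' - d2' * C11 - d2 * C11')
    (hb2' : 4 / 3 * b2' = d1' * C22 + d1 * C22' - d2' * C12 - d2 * C12')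
    (h3 : D * (m11 + m22) + (d1 * C21 - d2 * C11) = -c' + D * (n11 + n22) + b1)
    (h411 : D * (C11 * (m11 + (m11 + m22)) + C21 * m12) + b1 * C11 =
      -(c' * C11 + D * C11') + D * (C11 * (n11 + (n11 + n22)) + C12 * n21))
    (ha11 : D * (C11 * (mz11 + (mz11 + mz22)) + C21 * mz12) + b1 * d1 - D * e11 =
      -(cz * C11 + D * C11z) + D * (C11 * (nz11 + (nz11 + nz22)) + C12 * nz21))
    (h412 : D * (C12 * (m11 + (m11 + m22)) + C22 * m12) + b2 * C11 =
      -(c' * C12 + D * C12') + D * (C11 * n12 + C12 * (n22 + (n11 + n22))))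
    (ha12 : D * (C12 * (mz11 + (mz11 + mz22)) + C22 * mz12) + b2 * d1 - D * e12 =
      -(cz * C12 + D * C12z) + D * (C11 * nz12 + C12 * (nz22 + (nz11 + nz22))))
    (h421 : D * (C11 * m21 + C21 * (m22 + (m11 + m22))) + b1 * C21 =
      -(c' * C21 + D * C21') + D * (C21 * (n11 + (n11 + n22)) + C22 * n21))
    (ha21 : D * (C11 * mz21 + C21 * (mz22 + (mz11 + mz22))) + b1 * d2 - D * e21 =
      -(cz * C21 + D * C21z) + D * (C21 * (nz11 + (nz11 + nz22)) + C22 * nz21))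
    (h422 : D * (C12 * m21 + C22 * (m22 + (m11 + m22))) + b2 * C21 =
      -(c' * C22 + D * C22') + D * (C21 * n12 + C22 * (n22 + (n11 + n22))))
    (ha22 : D * (C12 * mz21 + C22 * (mz22 + (mz11 + mz22))) + b2 * d2 - D * e22 =
      -(cz * C22 + D * C22z) + D * (C21 * nz12 + C22 * (nz22 + (nz11 + nz22))))
    (hw1 : (d1 * m11 - C11 * mz11) + (d2 * m12 - C21 * mz12) + 4 / 3 * D * v2 =
      C11z + (C11 * (-nz11 + 4 / 3 * w2) + C12 * (-nz21 + 4 / 3 * (-w1))) - d1'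
        + d1 * (n11 + n22) + e11)
    (hw2 : (d1 * m21 - C11 * mz21) + (d2 * m22 - C21 * mz22) - 4 / 3 * D * v1 =
      C21z + (C21 * (-nz11 + 4 / 3 * w2) + C22 * (-nz21 + 4 / 3 * (-w1))) - d2'
        + d2 * (n11 + n22) + e21)
    (hv1 : D * (C11 * v1 + C21 * v2) + b1 * (m11 + m22) + e11 * C21 - e21 * C11 =
      -b1' + D * w1 + (b1 * (n11 + (n11 + n22)) + b2 * n21))
    (hv2 : D * (C12 * v1 + C22 * v2) + b2 * (m11 + m22) + e12 * C21 - e22 * C11 =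
      -b2' + D * w2 + (b1 * n12 + b2 * (n22 + (n11 + n22)))) :
    2 * f11 = f11 + f22 + p * (-(3 / 4) * q) ∧ 2 * f21 = q * (-(3 / 4) * q) := by
  subst hb1 hb2 hd1 hd2 he11 he12 he21 he22 hc' hcz hD
  -- The factor D² allows cofactors in place of the inverse of `C`.
  refine ⟨mul_left_cancel₀ (pow_ne_zero 2 hC) ?_, mul_left_cancel₀ (pow_ne_zero 2 hC) ?_⟩
  -- The inverse of `C` is applied to the equations `hw1`, `hw2` for θ⁴, θ⁵. The equations `h4..`
  -- and `ha..` remove the values of Ω₁, ..., Ω₄ along the two fields, `hv2` those of Ω₅, Ω₆, and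
  -- `hb2'` the derivatives of the weight one entries. What is left has `f22 - f11` with coefficient
  -- (5/3)D², hence the factor -3/5.
  · linear_combination (-3 / 5) * ((C11 * C22 - C12 * C21) * (C22 * hw1 - C12 * hw2)
      - (C22 * p * h411 + C22 * q * h412 - C12 * p * h421 - C12 * q * h422)
      + (C22 * ha11 - C12 * ha21)
      - 1 / 3 * (C22 * ha11 - C21 * ha12 - C12 * ha21 + C11 * ha22)
      - 4 / 3 * (C11 * C22 - C12 * C21) * hv2
      + 2 * (C11 * C22 - C12 * C21) * p * h3 + (C11 * C22 - C12 * C21) * hb2')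
  · linear_combination (-3 / 5) * ((C11 * C22 - C12 * C21) * (-C21 * hw1 + C11 * hw2)
      - (-C21 * p * h411 - C21 * q * h412 + C11 * p * h421 + C11 * q * h422)
      + (-C21 * ha11 + C11 * ha21)
      + 4 / 3 * (C11 * C22 - C12 * C21) * hv1
      + 2 * (C11 * C22 - C12 * C21) * q * h3 - (C11 * C22 - C12 * C21) * hb1')

set_option maxHeartbeats 1000000 in
/-- The second step in the comparison of two adapted coframes: the weight two part of the transition
matrix, second column. -/
theorem transition_second_order_right
    {D C11 C12 C21 C22 p q d1 d2 b1 b2 f11 f12 f21 f22 e11 e12 e21 e22 : ℝ}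
    {c' C11' C12' C21' C22' cz C11z C12z C21z C22z d1' d2' b1' b2' n11 n12 n21 n22 m11 m12 m21
      m22 nz11 nz12 nz21 nz22 mz11 mz12 mz21 mz22 w1 w2 v1 v2 : ℝ}
    (hC : D ≠ 0) (hD : D = C11 * C22 - C12 * C21)
    (hd1 : d1 = C11 * p + C12 * q) (hd2 : d2 = C21 * p + C22 * q)
    (hb1 : b1 = -(3 / 4) * D * q) (hb2 : b2 = 3 / 4 * D * p)
    (he11 : e11 = C11 * f11 + C12 * f21) (he12 : e12 = C11 * f12 + C12 * f22)
    (he21 : e21 = C21 * f11 + C22 * f21) (he22 : e22 = C21 * f12 + C22 * f22)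
    (hc' : c' = C11' * C22 + C11 * C22' - C12' * C21 - C12 * C21')
    (hcz : cz = C11z * C22 + C11 * C22z - C12z * C21 - C12 * C21z)
    (hb1' : 4 / 3 * b1' = d1' * C21 + d1 * C21' - d2' * C11 - d2 * C11')
    (hb2' : 4 / 3 * b2' = d1' * C22 + d1 * C22' - d2' * C12 - d2 * C12')
    (h3 : D * (m11 + m22) + (d1 * C22 - d2 * C12) = -c' + D * (n11 + n22) + b2)
    (h411 : D * (C11 * (m11 + (m11 + m22)) + C21 * m12) + b1 * C12 =
      -(c' * C11 + D * C11') + D * (C11 * (n11 + (n11 + n22)) + C12 * n21))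
    (ha11 : D * (C11 * (mz11 + (mz11 + mz22)) + C21 * mz12) + b1 * d1 - D * e11 =
      -(cz * C11 + D * C11z) + D * (C11 * (nz11 + (nz11 + nz22)) + C12 * nz21))
    (h412 : D * (C12 * (m11 + (m11 + m22)) + C22 * m12) + b2 * C12 =
      -(c' * C12 + D * C12') + D * (C11 * n12 + C12 * (n22 + (n11 + n22))))
    (ha12 : D * (C12 * (mz11 + (mz11 + mz22)) + C22 * mz12) + b2 * d1 - D * e12 =
      -(cz * C12 + D * C12z) + D * (C11 * nz12 + C12 * (nz22 + (nz11 + nz22))))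
    (h421 : D * (C11 * m21 + C21 * (m22 + (m11 + m22))) + b1 * C22 =
      -(c' * C21 + D * C21') + D * (C21 * (n11 + (n11 + n22)) + C22 * n21))
    (ha21 : D * (C11 * mz21 + C21 * (mz22 + (mz11 + mz22))) + b1 * d2 - D * e21 =
      -(cz * C21 + D * C21z) + D * (C21 * (nz11 + (nz11 + nz22)) + C22 * nz21))
    (h422 : D * (C12 * m21 + C22 * (m22 + (m11 + m22))) + b2 * C22 =
      -(c' * C22 + D * C22') + D * (C21 * n12 + C22 * (n22 + (n11 + n22))))
    (ha22 : D * (C12 * mz21 + C22 * (mz22 + (mz11 + mz22))) + b2 * d2 - D * e22 =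
      -(cz * C22 + D * C22z) + D * (C21 * nz12 + C22 * (nz22 + (nz11 + nz22))))
    (hw1 : (d1 * m11 - C12 * mz11) + (d2 * m12 - C22 * mz12) + 4 / 3 * D * v2 =
      C12z + (C11 * (-nz12 + 4 / 3 * w2) + C12 * (-nz22 + 4 / 3 * (-w1))) - d1'
        + d1 * (n11 + n22) + e12)
    (hw2 : (d1 * m21 - C12 * mz21) + (d2 * m22 - C22 * mz22) - 4 / 3 * D * v1 =
      C22z + (C21 * (-nz12 + 4 / 3 * w2) + C22 * (-nz22 + 4 / 3 * (-w1))) - d2'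
        + d2 * (n11 + n22) + e22)
    (hv1 : D * (C11 * v1 + C21 * v2) + b1 * (m11 + m22) + e11 * C22 - e21 * C12 =
      -b1' + D * w1 + (b1 * (n11 + (n11 + n22)) + b2 * n21))
    (hv2 : D * (C12 * v1 + C22 * v2) + b2 * (m11 + m22) + e12 * C22 - e22 * C12 =
      -b2' + D * w2 + (b1 * n12 + b2 * (n22 + (n11 + n22)))) :
    2 * f12 = p * (3 / 4 * p) ∧ 2 * f22 = f11 + f22 + q * (3 / 4 * p) := by
  subst hb1 hb2 hd1 hd2 he11 he12 he21 he22 hc' hcz hD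
  refine ⟨mul_left_cancel₀ (pow_ne_zero 2 hC) ?_, mul_left_cancel₀ (pow_ne_zero 2 hC) ?_⟩
  · linear_combination (-3 / 5) * ((C11 * C22 - C12 * C21) * (C22 * hw1 - C12 * hw2)
      - (C22 * p * h411 + C22 * q * h412 - C12 * p * h421 - C12 * q * h422)
      + (C22 * ha12 - C12 * ha22)
      - 4 / 3 * (C11 * C22 - C12 * C21) * hv2
      + 2 * (C11 * C22 - C12 * C21) * p * h3 + (C11 * C22 - C12 * C21) * hb2')
  · linear_combination (-3 / 5) * ((C11 * C22 - C12 * C21) * (-C21 * hw1 + C11 * hw2)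
      - (-C21 * p * h411 - C21 * q * h412 + C11 * p * h421 + C11 * q * h422)
      + (-C21 * ha12 + C11 * ha22)
      - 1 / 3 * (C22 * ha11 - C21 * ha12 - C12 * ha21 + C11 * ha22)
      + 4 / 3 * (C11 * C22 - C12 * C21) * hv1
      + 2 * (C11 * C22 - C12 * C21) * q * h3 - (C11 * C22 - C12 * C21) * hb1')

end Uniqueness

/-! ### The transition matrix between two solutions of Cartan's system. -/

section Transition

variable {E : Type*} [NormedAddCommGroup E] [NormedSpace ℝ E] [CompleteSpace E]
  {H : Type*} [TopologicalSpace H]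
  {I : ModelWithCorners ℝ E H} {M : Type*} [TopologicalSpace M] [ChartedSpace H M]
  [IsManifold I ∞ M]

/-- Comparison of the structure equations of two coframes, evaluated on the frame `Z` dual to the
first one. -/
theorem CartanSystem.compare {θ θ' : Fin 5 → OneForm I (M := M)}
    {Z : Fin 5 → VF I (M := M)} {Ω Ω' : Fin 7 → OneForm I (M := M)} (h : IsDualFrame θ Z)
    (hΩ : CartanSystem θ Ω) (hΩ' : CartanSystem θ' Ω') (p : M) (i j k : Fin 5) :
    cartanExpr (fun l => θ' l p (Z j p)) (fun l => θ' l p (Z k p)) (fun a => Ω' a p (Z j p))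
        (fun a => Ω' a p (Z k p)) i =
      dirDeriv (Z j) (fun q => θ' i q (Z k q)) p - dirDeriv (Z k) (fun q => θ' i q (Z j q)) p
        + ∑ l, θ' i p (Z l p) * cartanExpr (fun l => if l = j then 1 else 0)
            (fun l => if l = k then 1 else 0) (fun a => Ω a p (Z j p)) (fun a => Ω a p (Z k p)) l := by
  have h1 := (cartanSystem_iff θ' Ω').1 hΩ' i p _ _ (h.smoothVF j p) (h.smoothVF k p)
  -- The values `θ l (Z j)` are constant, so the system for `θ` itself yields the brackets of the
  -- frame fields; inserting them leaves no bracket in the system for `θ'`.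
  have h2 : ∀ l, θ l p (mlieBracket I (Z j) (Z k) p) =
      -cartanExpr (fun l => if l = j then 1 else 0)
            (fun l => if l = k then 1 else 0) (fun a => Ω a p (Z j p)) (fun a => Ω a p (Z k p)) l := by
    intro l
    have h3 := (cartanSystem_iff θ Ω).1 hΩ l p _ _ (h.smoothVF j p) (h.smoothVF k p)
    simp only [cartanForm_apply, h.dual, dirDeriv_const] at h3
    rw [h3]; ring
  rw [cartanForm_apply] at h1
  rw [h1, h.apply_eq_sum (θ' i) p (mlieBracket I (Z j) (Z k) p)]
  simp only [h2, neg_mul, Finset.sum_neg_distrib, sub_neg_eq_add]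
  congr 1
  exact Finset.sum_congr rfl fun l _ => mul_comm _ _

theorem dirDeriv_det {X : VF I (M := M)} {f₁₁ f₁₂ f₂₁ f₂₂ : M → ℝ} {p : M}
    (h₁₁ : MDifferentiableAt I 𝓘(ℝ, ℝ) f₁₁ p) (h₁₂ : MDifferentiableAt I 𝓘(ℝ, ℝ) f₁₂ p)
    (h₂₁ : MDifferentiableAt I 𝓘(ℝ, ℝ) f₂₁ p) (h₂₂ : MDifferentiableAt I 𝓘(ℝ, ℝ) f₂₂ p) :
    dirDeriv X (fun q => f₁₁ q * f₂₂ q - f₁₂ q * f₂₁ q) p =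
      dirDeriv X f₁₁ p * f₂₂ p + f₁₁ p * dirDeriv X f₂₂ p - dirDeriv X f₁₂ p * f₂₁ p
        - f₁₂ p * dirDeriv X f₂₁ p := by
  rw [dirDeriv_fun_sub (f := fun q => f₁₁ q * f₂₂ q) (g := fun q => f₁₂ q * f₂₁ q)
    (h₁₁.mul h₂₂) (h₁₂.mul h₂₁), dirDeriv_fun_mul h₁₁ h₂₂,
    dirDeriv_fun_mul h₁₂ h₂₁]
  ring

set_option maxHeartbeats 4000000 in
/-- The metrics of two solutions of Cartan's system with the same underlying distribution are
conformal to each other. -/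
theorem CartanSystem.conformal {θ θ' : Fin 5 → OneForm I (M := M)}
    {Z : Fin 5 → VF I (M := M)} {Ω Ω' : Fin 7 → OneForm I (M := M)} (h : IsDualFrame θ Z)
    (hΩ : CartanSystem θ Ω) (hΩ' : CartanSystem θ' Ω') (hs : ∀ i, SmoothForm (θ' i))
    (hli : ∀ p, LinearIndependent ℝ fun i => θ' i p)
    (h3 : ∀ p, θ' 0 p (Z 3 p) = 0 ∧ θ' 1 p (Z 3 p) = 0 ∧ θ' 2 p (Z 3 p) = 0)
    (h4 : ∀ p, θ' 0 p (Z 4 p) = 0 ∧ θ' 1 p (Z 4 p) = 0 ∧ θ' 2 p (Z 4 p) = 0) (p : M) :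
    θ' 2 p (Z 2 p) ≠ 0 ∧ ∀ v w, cartanMetric θ' p v w =
      θ' 2 p (Z 2 p) ^ 2 * cartanMetric θ p v w := by
  have key := fun p i j k => CartanSystem.compare h hΩ hΩ' p i j k
  have hexp := fun p (v : TangentSpace I p) i => h.apply_eq_sum (θ' i) p v
  have hne : ∀ p, θ' 0 p ≠ 0 := fun p => (hli p).ne_zero 0
  have hsm : ∀ i j p, MDifferentiableAt I 𝓘(ℝ, ℝ) (fun q => θ' i q (Z j q)) p := fun i j p =>
    (hs i p (Z j) (h.smoothVF j p)).mdifferentiableAt (by simp)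
  have hzero : ∀ p, (∀ j, θ' 0 p (Z j p) = 0) → False := fun p h0 => hne p <| by
    ext v
    rw [hexp]
    simp [h0]
  -- `T` is the transition matrix, θ' = Tθ. The block of the indices 3, 4 is the matrix `C` of the
  -- lemmas above.
  obtain ⟨T, hT⟩ : ∃ T : Fin 5 → Fin 5 → M → ℝ, ∀ i j, T i j = fun q => θ' i q (Z j q) :=
    ⟨_, fun _ _ => rfl⟩
  have hTp : ∀ i j q, θ' i q (Z j q) = T i j q := fun i j q => by rw [hT]
  simp only [hTp] at key hexp hsm hzero h3 h4 ⊢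
  obtain ⟨w, hw⟩ : ∃ w : M → Fin 7 → Fin 5 → ℝ, ∀ q a j, Ω a q (Z j q) = w q a j :=
    ⟨_, fun _ _ _ => rfl⟩
  obtain ⟨w', hw'⟩ : ∃ w : M → Fin 7 → Fin 5 → ℝ, ∀ q a j, Ω' a q (Z j q) = w q a j :=
    ⟨_, fun _ _ _ => rfl⟩
  simp only [hw, hw'] at key
  have hsm' : ∀ i j p, MDifferentiableAt I 𝓘(ℝ, ℝ) (T i j) p := hsm
  have e : ∀ i j, (fun q => T i j q) = T i j := fun _ _ => rfl
  simp only [e] at key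
  have T03 : ∀ q, T 0 3 q = 0 := fun q => (h3 q).1
  have T13 : ∀ q, T 1 3 q = 0 := fun q => (h3 q).2.1
  have T23 : ∀ q, T 2 3 q = 0 := fun q => (h3 q).2.2
  have T04 : ∀ q, T 0 4 q = 0 := fun q => (h4 q).1
  have T14 : ∀ q, T 1 4 q = 0 := fun q => (h4 q).2.1
  have T24 : ∀ q, T 2 4 q = 0 := fun q => (h4 q).2.2
  have dz : ∀ {i j}, (∀ q, T i j q = 0) → ∀ (X : VF I (M := M)) q, dirDeriv X (T i j) q = 0 := by
    intro i j hz X q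
    rw [show T i j = fun _ => 0 from funext hz, dirDeriv_const]
  -- Weight zero: on `Z 3` and `Z 4` the first three forms of both coframes vanish, so only the
  -- Ω-free terms of the system remain. The pairs (2,3), (2,4) then give the block of θ¹, θ².
  have T02 : ∀ q, T 0 2 q = 0 := by
    intro q
    have := key q 0 3 4
    simp [cartanExpr, Fin.sum_univ_five, T03, T04, T13, T14, T23, T24, dz T03, dz T04] at this
    linarith
  have T12 : ∀ q, T 1 2 q = 0 := by
    intro q
    have := key q 1 3 4
    simp [cartanExpr, Fin.sum_univ_five, T03, T04, T13, T14, T23, T24, dz T13, dz T14] at this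
    linarith
  have T22 : ∀ q, T 2 2 q = T 3 3 q * T 4 4 q - T 3 4 q * T 4 3 q := by
    intro q
    have := key q 2 3 4
    simp [cartanExpr, Fin.sum_univ_five, T03, T04, T13, T14, T23, T24, dz T23, dz T24] at this
    linarith
  have T00 : ∀ q, T 0 0 q = T 2 2 q * T 3 3 q := by
    intro q
    have := key q 0 2 3
    simp [cartanExpr, Fin.sum_univ_five, T02, T03, T04, T12, T13, T14, T23, T24, dz T02,
      dz T03] at this
    linarith
  have T01 : ∀ q, T 0 1 q = T 2 2 q * T 3 4 q := by
    intro q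
    have := key q 0 2 4
    simp [cartanExpr, Fin.sum_univ_five, T02, T03, T04, T12, T13, T14, T23, T24, dz T02,
      dz T04] at this
    linarith
  have T10 : ∀ q, T 1 0 q = T 2 2 q * T 4 3 q := by
    intro q
    have := key q 1 2 3
    simp [cartanExpr, Fin.sum_univ_five, T02, T03, T04, T12, T13, T14, T23, T24, dz T12,
      dz T13] at this
    linarith
  have T11 : ∀ q, T 1 1 q = T 2 2 q * T 4 4 q := by
    intro q
    have := key q 1 2 4
    simp [cartanExpr, Fin.sum_univ_five, T02, T03, T04, T12, T13, T14, T23, T24, dz T12,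
      dz T14] at this
    linarith
  -- If det C vanished at a point, so would the whole first row of `T`, against the independence of
  -- the forms `θ'`.
  have hc : ∀ q, T 2 2 q ≠ 0 := by
    intro q h0
    refine hzero q fun j => ?_
    fin_cases j
    · simpa [h0] using T00 q
    · simpa [h0] using T01 q
    · exact T02 q
    · exact T03 q
    · exact T04 q
  have dT22 : ∀ (X : VF I (M := M)) q, dirDeriv X (T 2 2) q =
      dirDeriv X (T 3 3) q * T 4 4 q + T 3 3 q * dirDeriv X (T 4 4) q
        - dirDeriv X (T 3 4) q * T 4 3 q - T 3 4 q * dirDeriv X (T 4 3) q := by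
    intro X q
    conv_lhs => rw [show T 2 2 = _ from funext T22]
    exact dirDeriv_det (hsm' _ _ _) (hsm' _ _ _) (hsm' _ _ _) (hsm' _ _ _)
  have dA : ∀ {i j k l}, (∀ q, T i j q = T 2 2 q * T k l q) → ∀ (X : VF I (M := M)) q,
      dirDeriv X (T i j) q =
        dirDeriv X (T 2 2) q * T k l q + T 2 2 q * dirDeriv X (T k l) q := by
    intro i j k l hz X q
    conv_lhs => rw [show T i j = _ from funext hz]
    rw [dirDeriv_fun_mul (hsm' _ _ _) (hsm' _ _ _)]
    ring
  -- Weight one: the pair (2,3) for θ³ and the pairs (0,3), (1,3) for θ¹, θ² involve the same values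
  -- of Ω₁, ..., Ω₄, which can therefore be eliminated.
  have B0 : ∀ q, T 3 2 q * T 4 3 q - T 4 2 q * T 3 3 q = 4 / 3 * T 2 0 q := by
    intro q
    have k3 := key q 2 2 3
    have k11 := key q 0 0 3
    have k12 := key q 0 1 3
    have k21 := key q 1 0 3
    have k22 := key q 1 1 3
    simp [cartanExpr, Fin.sum_univ_five, T02, T03, T04, T12, T13, T14, T23, T24, dz T03, dz T13,
      dz T23, T00, T01, T10, T11, dA T00, dA T01, dA T10, dA T11] at k3 k11 k12 k21 k22
    refine transition_first_order (D := T 2 2 q) (C11 := T 3 3 q) (C12 := T 3 4 q) (C21 := T 4 3 q)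
      (C22 := T 4 4 q) (b1 := T 2 0 q) (b2 := T 2 1 q) (hc q) (T22 q) (dT22 (Z 3) q) rfl rfl
      (n11 := w q 0 3) (n12 := w q 1 3) (n21 := w q 2 3) (n22 := w q 3 3)
      (m11 := w' q 0 3) (m12 := w' q 1 3) (m21 := w' q 2 3) (m22 := w' q 3 3)
      ?_ ?_ ?_ ?_ ?_ ?_
    · rw [T22 q]; ring
    · linear_combination k3
    · linear_combination k11
    · linear_combination k12
    · linear_combination k21
    · linear_combination k22
  have B1 : ∀ q, T 3 2 q * T 4 4 q - T 4 2 q * T 3 4 q = 4 / 3 * T 2 1 q := by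
    intro q
    have k3 := key q 2 2 4
    have k11 := key q 0 0 4
    have k12 := key q 0 1 4
    have k21 := key q 1 0 4
    have k22 := key q 1 1 4
    simp [cartanExpr, Fin.sum_univ_five, T02, T03, T04, T12, T13, T14, T23, T24, dz T04, dz T14,
      dz T24, T00, T01, T10, T11, dA T00, dA T01, dA T10, dA T11] at k3 k11 k12 k21 k22
    refine transition_first_order (D := T 2 2 q) (C11 := T 3 3 q) (C12 := T 3 4 q) (C21 := T 4 3 q)
      (C22 := T 4 4 q) (b1 := T 2 0 q) (b2 := T 2 1 q) (hc q) (T22 q) (dT22 (Z 4) q) rfl rfl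
      (n11 := w q 0 4) (n12 := w q 1 4) (n21 := w q 2 4) (n22 := w q 3 4)
      (m11 := w' q 0 4) (m12 := w' q 1 4) (m21 := w' q 2 4) (m22 := w' q 3 4)
      ?_ ?_ ?_ ?_ ?_ ?_
    · rw [T22 q]; ring
    · linear_combination k3
    · linear_combination k11
    · linear_combination k12
    · linear_combination k21
    · linear_combination k22
  -- The equations of weight two contain derivatives of the entries of weight one, so the relations
  -- `B0`, `B1` are differentiated.
  have dB0 : ∀ (X : VF I (M := M)) q, 4 / 3 * dirDeriv X (T 2 0) q =
      dirDeriv X (T 3 2) q * T 4 3 q + T 3 2 q * dirDeriv X (T 4 3) q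
        - dirDeriv X (T 4 2) q * T 3 3 q - T 4 2 q * dirDeriv X (T 3 3) q := by
    intro X q
    rw [← dirDeriv_det (hsm' _ _ _) (hsm' _ _ _) (hsm' _ _ _) (hsm' _ _ _),
      show (fun q => T 3 2 q * T 4 3 q - T 4 2 q * T 3 3 q) = _ from funext B0,
      dirDeriv_fun_mul (f := fun _ => 4 / 3) mdifferentiableAt_const (hsm' _ _ _), dirDeriv_const]
    ring
  have dB1 : ∀ (X : VF I (M := M)) q, 4 / 3 * dirDeriv X (T 2 1) q =
      dirDeriv X (T 3 2) q * T 4 4 q + T 3 2 q * dirDeriv X (T 4 4) q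
        - dirDeriv X (T 4 2) q * T 3 4 q - T 4 2 q * dirDeriv X (T 3 4) q := by
    intro X q
    rw [← dirDeriv_det (hsm' _ _ _) (hsm' _ _ _) (hsm' _ _ _) (hsm' _ _ _),
      show (fun q => T 3 2 q * T 4 4 q - T 4 2 q * T 3 4 q) = _ from funext B1,
      dirDeriv_fun_mul (f := fun _ => 4 / 3) mdifferentiableAt_const (hsm' _ _ _), dirDeriv_const]
    ring
  refine ⟨hc p, ?_⟩
  -- `C` is invertible by `hc`. Below, (P, Q) is the inverse of `C` applied to the θ³-column of the
  -- rows of θ⁴, θ⁵, and F is the inverse of `C` applied to their θ¹- and θ²-columns.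
  have solve : ∀ x y : ℝ, ∃ P Q, x = T 3 3 p * P + T 3 4 p * Q ∧ y = T 4 3 p * P + T 4 4 p * Q := by
    intro x y
    have hc' := hc p
    rw [T22] at hc'
    refine ⟨(T 4 4 p * x - T 3 4 p * y) / (T 3 3 p * T 4 4 p - T 3 4 p * T 4 3 p),
      (T 3 3 p * y - T 4 3 p * x) / (T 3 3 p * T 4 4 p - T 3 4 p * T 4 3 p), ?_, ?_⟩ <;>
    · rw [mul_div_assoc', mul_div_assoc', ← add_div, eq_div_iff hc']
      ring
  obtain ⟨P, Q, hd1, hd2⟩ := solve (T 3 2 p) (T 4 2 p)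
  obtain ⟨F11, F21, he11, he21⟩ := solve (T 3 0 p) (T 4 0 p)
  obtain ⟨F12, F22, he12, he22⟩ := solve (T 3 1 p) (T 4 1 p)
  have hb1 : T 2 0 p = -(3 / 4) * T 2 2 p * Q := by
    have := B0 p
    rw [hd1, hd2] at this
    rw [T22]
    linear_combination (-3 / 4) * this
  have hb2 : T 2 1 p = 3 / 4 * T 2 2 p * P := by
    have := B1 p
    rw [hd1, hd2] at this
    rw [T22]
    linear_combination (-3 / 4) * this
  have left : 2 * F11 = F11 + F22 + P * (-(3 / 4) * Q) ∧ 2 * F21 = Q * (-(3 / 4) * Q) := by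
    refine transition_second_order_left (D := T 2 2 p) (C11 := T 3 3 p) (C12 := T 3 4 p)
      (C21 := T 4 3 p) (C22 := T 4 4 p) (p := P) (q := Q) (f11 := F11) (f12 := F12) (f21 := F21)
      (f22 := F22) (b1' := dirDeriv (Z 3) (T 2 0) p) (b2' := dirDeriv (Z 3) (T 2 1) p)
      (d1' := dirDeriv (Z 3) (T 3 2) p) (d2' := dirDeriv (Z 3) (T 4 2) p)
      (n11 := w p 0 3) (n12 := w p 1 3) (n21 := w p 2 3) (n22 := w p 3 3)
      (m11 := w' p 0 3) (m12 := w' p 1 3) (m21 := w' p 2 3) (m22 := w' p 3 3)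
      (nz11 := w p 0 2) (nz12 := w p 1 2) (nz21 := w p 2 2) (nz22 := w p 3 2)
      (mz11 := w' p 0 2) (mz12 := w' p 1 2) (mz21 := w' p 2 2) (mz22 := w' p 3 2)
      (w1 := w p 4 3) (w2 := w p 5 3) (v1 := w' p 4 3) (v2 := w' p 5 3)
      (hc p) (T22 p) hd1 hd2 hb1 hb2 he11 he12 he21 he22 (dT22 (Z 3) p) (dT22 (Z 2) p)
      (dB0 (Z 3) p) (dB1 (Z 3) p) ?_ ?_ ?_ ?_ ?_ ?_ ?_ ?_ ?_ ?_ ?_ ?_ ?_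
    · have := key p 2 2 3
      simp [cartanExpr, Fin.sum_univ_five, T02, T03, T04, T12, T13, T14, T23, T24, dz T02, dz T03,
        dz T04, dz T12, dz T13, dz T14, dz T23, dz T24, T00, T01, T10, T11, dA T00, dA T01, dA T10,
        dA T11] at this
      linear_combination this
    · have := key p 0 0 3
      simp [cartanExpr, Fin.sum_univ_five, T02, T03, T04, T12, T13, T14, T23, T24, dz T02, dz T03,
        dz T04, dz T12, dz T13, dz T14, dz T23, dz T24, T00, T01, T10, T11, dA T00, dA T01, dA T10,
        dA T11] at this
      linear_combination this
    · have := key p 0 0 2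
      simp [cartanExpr, Fin.sum_univ_five, T02, T03, T04, T12, T13, T14, T23, T24, dz T02, dz T03,
        dz T04, dz T12, dz T13, dz T14, dz T23, dz T24, T00, T01, T10, T11, dA T00, dA T01, dA T10,
        dA T11] at this
      linear_combination this
    · have := key p 0 1 3
      simp [cartanExpr, Fin.sum_univ_five, T02, T03, T04, T12, T13, T14, T23, T24, dz T02, dz T03,
        dz T04, dz T12, dz T13, dz T14, dz T23, dz T24, T00, T01, T10, T11, dA T00, dA T01, dA T10,
        dA T11] at this
      linear_combination this
    · have := key p 0 1 2
      simp [cartanExpr, Fin.sum_univ_five, T02, T03, T04, T12, T13, T14, T23, T24, dz T02, dz T03,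
        dz T04, dz T12, dz T13, dz T14, dz T23, dz T24, T00, T01, T10, T11, dA T00, dA T01, dA T10,
        dA T11] at this
      linear_combination this
    · have := key p 1 0 3
      simp [cartanExpr, Fin.sum_univ_five, T02, T03, T04, T12, T13, T14, T23, T24, dz T02, dz T03,
        dz T04, dz T12, dz T13, dz T14, dz T23, dz T24, T00, T01, T10, T11, dA T00, dA T01, dA T10,
        dA T11] at this
      linear_combination this
    · have := key p 1 0 2
      simp [cartanExpr, Fin.sum_univ_five, T02, T03, T04, T12, T13, T14, T23, T24, dz T02, dz T03,
        dz T04, dz T12, dz T13, dz T14, dz T23, dz T24, T00, T01, T10, T11, dA T00, dA T01, dA T10,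
        dA T11] at this
      linear_combination this
    · have := key p 1 1 3
      simp [cartanExpr, Fin.sum_univ_five, T02, T03, T04, T12, T13, T14, T23, T24, dz T02, dz T03,
        dz T04, dz T12, dz T13, dz T14, dz T23, dz T24, T00, T01, T10, T11, dA T00, dA T01, dA T10,
        dA T11] at this
      linear_combination this
    · have := key p 1 1 2
      simp [cartanExpr, Fin.sum_univ_five, T02, T03, T04, T12, T13, T14, T23, T24, dz T02, dz T03,
        dz T04, dz T12, dz T13, dz T14, dz T23, dz T24, T00, T01, T10, T11, dA T00, dA T01, dA T10,
        dA T11] at this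
      linear_combination this
    · have := key p 3 2 3
      simp [cartanExpr, Fin.sum_univ_five, T02, T03, T04, T12, T13, T14, T23, T24, dz T02, dz T03,
        dz T04, dz T12, dz T13, dz T14, dz T23, dz T24, T00, T01, T10, T11, dA T00, dA T01, dA T10,
        dA T11] at this
      linear_combination this
    · have := key p 4 2 3
      simp [cartanExpr, Fin.sum_univ_five, T02, T03, T04, T12, T13, T14, T23, T24, dz T02, dz T03,
        dz T04, dz T12, dz T13, dz T14, dz T23, dz T24, T00, T01, T10, T11, dA T00, dA T01, dA T10,
        dA T11] at this
      linear_combination this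
    · have := key p 2 0 3
      simp [cartanExpr, Fin.sum_univ_five, T02, T03, T04, T12, T13, T14, T23, T24, dz T02, dz T03,
        dz T04, dz T12, dz T13, dz T14, dz T23, dz T24, T00, T01, T10, T11, dA T00, dA T01, dA T10,
        dA T11] at this
      linear_combination this
    · have := key p 2 1 3
      simp [cartanExpr, Fin.sum_univ_five, T02, T03, T04, T12, T13, T14, T23, T24, dz T02, dz T03,
        dz T04, dz T12, dz T13, dz T14, dz T23, dz T24, T00, T01, T10, T11, dA T00, dA T01, dA T10,
        dA T11] at this
      linear_combination this
  have right : 2 * F12 = P * (3 / 4 * P) ∧ 2 * F22 = F11 + F22 + Q * (3 / 4 * P) := by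
    refine transition_second_order_right (D := T 2 2 p) (C11 := T 3 3 p) (C12 := T 3 4 p)
      (C21 := T 4 3 p) (C22 := T 4 4 p) (p := P) (q := Q) (f11 := F11) (f12 := F12) (f21 := F21)
      (f22 := F22) (b1' := dirDeriv (Z 4) (T 2 0) p) (b2' := dirDeriv (Z 4) (T 2 1) p)
      (d1' := dirDeriv (Z 4) (T 3 2) p) (d2' := dirDeriv (Z 4) (T 4 2) p)
      (n11 := w p 0 4) (n12 := w p 1 4) (n21 := w p 2 4) (n22 := w p 3 4)
      (m11 := w' p 0 4) (m12 := w' p 1 4) (m21 := w' p 2 4) (m22 := w' p 3 4)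
      (nz11 := w p 0 2) (nz12 := w p 1 2) (nz21 := w p 2 2) (nz22 := w p 3 2)
      (mz11 := w' p 0 2) (mz12 := w' p 1 2) (mz21 := w' p 2 2) (mz22 := w' p 3 2)
      (w1 := w p 4 4) (w2 := w p 5 4) (v1 := w' p 4 4) (v2 := w' p 5 4)
      (hc p) (T22 p) hd1 hd2 hb1 hb2 he11 he12 he21 he22 (dT22 (Z 4) p) (dT22 (Z 2) p)
      (dB0 (Z 4) p) (dB1 (Z 4) p) ?_ ?_ ?_ ?_ ?_ ?_ ?_ ?_ ?_ ?_ ?_ ?_ ?_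
    · have := key p 2 2 4
      simp [cartanExpr, Fin.sum_univ_five, T02, T03, T04, T12, T13, T14, T23, T24, dz T02, dz T03,
        dz T04, dz T12, dz T13, dz T14, dz T23, dz T24, T00, T01, T10, T11, dA T00, dA T01, dA T10,
        dA T11] at this
      linear_combination this
    · have := key p 0 0 4
      simp [cartanExpr, Fin.sum_univ_five, T02, T03, T04, T12, T13, T14, T23, T24, dz T02, dz T03,
        dz T04, dz T12, dz T13, dz T14, dz T23, dz T24, T00, T01, T10, T11, dA T00, dA T01, dA T10,
        dA T11] at this
      linear_combination this
    · have := key p 0 0 2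
      simp [cartanExpr, Fin.sum_univ_five, T02, T03, T04, T12, T13, T14, T23, T24, dz T02, dz T03,
        dz T04, dz T12, dz T13, dz T14, dz T23, dz T24, T00, T01, T10, T11, dA T00, dA T01, dA T10,
        dA T11] at this
      linear_combination this
    · have := key p 0 1 4
      simp [cartanExpr, Fin.sum_univ_five, T02, T03, T04, T12, T13, T14, T23, T24, dz T02, dz T03,
        dz T04, dz T12, dz T13, dz T14, dz T23, dz T24, T00, T01, T10, T11, dA T00, dA T01, dA T10,
        dA T11] at this
      linear_combination this
    · have := key p 0 1 2
      simp [cartanExpr, Fin.sum_univ_five, T02, T03, T04, T12, T13, T14, T23, T24, dz T02, dz T03,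
        dz T04, dz T12, dz T13, dz T14, dz T23, dz T24, T00, T01, T10, T11, dA T00, dA T01, dA T10,
        dA T11] at this
      linear_combination this
    · have := key p 1 0 4
      simp [cartanExpr, Fin.sum_univ_five, T02, T03, T04, T12, T13, T14, T23, T24, dz T02, dz T03,
        dz T04, dz T12, dz T13, dz T14, dz T23, dz T24, T00, T01, T10, T11, dA T00, dA T01, dA T10,
        dA T11] at this
      linear_combination this
    · have := key p 1 0 2
      simp [cartanExpr, Fin.sum_univ_five, T02, T03, T04, T12, T13, T14, T23, T24, dz T02, dz T03,
        dz T04, dz T12, dz T13, dz T14, dz T23, dz T24, T00, T01, T10, T11, dA T00, dA T01, dA T10,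
        dA T11] at this
      linear_combination this
    · have := key p 1 1 4
      simp [cartanExpr, Fin.sum_univ_five, T02, T03, T04, T12, T13, T14, T23, T24, dz T02, dz T03,
        dz T04, dz T12, dz T13, dz T14, dz T23, dz T24, T00, T01, T10, T11, dA T00, dA T01, dA T10,
        dA T11] at this
      linear_combination this
    · have := key p 1 1 2
      simp [cartanExpr, Fin.sum_univ_five, T02, T03, T04, T12, T13, T14, T23, T24, dz T02, dz T03,
        dz T04, dz T12, dz T13, dz T14, dz T23, dz T24, T00, T01, T10, T11, dA T00, dA T01, dA T10,
        dA T11] at this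
      linear_combination this
    · have := key p 3 2 4
      simp [cartanExpr, Fin.sum_univ_five, T02, T03, T04, T12, T13, T14, T23, T24, dz T02, dz T03,
        dz T04, dz T12, dz T13, dz T14, dz T23, dz T24, T00, T01, T10, T11, dA T00, dA T01, dA T10,
        dA T11] at this
      linear_combination this
    · have := key p 4 2 4
      simp [cartanExpr, Fin.sum_univ_five, T02, T03, T04, T12, T13, T14, T23, T24, dz T02, dz T03,
        dz T04, dz T12, dz T13, dz T14, dz T23, dz T24, T00, T01, T10, T11, dA T00, dA T01, dA T10,
        dA T11] at this
      linear_combination this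
    · have := key p 2 0 4
      simp [cartanExpr, Fin.sum_univ_five, T02, T03, T04, T12, T13, T14, T23, T24, dz T02, dz T03,
        dz T04, dz T12, dz T13, dz T14, dz T23, dz T24, T00, T01, T10, T11, dA T00, dA T01, dA T10,
        dA T11] at this
      linear_combination this
    · have := key p 2 1 4
      simp [cartanExpr, Fin.sum_univ_five, T02, T03, T04, T12, T13, T14, T23, T24, dz T02, dz T03,
        dz T04, dz T12, dz T13, dz T14, dz T23, dz T24, T00, T01, T10, T11, dA T00, dA T01, dA T10,
        dA T11] at this
      linear_combination this
  -- F is a multiple of the identity plus terms quadratic in P, Q. The multiple of the identity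
  -- drops out of the metric because the pairing θ¹θ⁵ - θ²θ⁴ is skew in the two blocks; the terms in
  -- P, Q cancel against those of (4/3)θ³θ³.
  have f22 : F22 = F11 + 3 / 4 * P * Q := by linarith [left.1]
  have f21 : F21 = -(3 / 8) * Q ^ 2 := by linarith [left.2]
  have f12 : F12 = 3 / 8 * P ^ 2 := by linarith [right.1]
  intro v w
  simp only [cartanMetric, hexp p v, hexp p w, Fin.sum_univ_five, T02, T03, T04, T12, T13, T14,
    T23, T24, T00, T01, T10, T11, hb1, hb2, he11, he12, he21, he22, hd1, hd2, f22, f21, f12, T22]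
  ring

end Transition

/-! ### Framed surfaces and the consequences of the Killing field. -/

section Surfaces

variable {S : Type*} [TopologicalSpace S]
  [ChartedSpace (EuclideanSpace ℝ (Fin 2)) S] [IsManifold (𝓡 2) ∞ S]

/-- The inner product of two smooth fields along a map is smooth. -/
theorem contMDiffAt_inner {E : Type*} [NormedAddCommGroup E] [NormedSpace ℝ E]
    {H : Type*} [TopologicalSpace H] {I : ModelWithCorners ℝ E H} {M : Type*} [TopologicalSpace M]
    [ChartedSpace H M] (g : SurfaceMetric S) {b : M → S} {X Y : ∀ m, TangentSpace (𝓡 2) (b m)}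
    {p : M} (hX : ContMDiffAt I (𝓡 2).tangent ∞ (fun m => (⟨b m, X m⟩ : TangentBundle (𝓡 2) S)) p)
    (hY : ContMDiffAt I (𝓡 2).tangent ∞ (fun m => (⟨b m, Y m⟩ : TangentBundle (𝓡 2) S)) p) :
    ContMDiffAt I 𝓘(ℝ, ℝ) ∞ (fun m => g.inner (b m) (X m) (Y m)) p := by
  let _ : RiemannianBundle (fun x : S => TangentSpace (𝓡 2) x) := ⟨g.toRiemannianMetric⟩
  exact ContMDiffAt.inner_bundle (IB := 𝓡 2) (F := EuclideanSpace ℝ (Fin 2))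
    (E := fun x : S => TangentSpace (𝓡 2) x) hX hY

namespace FramedSurface

variable (F : FramedSurface S)

theorem e_ne_zero (i : Fin 2) (x : S) : F.e i x ≠ 0 := by
  intro h
  have := F.orthonormal x i i
  simp [h] at this

theorem expand (x : S) (v : TangentSpace (𝓡 2) x) :
    ∑ i, F.metric.inner x (F.e i x) v • F.e i x = v := by
  have hli : LinearIndependent ℝ (fun i => F.e i x) := by
    rw [Fintype.linearIndependent_iff]
    intro c hc j
    have := congrArg (F.metric.inner x (F.e j x)) hc
    fin_cases j <;> simpa [F.orthonormal] using this
  have hcard : Fintype.card (Fin 2) = Module.finrank ℝ (TangentSpace (𝓡 2) x) := by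
    change _ = Module.finrank ℝ (EuclideanSpace ℝ (Fin 2))
    simp
  have : FiniteDimensional ℝ (TangentSpace (𝓡 2) x) :=
    inferInstanceAs (FiniteDimensional ℝ (EuclideanSpace ℝ (Fin 2)))
  have hb := hli.span_eq_top_of_card_eq_finrank' hcard
  have hv : v ∈ Submodule.span ℝ (Set.range fun i => F.e i x) := by rw [hb]; trivial
  obtain ⟨c, rfl⟩ := (Submodule.mem_span_range_iff_exists_fun ℝ).1 hv
  refine Finset.sum_congr rfl fun i _ => ?_
  fin_cases i <;> simp [F.orthonormal]

theorem bracket (x : S) : mlieBracket (𝓡 2) (F.e 0) (F.e 1) x =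
    F.a 0 x • F.e 0 x + F.a 1 x • F.e 1 x := by
  conv_lhs => rw [← F.expand x (mlieBracket (𝓡 2) (F.e 0) (F.e 1) x)]
  simp only [Fin.sum_univ_two, a, F.metric.symm x (F.e _ x)]

theorem contMDiff_a (i : Fin 2) : ContMDiff (𝓡 2) 𝓘(ℝ, ℝ) ∞ (F.a i) := fun x =>
  contMDiffAt_inner F.metric (b := fun y => y) ((F.smooth 0 x).bracket (F.smooth 1 x))
    (F.smooth i x)

theorem contMDiff_dirDeriv (i : Fin 2) {f : S → ℝ} (hf : ContMDiff (𝓡 2) 𝓘(ℝ, ℝ) ∞ f) :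
    ContMDiff (𝓡 2) 𝓘(ℝ, ℝ) ∞ (dirDeriv (F.e i) f) := fun x =>
  SmoothVFAt.dirDeriv (F.smooth i x) (hf x)

theorem contMDiff_curv : ContMDiff (𝓡 2) 𝓘(ℝ, ℝ) ∞ F.curv :=
  (((F.contMDiff_dirDeriv 0 (F.contMDiff_a 1)).sub (F.contMDiff_dirDeriv 1 (F.contMDiff_a 0))).sub
    ((F.contMDiff_a 0).pow 2)).sub ((F.contMDiff_a 1).pow 2)

theorem dirDeriv_a_one (h : ∀ x, F.a 0 x = 0) (x : S) :
    dirDeriv (F.e 0) (F.a 1) x = F.curv x + F.a 1 x ^ 2 := by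
  have h0 : dirDeriv (F.e 1) (F.a 0) x = 0 := by
    rw [show F.a 0 = fun _ => 0 from funext h, dirDeriv_const]
  rw [curv, h0, h]
  ring

/-- If `[e₁, e₂] = a₂ e₂`, then the functions that are constant along `e₂` are preserved by `e₁`. -/
theorem dirDeriv_dirDeriv_eq_zero (h : ∀ x, F.a 0 x = 0) {f : S → ℝ}
    (hf : ContMDiff (𝓡 2) 𝓘(ℝ, ℝ) ∞ f) (hz : ∀ x, dirDeriv (F.e 1) f x = 0) (x : S) :
    dirDeriv (F.e 1) (dirDeriv (F.e 0) f) x = 0 := by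
  have h1 := dirDeriv_mlieBracket (F.smooth 0 x) (F.smooth 1 x) (F.smooth 0 x) (F.e_ne_zero 0 x)
    (hf x)
  have h2 : dirDeriv (mlieBracket (𝓡 2) (F.e 0) (F.e 1)) f x = 0 := by
    have hz' := hz x
    rw [dirDeriv_eq_mvfderiv] at hz' ⊢
    rw [F.bracket, h, zero_smul, zero_add, map_smul, hz', smul_zero]
  rw [h2, show dirDeriv (F.e 1) f = fun _ => 0 from funext hz, dirDeriv_const] at h1
  linarith

section Killing

variable {F} {K : VF (𝓡 2) (M := S)} (hK : IsKilling F.metric K)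
  {h : S → ℝ} (hpos : ∀ x, 0 < h x) (hKe : ∀ x, K x = h x • F.e 1 x)
include hK hpos hKe

-- `h` is not assumed smooth: it is recovered as the inner product of `K` with the unit field e₂.
omit hpos in
theorem contMDiff_of_killing : ContMDiff (𝓡 2) 𝓘(ℝ, ℝ) ∞ h := by
  have : h = fun x => F.metric.inner x (K x) (F.e 1 x) := by
    funext x
    simp [hKe, F.orthonormal]
  rw [this]
  exact fun x => contMDiffAt_inner F.metric (b := fun y => y) (hK.1 x) (F.smooth 1 x)

omit hpos in
theorem killing_bracket (i : Fin 2) (x : S) : mlieBracket (𝓡 2) K (F.e i) x =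
    -dirDeriv (F.e i) h x • F.e 1 x + h x • mlieBracket (𝓡 2) (F.e 1) (F.e i) x := by
  rw [show K = fun x => h x • F.e 1 x from funext hKe]
  exact mlieBracket_fun_smul_left ((contMDiff_of_killing hK hKe x).mdifferentiableAt (by simp))
    (F.smooth 1 x)

-- The Killing equation on two frame fields: the inner product differentiated on its left-hand side
-- is constant.
omit hpos in
theorem killing_orthonormal (i j : Fin 2) (x : S) :
    F.metric.inner x (mlieBracket (𝓡 2) K (F.e i) x) (F.e j x)
      + F.metric.inner x (F.e i x) (mlieBracket (𝓡 2) K (F.e j) x) = 0 := by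
  rw [← hK.2 x _ _ (F.smooth i x) (F.smooth j x)]
  simp only [F.orthonormal]
  exact dirDeriv_const _ _ _

/-- For the pair (e₁, e₁) the Killing equation reduces to h a₁ = 0. -/
theorem a_zero_of_killing (x : S) : F.a 0 x = 0 := by
  have h1 := killing_orthonormal hK hKe 0 0 x
  rw [F.metric.symm x (F.e 0 x), killing_bracket hK hKe, mlieBracket_swap_apply, F.bracket] at h1
  simp [F.orthonormal] at h1
  exact h1.resolve_left (hpos x).ne'

-- The pair (e₂, e₂), where only the derivative of `h` remains since [e₂, e₂] = 0.
omit hpos in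
theorem dirDeriv_one_of_killing (x : S) : dirDeriv (F.e 1) h x = 0 := by
  have h1 := killing_orthonormal hK hKe 1 1 x
  rw [F.metric.symm x (F.e 1 x), killing_bracket hK hKe, mlieBracket_self] at h1
  simp [F.orthonormal] at h1
  linarith

/-- The pair (e₁, e₂): a₂ is minus the logarithmic derivative of `h` along e₁. -/
theorem a_one_of_killing (x : S) : F.a 1 x = -(dirDeriv (F.e 0) h x * (h x)⁻¹) := by
  have h1 := killing_orthonormal hK hKe 0 1 x
  rw [killing_bracket hK hKe, killing_bracket hK hKe, mlieBracket_self, mlieBracket_swap_apply,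
    F.bracket] at h1
  simp [F.orthonormal] at h1
  have := (hpos x).ne'
  field_simp
  linarith

/-- a₂ is a function of `h` and e₁(h), both constant along e₂. -/
theorem dirDeriv_one_a_one_of_killing (x : S) : dirDeriv (F.e 1) (F.a 1) x = 0 := by
  have hs := contMDiff_of_killing hK hKe
  have h0 := a_zero_of_killing hK hpos hKe
  have h1 := dirDeriv_one_of_killing hK hKe
  have hd := (F.contMDiff_dirDeriv 0 hs x).mdifferentiableAt (by simp)
  have hh := (hs x).mdifferentiableAt (by simp)
  have hinv : MDifferentiableAt (𝓡 2) 𝓘(ℝ, ℝ) (fun y => (h y)⁻¹) x :=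
    ((hasDerivAt_inv (hpos x).ne').differentiableAt.mdifferentiableAt).comp x hh
  rw [show F.a 1 = _ from funext (a_one_of_killing hK hpos hKe), dirDeriv_fun_neg,
    dirDeriv_fun_mul hd hinv, F.dirDeriv_dirDeriv_eq_zero h0 hs h1,
    dirDeriv_comp_real (F := fun t => t⁻¹) (hasDerivAt_inv (hpos x).ne') hh, h1]
  ring

/-- κ = e₁(a₂) - a₂², and e₁ preserves constancy along e₂. -/
theorem dirDeriv_one_curv_of_killing (x : S) : dirDeriv (F.e 1) F.curv x = 0 := by
  have h0 := a_zero_of_killing hK hpos hKe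
  have ha := dirDeriv_one_a_one_of_killing hK hpos hKe
  have hc : F.curv = fun y => dirDeriv (F.e 0) (F.a 1) y - F.a 1 y * F.a 1 y := by
    funext y
    rw [F.dirDeriv_a_one h0]
    ring
  have hm := (F.contMDiff_a 1 x).mdifferentiableAt (by simp)
  have hd := (F.contMDiff_dirDeriv 0 (F.contMDiff_a 1) x).mdifferentiableAt (by simp)
  rw [hc, dirDeriv_fun_sub (g := fun y => F.a 1 y * F.a 1 y) hd (hm.mul hm),
    F.dirDeriv_dirDeriv_eq_zero h0 (F.contMDiff_a 1) ha, dirDeriv_fun_mul hm hm, ha]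
  ring

end Killing

end FramedSurface

end Surfaces

/-! ### Related vector fields and products of manifolds. -/

section Product

variable {E : Type*} [NormedAddCommGroup E] [NormedSpace ℝ E] [CompleteSpace E]
  {H : Type*} [TopologicalSpace H] {I : ModelWithCorners ℝ E H}
  {M : Type*} [TopologicalSpace M] [ChartedSpace H M] [IsManifold I ∞ M]
  {E' : Type*} [NormedAddCommGroup E'] [NormedSpace ℝ E'] [CompleteSpace E']
  {H' : Type*} [TopologicalSpace H'] {J : ModelWithCorners ℝ E' H'}
  {N : Type*} [TopologicalSpace N] [ChartedSpace H' N] [IsManifold J ∞ N]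

theorem dirDeriv_comp {f : M → N} {g : N → ℝ} {V : VF I (M := M)} {v : VF J (M := N)} {p : M}
    (hf : MDifferentiableAt I J f p) (hg : MDifferentiableAt J 𝓘(ℝ, ℝ) g (f p))
    (hV : mfderiv I J f p (V p) = v (f p)) :
    dirDeriv V (fun q => g (f q)) p = dirDeriv v g (f p) := by
  have h := mfderiv_comp p hg hf
  have h2 : dirDeriv V (fun q => g (f q)) p = mfderiv I 𝓘(ℝ, ℝ) (g ∘ f) p (V p) := rfl
  rw [h2, h]
  change mfderiv J 𝓘(ℝ, ℝ) g (f p) (mfderiv I J f p (V p)) = _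
  rw [hV]
  rfl

theorem dirDeriv_congr_of_eventuallyEq {f g : M → ℝ} {V : VF I (M := M)} {p : M}
    (h : f =ᶠ[nhds p] g) : dirDeriv V f p = dirDeriv V g p := by
  have h1 := h.mfderiv_eq (I := I) (I' := 𝓘(ℝ, ℝ))
  have h2 : mvfderiv I f p = mvfderiv I g p := by
    ext v
    exact congrArg (fun L : TangentSpace I p →L[ℝ] ℝ => L v) h1
  simp only [dirDeriv_eq_mvfderiv, h2]

/-- The brackets of related vector fields are related. -/
theorem mfderiv_mlieBracket {f : M → N} (hf : ContMDiff I J ∞ f)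
    {V W U : VF I (M := M)} {v w u : VF J (M := N)} (hV : SmoothVF V) (hW : SmoothVF W)
    (hv : SmoothVF v) (hw : SmoothVF w) (hU : SmoothVF U) (hU0 : ∀ p, U p ≠ 0)
    (hu : SmoothVF u) (hu0 : ∀ p, u p ≠ 0) (hVv : ∀ q, mfderiv I J f q (V q) = v (f q))
    (hWw : ∀ q, mfderiv I J f q (W q) = w (f q)) (p : M) :
    mfderiv I J f p (mlieBracket I V W p) = mlieBracket J v w (f p) := by
  have hfd : ∀ q, MDifferentiableAt I J f q := fun q => (hf q).mdifferentiableAt (by simp)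
  rw [← sub_eq_zero]
  -- Tested on functions, both brackets become commutators of derivations, and these correspond
  -- under composition with `f`. The map need not be invertible; projections are the case of
  -- interest.
  refine eq_zero_of_mfderiv_eq_zero _ fun g hg => ?_
  have hgd : MDifferentiableAt J 𝓘(ℝ, ℝ) g (f p) := hg.mdifferentiableAt (by simp)
  have hgf : ContMDiffAt I 𝓘(ℝ, ℝ) ∞ (fun q => g (f q)) p := hg.comp p (hf p)
  have hev : ∀ᶠ q in nhds p, MDifferentiableAt J 𝓘(ℝ, ℝ) g (f q) := by
    have : ∀ᶠ y in nhds (f p), ContMDiffAt J 𝓘(ℝ, ℝ) 1 g y :=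
      (contMDiffAt_iff_contMDiffAt_nhds (by simp)).1 (hg.of_le ENat.LEInfty.out)
    filter_upwards [(hf p).continuousAt.eventually this] with q hq
    exact hq.mdifferentiableAt (by simp)
  have eV : dirDeriv V (fun q => g (f q)) =ᶠ[nhds p] fun q => dirDeriv v g (f q) := by
    filter_upwards [hev] with q hq
    exact dirDeriv_comp (hfd q) hq (hVv q)
  have eW : dirDeriv W (fun q => g (f q)) =ᶠ[nhds p] fun q => dirDeriv w g (f q) := by
    filter_upwards [hev] with q hq
    exact dirDeriv_comp (hfd q) hq (hWw q)
  have h1 := dirDeriv_mlieBracket (hV p) (hW p) (hU p) (hU0 p) hgf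
  rw [dirDeriv_congr_of_eventuallyEq eV, dirDeriv_congr_of_eventuallyEq eW,
    dirDeriv_comp (hfd p) (((hw _).dirDeriv hg).mdifferentiableAt (by simp)) (hVv p),
    dirDeriv_comp (hfd p) (((hv _).dirDeriv hg).mdifferentiableAt (by simp)) (hWw p),
    ← dirDeriv_mlieBracket (hv _) (hw _) (hu _) (hu0 _) hg] at h1
  have h2 : dirDeriv (mlieBracket I V W) (fun q => g (f q)) p =
      mfderiv J 𝓘(ℝ, ℝ) g (f p) (mfderiv I J f p (mlieBracket I V W p)) := by
    have h3 : dirDeriv (mlieBracket I V W) (fun q => g (f q)) p =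
        mfderiv I 𝓘(ℝ, ℝ) (g ∘ f) p (mlieBracket I V W p) := rfl
    rw [h3, mfderiv_comp p hgd (hfd p)]
    rfl
  rw [map_sub, ← h2, h1]
  exact sub_self _

/-- The vector field on a product with given components on the factors. -/
def prodVF (v : VF I (M := M)) (w : VF J (M := N)) : VF (I.prod J) (M := M × N) :=
  fun p => (v p.1, w p.2)

theorem SmoothVF.prodVF {v : VF I (M := M)} {w : VF J (M := N)} (hv : SmoothVF v)
    (hw : SmoothVF w) : SmoothVF (prodVF v w) := by
  intro p
  have h1 : ContMDiff (I.prod J) (I.tangent.prod J.tangent) ∞ (fun q : M × N =>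
      ((⟨q.1, v q.1⟩ : TangentBundle I M), (⟨q.2, w q.2⟩ : TangentBundle J N))) :=
    (ContMDiff.comp (g := fun q : M => (⟨q, v q⟩ : TangentBundle I M)) hv contMDiff_fst).prodMk
      (ContMDiff.comp (g := fun q : N => (⟨q, w q⟩ : TangentBundle J N)) hw contMDiff_snd)
  exact (contMDiff_equivTangentBundleProd_symm.comp h1) p

theorem smoothVF_zero : SmoothVF (0 : VF I (M := M)) := fun p =>
  (contMDiff_zeroSection (𝕜 := ℝ) (IB := I) (E := fun q : M => TangentSpace I q) (F := E)) p

/-- The two projections relate the fields to their components, and a tangent vector of the product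
is determined by its projections. `u` and `t` only supply the nowhere vanishing fields that
`mfderiv_mlieBracket` asks for. -/
theorem mlieBracket_prodVF {v v' u : VF I (M := M)} {w w' t : VF J (M := N)} (hv : SmoothVF v)
    (hv' : SmoothVF v') (hu : SmoothVF u) (hu0 : ∀ p, u p ≠ 0) (hw : SmoothVF w)
    (hw' : SmoothVF w') (ht : SmoothVF t) (ht0 : ∀ p, t p ≠ 0) (p : M × N) :
    mlieBracket (I.prod J) (prodVF v w) (prodVF v' w') p =
      (mlieBracket I v v' p.1, mlieBracket J w w' p.2) := by
  have hU : SmoothVF (prodVF u t : VF (I.prod J) (M := M × N)) := hu.prodVF ht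
  have hU0 : ∀ q, (prodVF u t : VF (I.prod J) (M := M × N)) q ≠ 0 := fun q h =>
    hu0 q.1 (congrArg Prod.fst h)
  have h1 := mfderiv_mlieBracket (f := (Prod.fst : M × N → M)) (I := I.prod J) (J := I)
    contMDiff_fst (hv.prodVF hw) (hv'.prodVF hw') hv hv' hU hU0 hu hu0
    (fun q => by rw [mfderiv_fst]; rfl) (fun q => by rw [mfderiv_fst]; rfl) p
  have h2 := mfderiv_mlieBracket (f := (Prod.snd : M × N → N)) (I := I.prod J) (J := J)
    contMDiff_snd (hv.prodVF hw) (hv'.prodVF hw') hw hw' hU hU0 ht ht0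
    (fun q => by rw [mfderiv_snd]; rfl) (fun q => by rw [mfderiv_snd]; rfl) p
  rw [mfderiv_fst] at h1
  rw [mfderiv_snd] at h2
  exact Prod.ext h1 h2

theorem dirDeriv_prodVF_fst {v : VF I (M := M)} {w : VF J (M := N)} {g : M → ℝ} {p : M × N}
    (hg : MDifferentiableAt I 𝓘(ℝ, ℝ) g p.1) :
    dirDeriv (prodVF v w) (fun q => g q.1) p = dirDeriv v g p.1 :=
  dirDeriv_comp (f := Prod.fst) mdifferentiableAt_fst hg (by rw [mfderiv_fst]; rfl)

theorem dirDeriv_prodVF_snd {v : VF I (M := M)} {w : VF J (M := N)} {g : N → ℝ} {p : M × N}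
    (hg : MDifferentiableAt J 𝓘(ℝ, ℝ) g p.2) :
    dirDeriv (prodVF v w) (fun q => g q.2) p = dirDeriv w g p.2 :=
  dirDeriv_comp (f := Prod.snd) mdifferentiableAt_snd hg (by rw [mfderiv_snd]; rfl)

theorem dirDeriv_zero_field (g : M → ℝ) (p : M) : dirDeriv (0 : VF I (M := M)) g p = 0 := by
  rw [dirDeriv_eq_mvfderiv]
  exact map_zero _

/-- The coordinate vector field on the line. -/
def unitVF : VF 𝓘(ℝ, ℝ) (M := ℝ) := fun _ => (1 : ℝ)

theorem smoothVF_unitVF : SmoothVF unitVF := fun _ =>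
  contMDiffAt_vectorSpace_iff_contDiffAt.2 contDiffAt_const

theorem unitVF_ne_zero (t : ℝ) : unitVF t ≠ 0 := one_ne_zero (α := ℝ)

theorem dirDeriv_unitVF (f : ℝ → ℝ) (t : ℝ) : dirDeriv unitVF f t = deriv f t := by
  have : dirDeriv unitVF f t = fderiv ℝ f t 1 := by
    change mfderiv 𝓘(ℝ, ℝ) 𝓘(ℝ, ℝ) f t (1 : ℝ) = _
    rw [mfderiv_eq_fderiv]
    rfl
  rw [this, fderiv_apply_one_eq_deriv]

end Product

/-! ### Derivatives and brackets in a frame -/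

section FrameCalculus

variable {E : Type*} [NormedAddCommGroup E] [NormedSpace ℝ E] {H : Type*} [TopologicalSpace H]
  {I : ModelWithCorners ℝ E H} {M : Type*} [TopologicalSpace M] [ChartedSpace H M]
  {ι : Type*} {Z : ι → VF I (M := M)} {f g : M → ℝ} {d d' : ι → M → ℝ}

/-- The function `f` is smooth, with derivatives `d i` along the vector fields `Z i`. -/
def HasFrameDerivs (Z : ι → VF I (M := M)) (f : M → ℝ) (d : ι → M → ℝ) : Prop :=
  ContMDiff I 𝓘(ℝ, ℝ) ∞ f ∧ ∀ i p, dirDeriv (Z i) f p = d i p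

namespace HasFrameDerivs

theorem mdifferentiableAt (h : HasFrameDerivs Z f d) (p : M) : MDifferentiableAt I 𝓘(ℝ, ℝ) f p :=
  (h.1 p).mdifferentiableAt (by simp)

theorem const (c : ℝ) : HasFrameDerivs Z (fun _ => c) fun _ _ => 0 :=
  ⟨contMDiff_const, fun _ _ => dirDeriv_const _ _ _⟩

theorem add (h : HasFrameDerivs Z f d) (h' : HasFrameDerivs Z g d') :
    HasFrameDerivs Z (fun p => f p + g p) fun i p => d i p + d' i p :=
  ⟨h.1.add h'.1, fun i p => by
    rw [dirDeriv_fun_add (h.mdifferentiableAt p) (h'.mdifferentiableAt p), h.2, h'.2]⟩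

theorem sub (h : HasFrameDerivs Z f d) (h' : HasFrameDerivs Z g d') :
    HasFrameDerivs Z (fun p => f p - g p) fun i p => d i p - d' i p :=
  ⟨h.1.sub h'.1, fun i p => by
    rw [dirDeriv_fun_sub (h.mdifferentiableAt p) (h'.mdifferentiableAt p), h.2, h'.2]⟩

theorem neg (h : HasFrameDerivs Z f d) : HasFrameDerivs Z (fun p => -f p) fun i p => -d i p :=
  ⟨h.1.neg, fun i p => by rw [dirDeriv_fun_neg, h.2]⟩

theorem mul (h : HasFrameDerivs Z f d) (h' : HasFrameDerivs Z g d') :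
    HasFrameDerivs Z (fun p => f p * g p) fun i p => f p * d' i p + g p * d i p :=
  ⟨h.1.mul h'.1, fun i p => by
    rw [dirDeriv_fun_mul (h.mdifferentiableAt p) (h'.mdifferentiableAt p), h.2, h'.2]⟩

theorem comp (h : HasFrameDerivs Z f d) {F F' : ℝ → ℝ} (hF : ∀ p, ContDiffAt ℝ ∞ F (f p))
    (hF' : ∀ p, HasDerivAt F (F' (f p)) (f p)) :
    HasFrameDerivs Z (fun p => F (f p)) fun i p => F' (f p) * d i p :=
  ⟨fun p => (hF p).contMDiffAt.comp p (h.1 p), fun i p => by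
    rw [dirDeriv_comp_real (hF' p) (h.mdifferentiableAt p), h.2]⟩

theorem inv (h : HasFrameDerivs Z f d) (h0 : ∀ p, f p ≠ 0) :
    HasFrameDerivs Z (fun p => (f p)⁻¹) fun i p => -(f p ^ 2)⁻¹ * d i p :=
  h.comp (F := fun t => t⁻¹) (F' := fun t => -(t ^ 2)⁻¹) (fun p => contDiffAt_inv ℝ (h0 p))
    fun p => hasDerivAt_inv (h0 p)

theorem congr {f' : M → ℝ} {d₂ : ι → M → ℝ} (h : HasFrameDerivs Z f d) (hf : ∀ p, f' p = f p)
    (hd : ∀ i p, d₂ i p = d i p) : HasFrameDerivs Z f' d₂ := by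
  obtain rfl : f' = f := funext hf
  obtain rfl : d₂ = d := funext fun i => funext (hd i)
  exact h

end HasFrameDerivs

variable [IsManifold I ∞ M] [CompleteSpace E] [Fintype ι]

/-- The Lie bracket of two combinations of the fields `Z i`, in terms of the coefficients `C` of
the brackets of these fields. -/
theorem mlieBracket_of_frame {u v : ι → M → ℝ} {du dv : ι → ι → M → ℝ} {C : ι → ι → ι → M → ℝ}
    {V W : VF I (M := M)} (hZ : ∀ i, SmoothVF (Z i))
    (hC : ∀ i j p, mlieBracket I (Z i) (Z j) p = ∑ k, C i j k p • Z k p)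
    (hV : ∀ p, V p = ∑ i, u i p • Z i p) (hW : ∀ p, W p = ∑ i, v i p • Z i p)
    (hu : ∀ i, HasFrameDerivs Z (u i) (du i)) (hv : ∀ i, HasFrameDerivs Z (v i) (dv i)) (p : M) :
    mlieBracket I V W p = ∑ k, (∑ i, (u i p * dv k i p - v i p * du k i p)
      + ∑ i, ∑ j, u i p * v j p * C i j k p) • Z k p := by
  obtain rfl : V = fun p => ∑ i, u i p • Z i p := funext hV
  obtain rfl : W = fun p => ∑ i, v i p • Z i p := funext hW
  rw [mlieBracket_sum_smul (fun i => (hu i).1 p) (fun i => (hv i).1 p) fun i => hZ i p]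
  simp only [hC, (hu _).2, (hv _).2, Finset.smul_sum, smul_smul, add_smul, Finset.sum_add_distrib,
    Finset.sum_smul]
  congr 1
  exact (Finset.sum_congr rfl fun _ _ => Finset.sum_comm).trans Finset.sum_comm

end FrameCalculus

/-! ### The frame lifted from the two surfaces and the fibre. -/

section TwistorFrame

variable {S₁ S₂ : Type*}
  [TopologicalSpace S₁] [ChartedSpace (EuclideanSpace ℝ (Fin 2)) S₁] [IsManifold (𝓡 2) ∞ S₁]
  [TopologicalSpace S₂] [ChartedSpace (EuclideanSpace ℝ (Fin 2)) S₂] [IsManifold (𝓡 2) ∞ S₂]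
  (F₁ : FramedSurface S₁) (F₂ : FramedSurface S₂)

/-- The frame `e₁, e₂, e₃, e₄, ∂_φ` of the twistor space. -/
def liftFrame : Fin 5 → VF I5 (M := Twistor S₁ S₂) :=
  ![lift₁ F₁ 0, lift₁ F₁ 1, lift₂ F₂ 0, lift₂ F₂ 1, dφ]

/-- The coframe `σ¹, σ², σ³, σ⁴, dφ` of the twistor space. -/
def liftCoframe : Fin 5 → OneForm I5 (M := Twistor S₁ S₂) :=
  ![σ₁ F₁ 0, σ₁ F₁ 1, σ₂ F₂ 0, σ₂ F₂ 1, formφ]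

theorem σ₁_apply (i : Fin 2) (p : Twistor S₁ S₂) (v : TangentSpace I5 p) :
    σ₁ F₁ i p v = F₁.metric.inner p.1 (F₁.e i p.1) v.1 := by
  have : mfderiv I5 (𝓡 2) (fun q : Twistor S₁ S₂ => q.1) p v = v.1 := by
    erw [mfderiv_fst]; rfl
  exact congrArg _ this

theorem σ₂_apply (i : Fin 2) (p : Twistor S₁ S₂) (v : TangentSpace I5 p) :
    σ₂ F₂ i p v = F₂.metric.inner p.2.1 (F₂.e i p.2.1) v.2.1 := by
  have : mfderiv I5 (𝓡 2) (fun q : Twistor S₁ S₂ => q.2.1) p v = v.2.1 := by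
    have h := mfderiv_comp (I := I5) (I' := (𝓡 2).prod 𝓘(ℝ, ℝ)) (I'' := 𝓡 2) p
      (g := (Prod.fst : S₂ × ℝ → S₂)) (f := (Prod.snd : Twistor S₁ S₂ → S₂ × ℝ))
      mdifferentiableAt_fst mdifferentiableAt_snd
    rw [mfderiv_fst, mfderiv_snd] at h
    exact congrArg (fun L : TangentSpace I5 p →L[ℝ] TangentSpace (𝓡 2) p.2.1 => L v) h
  exact congrArg _ this

theorem formφ_apply (p : Twistor S₁ S₂) (v : TangentSpace I5 p) : formφ p v = v.2.2 := by
  have h := mfderiv_comp (I := I5) (I' := (𝓡 2).prod 𝓘(ℝ, ℝ)) (I'' := 𝓘(ℝ, ℝ)) p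
    (g := (Prod.snd : S₂ × ℝ → ℝ)) (f := (Prod.snd : Twistor S₁ S₂ → S₂ × ℝ))
    mdifferentiableAt_snd mdifferentiableAt_snd
  rw [mfderiv_snd, mfderiv_snd] at h
  exact congrArg (fun L : TangentSpace I5 p →L[ℝ] ℝ => L v) h

theorem smoothForm_liftCoframe (i : Fin 5) : SmoothForm (liftCoframe F₁ F₂ i) := by
  have h1 : ∀ i, SmoothForm (σ₁ F₁ i : OneForm I5 (M := Twistor S₁ S₂)) := by
    intro i p X hX
    have hf : ContMDiff I5 (𝓡 2) ∞ (fun q : Twistor S₁ S₂ => q.1) := contMDiff_fst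
    refine contMDiffAt_inner F₁.metric (b := fun q : Twistor S₁ S₂ => q.1)
      (ContMDiffAt.comp (g := fun y => (⟨y, F₁.e i y⟩ : TangentBundle (𝓡 2) S₁)) p
        (F₁.smooth i p.1) (hf p)) ?_
    -- The tangent map of the projection turns `X` into a smooth section along the projection.
    exact ContMDiffAt.comp p ((hf.contMDiff_tangentMap (m := ∞) (by simp)) _) hX
  have h2 : ∀ i, SmoothForm (σ₂ F₂ i : OneForm I5 (M := Twistor S₁ S₂)) := by
    intro i p X hX
    have hf : ContMDiff I5 (𝓡 2) ∞ (fun q : Twistor S₁ S₂ => q.2.1) :=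
      contMDiff_fst.comp contMDiff_snd
    refine contMDiffAt_inner F₂.metric (b := fun q : Twistor S₁ S₂ => q.2.1)
      (ContMDiffAt.comp (g := fun y => (⟨y, F₂.e i y⟩ : TangentBundle (𝓡 2) S₂)) p
        (F₂.smooth i p.2.1) (hf p)) ?_
    exact ContMDiffAt.comp p ((hf.contMDiff_tangentMap (m := ∞) (by simp)) _) hX
  have h3 : SmoothForm (formφ : OneForm I5 (M := Twistor S₁ S₂)) := fun p X hX =>
    SmoothVFAt.dirDeriv hX ((contMDiff_snd.comp contMDiff_snd) p)
  fin_cases i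
  exacts [h1 0, h1 1, h2 0, h2 1, h3]

/-- As product fields the lifted fields have brackets and derivatives computed factor by factor. -/
theorem liftFrame_eq_prodVF (i : Fin 5) : liftFrame F₁ F₂ i =
    prodVF ((![F₁.e 0, F₁.e 1, 0, 0, 0] : Fin 5 → VF (𝓡 2) (M := S₁)) i)
      (prodVF ((![0, 0, F₂.e 0, F₂.e 1, 0] : Fin 5 → VF (𝓡 2) (M := S₂)) i)
        ((![0, 0, 0, 0, unitVF] : Fin 5 → VF 𝓘(ℝ, ℝ) (M := ℝ)) i)) := by
  fin_cases i <;> rfl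

theorem smoothVF_liftFrame (i : Fin 5) : SmoothVF (liftFrame F₁ F₂ i) := by
  rw [liftFrame_eq_prodVF]
  refine SmoothVF.prodVF ?_ (SmoothVF.prodVF ?_ ?_) <;> fin_cases i
  exacts [F₁.smooth 0, F₁.smooth 1, smoothVF_zero, smoothVF_zero, smoothVF_zero,
    smoothVF_zero, smoothVF_zero, F₂.smooth 0, F₂.smooth 1, smoothVF_zero,
    smoothVF_zero, smoothVF_zero, smoothVF_zero, smoothVF_zero, smoothVF_unitVF]

theorem σ₁_lift₁ (i j : Fin 2) (p : Twistor S₁ S₂) :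
    σ₁ F₁ i p (lift₁ F₁ j p) = if i = j then 1 else 0 :=
  (σ₁_apply F₁ i p _).trans (F₁.orthonormal _ i j)

theorem σ₁_lift₂ (i j : Fin 2) (p : Twistor S₁ S₂) : σ₁ F₁ i p (lift₂ F₂ j p) = 0 :=
  (σ₁_apply F₁ i p _).trans (map_zero _)

theorem σ₁_dφ (i : Fin 2) (p : Twistor S₁ S₂) : σ₁ F₁ i p (dφ p) = 0 :=
  (σ₁_apply F₁ i p _).trans (map_zero _)

theorem σ₂_lift₁ (i j : Fin 2) (p : Twistor S₁ S₂) : σ₂ F₂ i p (lift₁ F₁ j p) = 0 :=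
  (σ₂_apply F₂ i p _).trans (map_zero _)

theorem σ₂_lift₂ (i j : Fin 2) (p : Twistor S₁ S₂) :
    σ₂ F₂ i p (lift₂ F₂ j p) = if i = j then 1 else 0 :=
  (σ₂_apply F₂ i p _).trans (F₂.orthonormal _ i j)

theorem σ₂_dφ (i : Fin 2) (p : Twistor S₁ S₂) : σ₂ F₂ i p (dφ p) = 0 :=
  (σ₂_apply F₂ i p _).trans (map_zero _)

theorem formφ_lift₁ (i : Fin 2) (p : Twistor S₁ S₂) : formφ p (lift₁ F₁ i p) = 0 :=
  formφ_apply p _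

theorem formφ_lift₂ (i : Fin 2) (p : Twistor S₁ S₂) : formφ p (lift₂ F₂ i p) = 0 :=
  formφ_apply p _

theorem formφ_dφ (p : Twistor S₁ S₂) : formφ p (dφ p) = 1 := formφ_apply p _

theorem isDualFrame_lift : IsDualFrame (liftCoframe F₁ F₂) (liftFrame F₁ F₂) where
  smoothForm := smoothForm_liftCoframe F₁ F₂
  smoothVF := smoothVF_liftFrame F₁ F₂
  dual i j p := by
    fin_cases i <;> fin_cases j <;>
      simp [liftCoframe, liftFrame, σ₁_lift₁, σ₁_lift₂, σ₁_dφ, σ₂_lift₁, σ₂_lift₂, σ₂_dφ,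
        formφ_lift₁, formφ_lift₂, formφ_dφ]
  expand p v := by
    have h1 := F₁.expand p.1 v.1
    have h2 := F₂.expand p.2.1 v.2.1
    simp only [Fin.sum_univ_two, ← σ₁_apply, ← σ₂_apply] at h1 h2
    simp only [Fin.sum_univ_five]
    refine Prod.ext ?_ (Prod.ext ?_ ?_)
    · change σ₁ F₁ 0 p v • F₁.e 0 p.1 + σ₁ F₁ 1 p v • F₁.e 1 p.1
        + σ₂ F₂ 0 p v • (0 : TangentSpace (𝓡 2) p.1) + σ₂ F₂ 1 p v • (0 : TangentSpace (𝓡 2) p.1)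
        + formφ p v • (0 : TangentSpace (𝓡 2) p.1) = v.1
      simp only [smul_zero]
      exact (congrArg (· + _ + _ + _) h1).trans (by simp only [add_zero]; exact add_zero _)
    · change σ₁ F₁ 0 p v • (0 : TangentSpace (𝓡 2) p.2.1)
        + σ₁ F₁ 1 p v • (0 : TangentSpace (𝓡 2) p.2.1)
        + σ₂ F₂ 0 p v • F₂.e 0 p.2.1 + σ₂ F₂ 1 p v • F₂.e 1 p.2.1
        + formφ p v • (0 : TangentSpace (𝓡 2) p.2.1) = v.2.1
      simp only [smul_zero, add_zero, zero_add]
      exact h2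
    · change σ₁ F₁ 0 p v * 0 + σ₁ F₁ 1 p v * 0 + σ₂ F₂ 0 p v * 0 + σ₂ F₂ 1 p v * 0
        + formφ p v * 1 = v.2.2
      rw [formφ_apply]
      ring

theorem mlieBracket_prodVF₃ (F₁ : FramedSurface S₁) (F₂ : FramedSurface S₂)
    {v v' : VF (𝓡 2) (M := S₁)} {w w' : VF (𝓡 2) (M := S₂)}
    {t t' : VF 𝓘(ℝ, ℝ) (M := ℝ)} (hv : SmoothVF v) (hv' : SmoothVF v') (hw : SmoothVF w)
    (hw' : SmoothVF w') (ht : SmoothVF t) (ht' : SmoothVF t') (p : Twistor S₁ S₂) :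
    mlieBracket I5 (prodVF v (prodVF w t)) (prodVF v' (prodVF w' t')) p =
      (mlieBracket (𝓡 2) v v' p.1, (mlieBracket (𝓡 2) w w' p.2.1,
        mlieBracket 𝓘(ℝ, ℝ) t t' p.2.2)) := by
  have h0 : ∀ q : S₂ × ℝ, prodVF (F₂.e 0) unitVF q ≠ 0 := fun q h =>
    F₂.e_ne_zero 0 q.1 (congrArg Prod.fst h)
  rw [mlieBracket_prodVF hv hv' (F₁.smooth 0) (F₁.e_ne_zero 0) (hw.prodVF ht) (hw'.prodVF ht')
    ((F₂.smooth 0).prodVF smoothVF_unitVF) h0,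
    mlieBracket_prodVF hw hw' (F₂.smooth 0) (F₂.e_ne_zero 0) ht ht' smoothVF_unitVF unitVF_ne_zero]
  rfl

/-- The coefficients of the brackets of the frame `e₁, e₂, e₃, e₄, ∂_φ`, for `a₁ = a₃ = 0`. -/
def liftBracket (a b : ℝ) (i j k : Fin 5) : ℝ :=
  (if k = 1 then (if i = 0 ∧ j = 1 then a else 0) - if i = 1 ∧ j = 0 then a else 0 else 0)
    + if k = 3 then (if i = 2 ∧ j = 3 then b else 0) - if i = 3 ∧ j = 2 then b else 0 else 0

theorem mlieBracket_liftFrame (h₁ : ∀ x, F₁.a 0 x = 0) (h₂ : ∀ x, F₂.a 0 x = 0) (i j : Fin 5)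
    (p : Twistor S₁ S₂) : mlieBracket I5 (liftFrame F₁ F₂ i) (liftFrame F₁ F₂ j) p =
      ∑ k, liftBracket (a₂ F₁ p) (a₄ F₂ p) i j k • liftFrame F₁ F₂ k p := by
  have s1 : ∀ i, SmoothVF ((![F₁.e 0, F₁.e 1, 0, 0, 0] : Fin 5 → VF (𝓡 2) (M := S₁)) i) := by
    intro i
    fin_cases i
    exacts [F₁.smooth 0, F₁.smooth 1, smoothVF_zero, smoothVF_zero, smoothVF_zero]
  have s2 : ∀ i, SmoothVF ((![0, 0, F₂.e 0, F₂.e 1, 0] : Fin 5 → VF (𝓡 2) (M := S₂)) i) := by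
    intro i
    fin_cases i
    exacts [smoothVF_zero, smoothVF_zero, F₂.smooth 0, F₂.smooth 1, smoothVF_zero]
  have s3 : ∀ i, SmoothVF ((![0, 0, 0, 0, unitVF] : Fin 5 → VF 𝓘(ℝ, ℝ) (M := ℝ)) i) := by
    intro i
    fin_cases i
    exacts [smoothVF_zero, smoothVF_zero, smoothVF_zero, smoothVF_zero, smoothVF_unitVF]
  have b1 : mlieBracket (𝓡 2) ((![F₁.e 0, F₁.e 1, 0, 0, 0] : Fin 5 → VF (𝓡 2) (M := S₁)) i)
      ((![F₁.e 0, F₁.e 1, 0, 0, 0] : Fin 5 → VF (𝓡 2) (M := S₁)) j) p.1 =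
      liftBracket (a₂ F₁ p) (a₄ F₂ p) i j 1 • F₁.e 1 p.1 := by
    have := F₁.bracket p.1
    have h' := mlieBracket_swap_apply (I := 𝓡 2) (V := F₁.e 1) (W := F₁.e 0) (x := p.1)
    fin_cases i <;> fin_cases j <;> simp [liftBracket, this, h', h₁, a₂]
  have b2 : mlieBracket (𝓡 2) ((![0, 0, F₂.e 0, F₂.e 1, 0] : Fin 5 → VF (𝓡 2) (M := S₂)) i)
      ((![0, 0, F₂.e 0, F₂.e 1, 0] : Fin 5 → VF (𝓡 2) (M := S₂)) j) p.2.1 =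
      liftBracket (a₂ F₁ p) (a₄ F₂ p) i j 3 • F₂.e 1 p.2.1 := by
    have := F₂.bracket p.2.1
    have h' := mlieBracket_swap_apply (I := 𝓡 2) (V := F₂.e 1) (W := F₂.e 0) (x := p.2.1)
    fin_cases i <;> fin_cases j <;> simp [liftBracket, this, h', h₂, a₄]
  have b3 : mlieBracket 𝓘(ℝ, ℝ) ((![0, 0, 0, 0, unitVF] : Fin 5 → VF 𝓘(ℝ, ℝ) (M := ℝ)) i)
      ((![0, 0, 0, 0, unitVF] : Fin 5 → VF 𝓘(ℝ, ℝ) (M := ℝ)) j) p.2.2 = 0 := by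
    fin_cases i <;> fin_cases j <;> simp
  have hr : ∑ k, liftBracket (a₂ F₁ p) (a₄ F₂ p) i j k • liftFrame F₁ F₂ k p =
      liftBracket (a₂ F₁ p) (a₄ F₂ p) i j 1 • lift₁ F₁ 1 p
        + liftBracket (a₂ F₁ p) (a₄ F₂ p) i j 3 • lift₂ F₂ 1 p := by
    simp [Fin.sum_univ_five, liftBracket, liftFrame]
  rw [liftFrame_eq_prodVF, liftFrame_eq_prodVF, mlieBracket_prodVF₃ F₁ F₂ (s1 i) (s1 j) (s2 i)
    (s2 j) (s3 i) (s3 j), b1, b2, b3, hr]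
  refine Prod.ext ?_ (Prod.ext ?_ ?_)
  · change _ = liftBracket (a₂ F₁ p) (a₄ F₂ p) i j 1 • F₁.e 1 p.1
        + liftBracket (a₂ F₁ p) (a₄ F₂ p) i j 3 • (0 : TangentSpace (𝓡 2) p.1)
    rw [smul_zero]
    exact (add_zero _).symm
  · change _ = liftBracket (a₂ F₁ p) (a₄ F₂ p) i j 1 • (0 : TangentSpace (𝓡 2) p.2.1)
        + liftBracket (a₂ F₁ p) (a₄ F₂ p) i j 3 • F₂.e 1 p.2.1
    rw [smul_zero]
    exact (zero_add _).symm
  · change (0 : ℝ) = liftBracket (a₂ F₁ p) (a₄ F₂ p) i j 1 * 0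
        + liftBracket (a₂ F₁ p) (a₄ F₂ p) i j 3 * 0
    ring

/-! ### Derivatives of the coefficient functions -/

theorem hasFrameDerivs_fst {f : S₁ → ℝ} (hf : ContMDiff (𝓡 2) 𝓘(ℝ, ℝ) ∞ f) :
    HasFrameDerivs (liftFrame F₁ F₂) (fun p : Twistor S₁ S₂ => f p.1)
      ![fun p => dirDeriv (F₁.e 0) f p.1, fun p => dirDeriv (F₁.e 1) f p.1, 0, 0, 0] := by
  refine ⟨hf.comp contMDiff_fst, fun i p => ?_⟩
  rw [liftFrame_eq_prodVF, dirDeriv_prodVF_fst ((hf p.1).mdifferentiableAt (by simp))]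
  fin_cases i
  exacts [rfl, rfl, dirDeriv_zero_field _ _, dirDeriv_zero_field _ _, dirDeriv_zero_field _ _]

theorem hasFrameDerivs_snd {f : S₂ → ℝ} (hf : ContMDiff (𝓡 2) 𝓘(ℝ, ℝ) ∞ f) :
    HasFrameDerivs (liftFrame F₁ F₂) (fun p : Twistor S₁ S₂ => f p.2.1)
      ![0, 0, fun p => dirDeriv (F₂.e 0) f p.2.1, fun p => dirDeriv (F₂.e 1) f p.2.1, 0] := by
  have h1 : ContMDiff ((𝓡 2).prod 𝓘(ℝ, ℝ)) 𝓘(ℝ, ℝ) ∞ (fun q : S₂ × ℝ => f q.1) :=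
    hf.comp contMDiff_fst
  refine ⟨h1.comp contMDiff_snd, fun i p => ?_⟩
  rw [liftFrame_eq_prodVF, dirDeriv_prodVF_snd (g := fun q : S₂ × ℝ => f q.1)
    ((h1 p.2).mdifferentiableAt (by simp)),
    dirDeriv_prodVF_fst ((hf p.2.1).mdifferentiableAt (by simp))]
  fin_cases i
  exacts [dirDeriv_zero_field _ _, dirDeriv_zero_field _ _, rfl, rfl, dirDeriv_zero_field _ _]

theorem hasFrameDerivs_angle {f f' : ℝ → ℝ} (hf : ContDiff ℝ ∞ f)
    (hf' : ∀ t, HasDerivAt f (f' t) t) :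
    HasFrameDerivs (liftFrame F₁ F₂) (fun p : Twistor S₁ S₂ => f p.2.2)
      ![0, 0, 0, 0, fun p => f' p.2.2] := by
  have h1 : ContMDiff ((𝓡 2).prod 𝓘(ℝ, ℝ)) 𝓘(ℝ, ℝ) ∞ (fun q : S₂ × ℝ => f q.2) :=
    hf.contMDiff.comp contMDiff_snd
  refine ⟨h1.comp contMDiff_snd, fun i p => ?_⟩
  rw [liftFrame_eq_prodVF, dirDeriv_prodVF_snd (g := fun q : S₂ × ℝ => f q.2)
    ((h1 p.2).mdifferentiableAt (by simp)),
    dirDeriv_prodVF_snd ((hf.contMDiff p.2.2).mdifferentiableAt (by simp))]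
  fin_cases i
  exacts [dirDeriv_zero_field _ _, dirDeriv_zero_field _ _, dirDeriv_zero_field _ _,
    dirDeriv_zero_field _ _, (dirDeriv_unitVF _ _).trans (hf' _).deriv]

end TwistorFrame

/-! ### Change of frame. -/

section ChangeOfFrame

variable {E : Type*} [NormedAddCommGroup E] [NormedSpace ℝ E] {H : Type*} [TopologicalSpace H]
  {I : ModelWithCorners ℝ E H} {M : Type*} [TopologicalSpace M] [ChartedSpace H M]
  [IsManifold I ∞ M] {ι : Type*} [Fintype ι] [DecidableEq ι]

theorem IsDualFrame.change {θ θ' : ι → OneForm I (M := M)} {Z Z' : ι → VF I (M := M)}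
    {A B : ι → ι → M → ℝ} (h : IsDualFrame θ Z)
    (hA : ∀ i j, ContMDiff I 𝓘(ℝ, ℝ) ∞ (A i j)) (hB : ∀ i j, ContMDiff I 𝓘(ℝ, ℝ) ∞ (B i j))
    (hZ : ∀ i p, Z' i p = ∑ j, A i j p • Z j p) (hθ : ∀ i p, θ' i p = ∑ j, B i j p • θ j p)
    (hBA : ∀ i j p, ∑ k, B i k p * A j k p = if i = j then 1 else 0) : IsDualFrame θ' Z' where
  smoothForm i := by
    rw [show θ' i = fun p => ∑ j, B i j p • θ j p from funext (hθ i)]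
    exact SmoothForm.sum_smul (hB i) h.smoothForm
  smoothVF i p := by
    rw [show Z' i = fun p => ∑ j, A i j p • Z j p from funext (hZ i)]
    exact SmoothVFAt.sum_smul (fun j => hA i j p) fun j => h.smoothVF j p
  dual i j p := by
    rw [hθ, hZ, ← hBA i j p]
    simp [h.dual, mul_comm (A j _ p)]
  expand p v := by
    -- Duality says that `B` is a left inverse of the transpose of `A`. For square matrices it is
    -- then also a right inverse, which is the expansion property.
    have h1 : (Matrix.of fun i k => B i k p) * (Matrix.of fun i k => A i k p).transpose = 1 := by
      ext i j
      simp only [Matrix.mul_apply, Matrix.of_apply, Matrix.transpose_apply, Matrix.one_apply, hBA]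
    have h2 := mul_eq_one_comm.1 h1
    have h3 : ∀ k j, ∑ i, A i k p * B i j p = if k = j then 1 else 0 := by
      intro k j
      have := congrArg (fun X => X k j) h2
      simpa only [Matrix.mul_apply, Matrix.of_apply, Matrix.transpose_apply, Matrix.one_apply]
        using this
    conv_rhs => rw [← h.expand p v]
    calc ∑ i, θ' i p v • Z' i p
        = ∑ k, ∑ j, (θ j p v * ∑ i, A i k p * B i j p) • Z k p := by
          simp only [hθ, hZ, sum_apply, smul_apply, smul_eq_mul, Finset.smul_sum, smul_smul,
            Finset.mul_sum, Finset.sum_mul, Finset.sum_smul]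
          rw [Finset.sum_comm]
          refine Finset.sum_congr rfl fun k _ => ?_
          rw [Finset.sum_comm]
          exact Finset.sum_congr rfl fun j _ => Finset.sum_congr rfl fun i _ => by ring_nf
      _ = ∑ k, θ k p v • Z k p := by
          simp only [h3, mul_ite, mul_one, mul_zero, ite_smul, zero_smul, Finset.sum_ite_eq,
            Finset.mem_univ, if_true]

end ChangeOfFrame

/-! ### The horizontal frame and its brackets. -/

section TwistorFrame

variable {S₁ S₂ : Type*}
  [TopologicalSpace S₁] [ChartedSpace (EuclideanSpace ℝ (Fin 2)) S₁] [IsManifold (𝓡 2) ∞ S₁]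
  [TopologicalSpace S₂] [ChartedSpace (EuclideanSpace ℝ (Fin 2)) S₂] [IsManifold (𝓡 2) ∞ S₂]
  (F₁ : FramedSurface S₁) (F₂ : FramedSurface S₂) (lam : ℝ)

/-- The properties of the frames of the two surfaces that the computations depend on. -/
structure IsNormalized : Prop where
  a_fst : ∀ x, F₁.a 0 x = 0
  dirDeriv_a : ∀ x, dirDeriv (F₁.e 1) (F₁.a 1) x = 0
  dirDeriv_curv : ∀ x, dirDeriv (F₁.e 1) F₁.curv x = 0
  a_snd : ∀ y, F₂.a 0 y = 0
  curv_snd : ∀ y, F₂.curv y = lam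
  curv_ne : ∀ x, F₁.curv x ≠ lam

/-- The coefficients of the rotated frame in the frame `e₁, e₂, e₃, e₄, ∂_φ`. -/
def rotationCoeff (c s a b : ℝ) : Fin 5 → Fin 5 → ℝ :=
  ![![1, 0, 0, 0, 0], ![0, 1, 0, 0, -a], ![0, 0, c, s, b * s], ![0, 0, -s, c, b * c],
    ![0, 0, 0, 0, 1]]

/-- The coefficients of the dual of the rotated frame. -/
def rotationCoeffDual (c s a b : ℝ) : Fin 5 → Fin 5 → ℝ :=
  ![![1, 0, 0, 0, 0], ![0, 1, 0, 0, 0], ![0, 0, c, s, 0], ![0, 0, -s, c, 0], ![0, a, 0, -b, 1]]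

/-- The frame of the twistor space that consists of the horizontal lifts of `e₁`, `e₂`,
`cos φ e₃ + sin φ e₄`, `-sin φ e₃ + cos φ e₄` and of `∂_φ`. -/
def horizontalFrame (i : Fin 5) : VF I5 (M := Twistor S₁ S₂) := fun p =>
  ∑ j, rotationCoeff (Real.cos p.2.2) (Real.sin p.2.2) (a₂ F₁ p) (a₄ F₂ p) i j
    • liftFrame F₁ F₂ j p

/-- The dual coframe of `horizontalFrame`. -/
def horizontalCoframe (i : Fin 5) : OneForm I5 (M := Twistor S₁ S₂) := fun p =>
  ∑ j, rotationCoeffDual (Real.cos p.2.2) (Real.sin p.2.2) (a₂ F₁ p) (a₄ F₂ p) i j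
    • liftCoframe F₁ F₂ j p

/-- The derivatives of `rotationCoeff` along the frame `e₁, e₂, e₃, e₄, ∂_φ`. -/
def rotationCoeffDeriv (c s a b k l e : ℝ) : Fin 5 → Fin 5 → Fin 5 → ℝ :=
  ![0, ![0, 0, 0, 0, ![-(k + a ^ 2), 0, 0, 0, 0]],
    ![0, 0, ![0, 0, 0, 0, -s], ![0, 0, 0, 0, c], ![0, 0, s * (l + b ^ 2), s * e, b * c]],
    ![0, 0, ![0, 0, 0, 0, -c], ![0, 0, 0, 0, -s], ![0, 0, c * (l + b ^ 2), c * e, -(b * s)]], 0]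

variable {F₁ F₂ lam} (hN : IsNormalized F₁ F₂ lam)
include hN

/-- The definitions of the curvatures give e₁(a₂) = κ + a₂² and e₃(a₄) = λ + a₄². Nothing is known
about e₄(a₄), which is carried along as the parameter `e` and cancels in the brackets. -/
theorem IsNormalized.hasFrameDerivs_rotationCoeff (i j : Fin 5) :
    HasFrameDerivs (liftFrame F₁ F₂)
      (fun p : Twistor S₁ S₂ => rotationCoeff (Real.cos p.2.2) (Real.sin p.2.2) (a₂ F₁ p)
        (a₄ F₂ p) i j)
      fun l p => rotationCoeffDeriv (Real.cos p.2.2) (Real.sin p.2.2) (a₂ F₁ p) (a₄ F₂ p)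
        (κ F₁ p) lam (dirDeriv (F₂.e 1) (F₂.a 1) p.2.1) i j l := by
  have ha := hasFrameDerivs_fst F₁ F₂ (F₁.contMDiff_a 1)
  have hb := hasFrameDerivs_snd F₁ F₂ (F₂.contMDiff_a 1)
  have hs := hasFrameDerivs_angle F₁ F₂ Real.contDiff_sin Real.hasDerivAt_sin
  have hc := hasFrameDerivs_angle F₁ F₂ Real.contDiff_cos Real.hasDerivAt_cos
  have h0 := HasFrameDerivs.const (Z := liftFrame F₁ F₂) 0
  have h1 := HasFrameDerivs.const (Z := liftFrame F₁ F₂) 1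
  have e1 := F₁.dirDeriv_a_one hN.a_fst
  have e2 := hN.dirDeriv_a
  have e3 := F₂.dirDeriv_a_one hN.a_snd
  fin_cases i <;> fin_cases j
  all_goals first
    | exact h0.congr (fun _ => rfl) fun l _ => by
        fin_cases l <;> simp [rotationCoeffDeriv]
    | exact h1.congr (fun _ => rfl) fun l _ => by
        fin_cases l <;> simp [rotationCoeffDeriv]
    | exact hc.congr (fun _ => rfl) fun l _ => by
        fin_cases l <;> simp [rotationCoeffDeriv]
    | exact hs.congr (fun _ => rfl) fun l _ => by
        fin_cases l <;> simp [rotationCoeffDeriv]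
    | exact hs.neg.congr (fun _ => rfl) fun l _ => by
        fin_cases l <;> simp [rotationCoeffDeriv]
    | exact ha.neg.congr (fun _ => rfl) fun l _ => by
        fin_cases l <;> simp [rotationCoeffDeriv, e1, e2, a₂, κ]
    | exact (hb.mul hs).congr (fun _ => rfl) fun l _ => by
        fin_cases l <;> simp [rotationCoeffDeriv, e3, hN.curv_snd, a₄]
    | exact (hb.mul hc).congr (fun _ => rfl) fun l _ => by
        fin_cases l <;> simp [rotationCoeffDeriv, e3, hN.curv_snd, a₄]

theorem IsNormalized.isDualFrame :
    IsDualFrame (horizontalCoframe F₁ F₂) (horizontalFrame F₁ F₂) := by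
  have ha := (hasFrameDerivs_fst F₁ F₂ (F₁.contMDiff_a 1)).1
  have hb := (hasFrameDerivs_snd F₁ F₂ (F₂.contMDiff_a 1)).1
  have hs := (hasFrameDerivs_angle F₁ F₂ Real.contDiff_sin Real.hasDerivAt_sin).1
  have hc := (hasFrameDerivs_angle F₁ F₂ Real.contDiff_cos Real.hasDerivAt_cos).1
  refine (isDualFrame_lift F₁ F₂).change
    (fun i j => (hN.hasFrameDerivs_rotationCoeff i j).1) (fun i j => ?_) (fun i p => rfl)
    (fun i p => rfl) fun i j p => ?_
  · fin_cases i <;> fin_cases j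
    all_goals first
      | exact contMDiff_const
      | exact hc
      | exact hs
      | exact hs.neg
      | exact ha
      | exact hb.neg
  · have := Real.sin_sq_add_cos_sq p.2.2
    fin_cases i <;> fin_cases j <;>
      simp [rotationCoeff, rotationCoeffDual, Fin.sum_univ_five] <;>
      first | ring1 | linear_combination this

omit hN

/-- The coefficients of the brackets of `horizontalFrame`. -/
def horizontalBracket (a k l : ℝ) : Fin 5 → Fin 5 → Fin 5 → ℝ :=
  ![![0, ![0, a, 0, 0, -k], 0, 0, 0],
    ![![0, -a, 0, 0, k], 0, ![0, 0, 0, -a, 0], ![0, 0, a, 0, 0], 0],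
    ![0, ![0, 0, 0, a, 0], 0, ![0, 0, 0, 0, l], ![0, 0, 0, -1, 0]],
    ![0, ![0, 0, -a, 0, 0], ![0, 0, 0, 0, -l], 0, ![0, 0, 1, 0, 0]],
    ![0, 0, ![0, 0, 0, 1, 0], ![0, 0, -1, 0, 0], 0]]

-- Parallel transport absorbs the connection term a₄ and the angle: ∂_φ acts by rotation, and the
-- curvatures appear as the vertical parts of the brackets of horizontal lifts. The identity `h` is
-- needed only to collect the coefficient of λ.
set_option maxHeartbeats 4000000 in
theorem horizontalBracket_eq {c s : ℝ} (h : s ^ 2 + c ^ 2 = 1) (a b k l e : ℝ) (i j n : Fin 5) :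
    ∑ m, (rotationCoeff c s a b i m * rotationCoeffDeriv c s a b k l e j n m
        - rotationCoeff c s a b j m * rotationCoeffDeriv c s a b k l e i n m)
      + ∑ m, ∑ m', rotationCoeff c s a b i m * rotationCoeff c s a b j m' * liftBracket a b m m' n
    = ∑ m, horizontalBracket a k l i j m * rotationCoeff c s a b m n := by
  fin_cases i <;> fin_cases j <;> fin_cases n <;>
    simp [Fin.sum_univ_five, rotationCoeff, rotationCoeffDeriv, liftBracket, horizontalBracket] <;>
    first | ring1 | linear_combination l * h | linear_combination -l * h

include hN in
theorem IsNormalized.mlieBracket_horizontalFrame (i j : Fin 5) (p : Twistor S₁ S₂) :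
    mlieBracket I5 (horizontalFrame F₁ F₂ i) (horizontalFrame F₁ F₂ j) p =
      ∑ k, horizontalBracket (a₂ F₁ p) (κ F₁ p) lam i j k • horizontalFrame F₁ F₂ k p := by
  rw [mlieBracket_of_frame (V := horizontalFrame F₁ F₂ i) (W := horizontalFrame F₁ F₂ j)
    (C := fun i j k p => liftBracket (a₂ F₁ p) (a₄ F₂ p) i j k)
    (smoothVF_liftFrame F₁ F₂) (mlieBracket_liftFrame F₁ F₂ hN.a_fst hN.a_snd) (fun _ => rfl)
    (fun _ => rfl) (hN.hasFrameDerivs_rotationCoeff i) (hN.hasFrameDerivs_rotationCoeff j)]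
  simp only [horizontalBracket_eq (Real.sin_sq_add_cos_sq p.2.2), horizontalFrame, Finset.smul_sum,
    Finset.sum_smul, smul_smul]
  exact Finset.sum_comm

end TwistorFrame

/-! ### Radial functions; the fields X̃ and the forms ω in the horizontal frame. -/

section TwistorFrame

variable {S₁ S₂ : Type*}
  [TopologicalSpace S₁] [ChartedSpace (EuclideanSpace ℝ (Fin 2)) S₁] [IsManifold (𝓡 2) ∞ S₁]
  [TopologicalSpace S₂] [ChartedSpace (EuclideanSpace ℝ (Fin 2)) S₂] [IsManifold (𝓡 2) ∞ S₂]
  (F₁ : FramedSurface S₁) (F₂ : FramedSurface S₂) (lam : ℝ)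

/-! ### Functions that depend on the first surface only and are constant along `e₂` -/

/-- The function `f` is smooth, with derivative `f'` along the horizontal lift of `e₁`, and constant
along the other fields of `horizontalFrame`. -/
def HasRadialDeriv (f f' : Twistor S₁ S₂ → ℝ) : Prop :=
  HasFrameDerivs (horizontalFrame F₁ F₂) f fun i p => if i = 0 then f' p else 0

variable {F₁ F₂} {f f' g g' : Twistor S₁ S₂ → ℝ}

namespace HasRadialDeriv

theorem congr {f₂ f₂' : Twistor S₁ S₂ → ℝ} (h : HasRadialDeriv F₁ F₂ f f')
    (hf : ∀ p, f₂ p = f p) (hf' : ∀ p, f₂' p = f' p) : HasRadialDeriv F₁ F₂ f₂ f₂' :=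
  HasFrameDerivs.congr h hf fun i p => by rw [hf']

theorem const (c : ℝ) : HasRadialDeriv F₁ F₂ (fun _ => c) fun _ => 0 :=
  (HasFrameDerivs.const c).congr (fun _ => rfl) fun i p => by simp

theorem add (h : HasRadialDeriv F₁ F₂ f f') (h' : HasRadialDeriv F₁ F₂ g g') :
    HasRadialDeriv F₁ F₂ (fun p => f p + g p) fun p => f' p + g' p :=
  (HasFrameDerivs.add h h').congr (fun _ => rfl) fun i p => by split_ifs <;> simp

theorem sub (h : HasRadialDeriv F₁ F₂ f f') (h' : HasRadialDeriv F₁ F₂ g g') :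
    HasRadialDeriv F₁ F₂ (fun p => f p - g p) fun p => f' p - g' p :=
  (HasFrameDerivs.sub h h').congr (fun _ => rfl) fun i p => by split_ifs <;> simp

theorem neg (h : HasRadialDeriv F₁ F₂ f f') :
    HasRadialDeriv F₁ F₂ (fun p => -f p) fun p => -f' p :=
  (HasFrameDerivs.neg h).congr (fun _ => rfl) fun i p => by split_ifs <;> simp

theorem mul (h : HasRadialDeriv F₁ F₂ f f') (h' : HasRadialDeriv F₁ F₂ g g') :
    HasRadialDeriv F₁ F₂ (fun p => f p * g p) fun p => f p * g' p + g p * f' p :=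
  (HasFrameDerivs.mul h h').congr (fun _ => rfl) fun i p => by split_ifs <;> simp

/-- The derivative is written with powers of the inverse, as the coefficient tables are polynomial
in r = 1 / (κ - λ). -/
theorem inv (h : HasRadialDeriv F₁ F₂ f f') (h0 : ∀ p, f p ≠ 0) :
    HasRadialDeriv F₁ F₂ (fun p => (f p)⁻¹) fun p => -f' p * (f p)⁻¹ ^ 2 :=
  (HasFrameDerivs.inv h h0).congr (fun _ => rfl) fun i p => by
    split_ifs
    · change -f' p * (f p)⁻¹ ^ 2 = _
      rw [inv_pow]; ring
    · simp

theorem of_fst {f : S₁ → ℝ} (hf : ContMDiff (𝓡 2) 𝓘(ℝ, ℝ) ∞ f)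
    (h0 : ∀ x, dirDeriv (F₁.e 1) f x = 0) :
    HasRadialDeriv F₁ F₂ (fun p => f p.1) fun p => dirDeriv (F₁.e 0) f p.1 := by
  have h := hasFrameDerivs_fst F₁ F₂ hf
  refine ⟨h.1, fun i p => ?_⟩
  change dirDeriv (fun p => ∑ j, rotationCoeff (Real.cos p.2.2) (Real.sin p.2.2) (a₂ F₁ p)
    (a₄ F₂ p) i j • liftFrame F₁ F₂ j p) _ p = _
  rw [dirDeriv_sum_smul]
  simp only [h.2, Fin.sum_univ_five]
  fin_cases i <;> simp [rotationCoeff, h0]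

end HasRadialDeriv

/-- The coefficients of the bracket of two combinations of `horizontalFrame` with coefficients
`u`, `v`, whose derivatives along the horizontal lift of `e₁` are `u'`, `v'` and which are
constant along the other fields of the frame. -/
def radialBracket (a k l : ℝ) (u v u' v' : Fin 5 → ℝ) : Fin 5 → ℝ :=
  ![u 0 * v' 0 - v 0 * u' 0,
    u 0 * v' 1 - v 0 * u' 1 + a * (u 0 * v 1 - u 1 * v 0),
    u 0 * v' 2 - v 0 * u' 2 + a * (u 1 * v 3 - u 3 * v 1) + (u 3 * v 4 - u 4 * v 3),
    u 0 * v' 3 - v 0 * u' 3 - a * (u 1 * v 2 - u 2 * v 1) - (u 2 * v 4 - u 4 * v 2),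
    u 0 * v' 4 - v 0 * u' 4 - k * (u 0 * v 1 - u 1 * v 0) + l * (u 2 * v 3 - u 3 * v 2)]

variable {lam}

/-- Only derivatives along the lift of e₁ survive in the general bracket formula, so the bracket is
a pointwise expression in the coefficients and their radial derivatives. -/
theorem IsNormalized.mlieBracket_of_radial (hN : IsNormalized F₁ F₂ lam)
    {u v u' v' : Fin 5 → Twistor S₁ S₂ → ℝ} {V W : VF I5 (M := Twistor S₁ S₂)}
    (hV : ∀ p, V p = ∑ i, u i p • horizontalFrame F₁ F₂ i p)
    (hW : ∀ p, W p = ∑ i, v i p • horizontalFrame F₁ F₂ i p)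
    (hu : ∀ i, HasRadialDeriv F₁ F₂ (u i) (u' i)) (hv : ∀ i, HasRadialDeriv F₁ F₂ (v i) (v' i))
    (p : Twistor S₁ S₂) :
    mlieBracket I5 V W p = ∑ k, radialBracket (a₂ F₁ p) (κ F₁ p) lam (fun i => u i p)
      (fun i => v i p) (fun i => u' i p) (fun i => v' i p) k • horizontalFrame F₁ F₂ k p := by
  rw [mlieBracket_of_frame
    (C := fun i j k p => horizontalBracket (a₂ F₁ p) (κ F₁ p) lam i j k)
    hN.isDualFrame.smoothVF hN.mlieBracket_horizontalFrame hV hW hu hv]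
  refine Finset.sum_congr rfl fun k _ => congrArg (· • _) ?_
  fin_cases k <;> simp [Fin.sum_univ_five, horizontalBracket, radialBracket] <;> ring

/-! ### The fields `X` and the forms `ω` in the horizontal frame -/

/-- The coefficients of the fields `X` in `horizontalFrame`, with `s = κ - λ`. -/
def fieldCoeff (a k s k₁ : ℝ) : Fin 5 → Fin 5 → ℝ :=
  ![![1, 0, 1, 0, 0], ![0, 1, 0, 1, 0], ![0, a, 0, a, -s],
    ![0, k + a ^ 2, 0, k + a ^ 2 + s, -k₁], ![0, 0, -s, 0, 0]]

/-- The coefficients of the forms `ω` in `horizontalCoframe`, with `r = 1 / (κ - λ)`. -/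
def omegaCoeff (a k r k₁ : ℝ) : Fin 5 → Fin 5 → ℝ :=
  ![![1, 0, 0, 0, 0],
    ![0, 1 + (a ^ 2 + k) * r - a * k₁ * r ^ 2, 0, -((a ^ 2 + k) * r - a * k₁ * r ^ 2), a * r],
    ![0, k₁ * r ^ 2, 0, -(k₁ * r ^ 2), -r], ![0, -r, 0, r, 0], ![r, 0, -r, 0, 0]]

/-- The derivatives of `fieldCoeff` along the horizontal lift of `e₁`. -/
def fieldCoeffDeriv (a k k₁ k₁₁ : ℝ) : Fin 5 → Fin 5 → ℝ :=
  ![0, 0, ![0, k + a ^ 2, 0, k + a ^ 2, -k₁],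
    ![0, k₁ + 2 * a * (k + a ^ 2), 0, k₁ + 2 * a * (k + a ^ 2) + k₁, -k₁₁], ![0, 0, -k₁, 0, 0]]

namespace IsNormalized

variable (hN : IsNormalized F₁ F₂ lam)
include hN

theorem sub_ne_zero (p : Twistor S₁ S₂) : κ F₁ p - lam ≠ 0 :=
  _root_.sub_ne_zero.2 (hN.curv_ne p.1)

/-- The terms a₄ cos φ in B and a₄ sin φ in X̃₅ are those that complete the rotated vectors to
horizontal lifts; hence neither a₄ nor φ occurs in the coefficients. -/
theorem X_eq_sum (i : Fin 5) (p : Twistor S₁ S₂) : X F₁ F₂ lam i p =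
    ∑ j, fieldCoeff (a₂ F₁ p) (κ F₁ p) (κ F₁ p - lam) (κ₁ F₁ p) i j
      • horizontalFrame F₁ F₂ j p := by
  have h0 := hN.sub_ne_zero p
  have h0' : lam - κ F₁ p ≠ 0 := by rw [← neg_sub]; exact neg_ne_zero.2 h0
  have ha : F₁.a 1 p.1 = a₂ F₁ p := rfl
  have hb : F₂.a 1 p.2.1 = a₄ F₂ p := rfl
  fin_cases i <;>
    simp [X, X₁, X₂, X₃, X₄, X₅, horizontalFrame, Fin.sum_univ_five, fieldCoeff, rotationCoeff,
      liftFrame, hN.a_fst, hN.a_snd, ha, hb] <;>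
    match_scalars <;> field_simp <;> ring

theorem omegaForm_eq_sum (i : Fin 5) (p : Twistor S₁ S₂) : omegaForm F₁ F₂ lam i p =
    ∑ j, omegaCoeff (a₂ F₁ p) (κ F₁ p) (κ F₁ p - lam)⁻¹ (κ₁ F₁ p) i j
      • horizontalCoframe F₁ F₂ j p := by
  have h0 := hN.sub_ne_zero p
  fin_cases i <;>
    simp [omegaForm, ω₁, ω₂, ω₃, ω₄, ω₅, horizontalCoframe, Fin.sum_univ_five, omegaCoeff,
      rotationCoeffDual, liftCoframe] <;>
    match_scalars <;> field_simp <;> ring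

theorem hasRadialDeriv_a₂ : HasRadialDeriv F₁ F₂ (a₂ F₁) fun p => κ F₁ p + a₂ F₁ p ^ 2 :=
  (HasRadialDeriv.of_fst (F₁.contMDiff_a 1) hN.dirDeriv_a).congr (fun _ => rfl)
    fun p => (F₁.dirDeriv_a_one hN.a_fst p.1).symm

theorem hasRadialDeriv_κ : HasRadialDeriv F₁ F₂ (κ F₁) (κ₁ F₁) :=
  HasRadialDeriv.of_fst F₁.contMDiff_curv hN.dirDeriv_curv

theorem hasRadialDeriv_κ₁ : HasRadialDeriv F₁ F₂ (κ₁ F₁) (κ₁₁ F₁) :=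
  HasRadialDeriv.of_fst (F₁.contMDiff_dirDeriv 0 F₁.contMDiff_curv)
    (F₁.dirDeriv_dirDeriv_eq_zero hN.a_fst F₁.contMDiff_curv hN.dirDeriv_curv)

/-- The third derivative of κ enters the structure functions of the dual frame of θ, but Cartan's
relations hold for every value of it; existence suffices. -/
theorem exists_hasRadialDeriv_κ₁₁ : ∃ κ₁₁₁, HasRadialDeriv F₁ F₂ (κ₁₁ F₁) κ₁₁₁ :=
  have h := F₁.contMDiff_dirDeriv 0 F₁.contMDiff_curv
  ⟨_, HasRadialDeriv.of_fst (F₁.contMDiff_dirDeriv 0 h)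
    (F₁.dirDeriv_dirDeriv_eq_zero hN.a_fst h
      (F₁.dirDeriv_dirDeriv_eq_zero hN.a_fst F₁.contMDiff_curv hN.dirDeriv_curv))⟩

theorem hasRadialDeriv_sub : HasRadialDeriv F₁ F₂ (fun p => κ F₁ p - lam) (κ₁ F₁) :=
  (hN.hasRadialDeriv_κ.sub (HasRadialDeriv.const lam)).congr (fun _ => rfl) fun _ => by simp

theorem hasRadialDeriv_fieldCoeff (i j : Fin 5) :
    HasRadialDeriv F₁ F₂
      (fun p => fieldCoeff (a₂ F₁ p) (κ F₁ p) (κ F₁ p - lam) (κ₁ F₁ p) i j)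
      fun p => fieldCoeffDeriv (a₂ F₁ p) (κ F₁ p) (κ₁ F₁ p) (κ₁₁ F₁ p) i j := by
  have ha := hN.hasRadialDeriv_a₂
  have hs := hN.hasRadialDeriv_sub
  have h3 := hN.hasRadialDeriv_κ.add (ha.mul ha)
  have hc := fun c => HasRadialDeriv.const (F₁ := F₁) (F₂ := F₂) c
  fin_cases i <;> fin_cases j
  all_goals first
    | exact hc _
    | exact ha
    | exact hs.neg
    | exact hN.hasRadialDeriv_κ₁.neg
    | exact h3.congr (fun p => by simp [fieldCoeff]; ring1)
        fun p => by simp [fieldCoeffDeriv]; ring1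
    | exact (h3.add hs).congr (fun p => by simp [fieldCoeff]; ring1)
        fun p => by simp [fieldCoeffDeriv]; ring1

theorem mlieBracket_X (i j : Fin 5) (p : Twistor S₁ S₂) :
    mlieBracket I5 (X F₁ F₂ lam i) (X F₁ F₂ lam j) p =
      ∑ k, radialBracket (a₂ F₁ p) (κ F₁ p) lam
        (fieldCoeff (a₂ F₁ p) (κ F₁ p) (κ F₁ p - lam) (κ₁ F₁ p) i)
        (fieldCoeff (a₂ F₁ p) (κ F₁ p) (κ F₁ p - lam) (κ₁ F₁ p) j)
        (fieldCoeffDeriv (a₂ F₁ p) (κ F₁ p) (κ₁ F₁ p) (κ₁₁ F₁ p) i)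
        (fieldCoeffDeriv (a₂ F₁ p) (κ F₁ p) (κ₁ F₁ p) (κ₁₁ F₁ p) j) k
        • horizontalFrame F₁ F₂ k p :=
  hN.mlieBracket_of_radial (hN.X_eq_sum i) (hN.X_eq_sum j) (hN.hasRadialDeriv_fieldCoeff i)
    (hN.hasRadialDeriv_fieldCoeff j) p

theorem mlieBracket_X_zero_one (p : Twistor S₁ S₂) :
    mlieBracket I5 (X F₁ F₂ lam 0) (X F₁ F₂ lam 1) p = X F₁ F₂ lam 2 p := by
  rw [hN.mlieBracket_X, hN.X_eq_sum]
  refine Finset.sum_congr rfl fun k _ => congrArg (· • _) ?_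
  fin_cases k <;> simp [radialBracket, fieldCoeff, fieldCoeffDeriv]
  ring

theorem mlieBracket_X_zero_two (p : Twistor S₁ S₂) :
    mlieBracket I5 (X F₁ F₂ lam 0) (X F₁ F₂ lam 2) p =
      X F₁ F₂ lam 3 p + a₂ F₁ p • X F₁ F₂ lam 2 p := by
  rw [hN.mlieBracket_X, hN.X_eq_sum, hN.X_eq_sum, Finset.smul_sum, ← Finset.sum_add_distrib]
  refine Finset.sum_congr rfl fun k _ => ?_
  rw [smul_smul, ← add_smul]
  refine congrArg (· • _) ?_
  fin_cases k <;> simp [radialBracket, fieldCoeff, fieldCoeffDeriv] <;> ring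

theorem mlieBracket_X_one_two (p : Twistor S₁ S₂) :
    mlieBracket I5 (X F₁ F₂ lam 1) (X F₁ F₂ lam 2) p = X F₁ F₂ lam 4 p := by
  rw [hN.mlieBracket_X, hN.X_eq_sum]
  refine Finset.sum_congr rfl fun k _ => congrArg (· • _) ?_
  fin_cases k <;> simp [radialBracket, fieldCoeff, fieldCoeffDeriv]

theorem omegaForm_X (i j : Fin 5) (p : Twistor S₁ S₂) :
    omegaForm F₁ F₂ lam i p (X F₁ F₂ lam j p) = if i = j then 1 else 0 := by
  have h0 := hN.sub_ne_zero p
  have h : omegaForm F₁ F₂ lam i p (X F₁ F₂ lam j p) =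
      ∑ k, omegaCoeff (a₂ F₁ p) (κ F₁ p) (κ F₁ p - lam)⁻¹ (κ₁ F₁ p) i k
        * fieldCoeff (a₂ F₁ p) (κ F₁ p) (κ F₁ p - lam) (κ₁ F₁ p) j k := by
    rw [hN.omegaForm_eq_sum, hN.X_eq_sum]
    simp [hN.isDualFrame.dual, mul_comm (fieldCoeff _ _ _ _ _ _)]
  rw [h]
  fin_cases i <;> fin_cases j <;>
    simp [Fin.sum_univ_five, omegaCoeff, fieldCoeff, h0] <;> field_simp <;> ring

end IsNormalized

end TwistorFrame

/-! ### The frame dual to θ and the verification of Cartan's relations. -/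

section TwistorFrame

variable {S₁ S₂ : Type*}
  [TopologicalSpace S₁] [ChartedSpace (EuclideanSpace ℝ (Fin 2)) S₁] [IsManifold (𝓡 2) ∞ S₁]
  [TopologicalSpace S₂] [ChartedSpace (EuclideanSpace ℝ (Fin 2)) S₂] [IsManifold (𝓡 2) ∞ S₂]

/-! ### The forms `θ` and their dual frame -/

/-- The function `(3/10) (κ - λ) - (2/5) λ - (1/10) a₂ κ₁ / (κ - λ)`. -/
def coeffP (a l s r k₁ : ℝ) : ℝ := 3 / 10 * s - 2 / 5 * l - 1 / 10 * (a * k₁ * r)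

/-- The derivative of `coeffP` along the horizontal lift of `e₁`. -/
def coeffPDeriv (a l s r k₁ k₁₁ : ℝ) : ℝ :=
  3 / 10 * k₁ - 1 / 10 * ((s + l + a ^ 2) * k₁ * r + a * k₁₁ * r - a * k₁ ^ 2 * r ^ 2)

/-- The function `-(1/10) κ₁₁ / (κ - λ) + (1/2) κ₁² / (κ - λ)²`. -/
def coeffM (r k₁ k₁₁ : ℝ) : ℝ := -(1 / 10 * (k₁₁ * r)) + 1 / 2 * (k₁ ^ 2 * r ^ 2)

/-- The derivative of `coeffM` along the horizontal lift of `e₁`. -/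
def coeffMDeriv (r k₁ k₁₁ k₁₁₁ : ℝ) : ℝ :=
  -(1 / 10 * (k₁₁₁ * r)) + 11 / 10 * (k₁ * k₁₁ * r ^ 2) - k₁ ^ 3 * r ^ 3

/-- The coefficients in `horizontalFrame` of the frame dual to the forms `θ`, with
`s = κ - λ`, `r = 1 / s`. -/
def dualCoeff (a l s r k₁ k₁₁ : ℝ) : Fin 5 → Fin 5 → ℝ :=
  ![![coeffP a l s r k₁, coeffM r k₁ k₁₁ - 3 / 10 * s + 2 / 5 * l, coeffP a l s r k₁,
      coeffM r k₁ k₁₁ + 7 / 10 * s + 2 / 5 * l, -k₁],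
    ![2 * coeffP a l s r k₁, coeffM r k₁ k₁₁ - 1 / 10 * (a * k₁ * r),
      2 * coeffP a l s r k₁ - s, s + coeffM r k₁ k₁₁ - 1 / 10 * (a * k₁ * r), -k₁],
    ![0, -(k₁ * r), 0, -(k₁ * r), s], ![-1, 0, -1, 0, 0], ![-1, -1, -1, -1, 0]]

/-- The derivatives of `dualCoeff` along the horizontal lift of `e₁`. -/
def dualCoeffDeriv (a l s r k₁ k₁₁ k₁₁₁ : ℝ) : Fin 5 → Fin 5 → ℝ :=
  ![![coeffPDeriv a l s r k₁ k₁₁, coeffMDeriv r k₁ k₁₁ k₁₁₁ - 3 / 10 * k₁,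
      coeffPDeriv a l s r k₁ k₁₁, coeffMDeriv r k₁ k₁₁ k₁₁₁ + 7 / 10 * k₁, -k₁₁],
    ![2 * coeffPDeriv a l s r k₁ k₁₁,
      coeffMDeriv r k₁ k₁₁ k₁₁₁ + coeffPDeriv a l s r k₁ k₁₁ - 3 / 10 * k₁,
      2 * coeffPDeriv a l s r k₁ k₁₁ - k₁,
      coeffMDeriv r k₁ k₁₁ k₁₁₁ + coeffPDeriv a l s r k₁ k₁₁ + 7 / 10 * k₁, -k₁₁],
    ![0, k₁ ^ 2 * r ^ 2 - k₁₁ * r, 0, k₁ ^ 2 * r ^ 2 - k₁₁ * r, k₁], 0, 0]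

/-- The coefficients of the forms `θ` in `horizontalCoframe`. -/
def thetaCoeff (a l r k₁ k₁₁ : ℝ) : Fin 5 → Fin 5 → ℝ :=
  ![![-r, -r, r, r, 0], ![r, 0, -r, 0, 0], ![0, -(k₁ * r ^ 2), 0, k₁ * r ^ 2, r],
    ![-1, 2 / 5 + 4 / 5 * (l * r) - 1 / 10 * ((k₁₁ - a * k₁) * r ^ 2) - 1 / 2 * (k₁ ^ 2 * r ^ 3), 0,
      3 / 5 - 4 / 5 * (l * r) + 1 / 10 * ((k₁₁ - a * k₁) * r ^ 2) + 1 / 2 * (k₁ ^ 2 * r ^ 3),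
      k₁ * r ^ 2],
    ![3 / 10 - 2 / 5 * (l * r) - 1 / 10 * (a * k₁ * r ^ 2),
      -7 / 10 - 2 / 5 * (l * r) + 1 / 10 * (k₁₁ * r ^ 2) + 1 / 2 * (k₁ ^ 2 * r ^ 3),
      -(3 / 10 - 2 / 5 * (l * r) - 1 / 10 * (a * k₁ * r ^ 2)),
      -3 / 10 + 2 / 5 * (l * r) - 1 / 10 * (k₁₁ * r ^ 2) - 1 / 2 * (k₁ ^ 2 * r ^ 3),
      -(k₁ * r ^ 2)]]

theorem thetaCoeff_dualCoeff {s r : ℝ} (h : s * r = 1) (a l k₁ k₁₁ : ℝ) (i j : Fin 5) :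
    ∑ k, thetaCoeff a l r k₁ k₁₁ i k * dualCoeff a l s r k₁ k₁₁ j k = if i = j then 1 else 0 := by
  obtain rfl := eq_inv_of_mul_eq_one_right h
  have hs : s ≠ 0 := left_ne_zero_of_mul_eq_one h
  fin_cases i <;> fin_cases j <;>
    simp [Fin.sum_univ_five, thetaCoeff, dualCoeff, coeffP, coeffM, hs] <;> field_simp <;> ring1

/-- The structure functions of the dual frame of the forms `θ`. -/
def dualBracket (a l s r k₁ k₁₁ k₁₁₁ : ℝ) (i j k : Fin 5) : ℝ :=
  ∑ m, thetaCoeff a l r k₁ k₁₁ i m * radialBracket a (s + l) l (dualCoeff a l s r k₁ k₁₁ j)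
    (dualCoeff a l s r k₁ k₁₁ k) (dualCoeffDeriv a l s r k₁ k₁₁ k₁₁₁ j)
    (dualCoeffDeriv a l s r k₁ k₁₁ k₁₁₁ k) m

-- The constants in θ⁴ and θ⁵ are tested here: with κ = s + l and the radial derivatives already
-- inserted, each relation is an identity of rational functions in independent variables.
set_option maxHeartbeats 4000000 in
theorem cartanRelations_dualBracket {s r : ℝ} (h : s * r = 1) (a l k₁ k₁₁ k₁₁₁ : ℝ) :
    CartanRelations (dualBracket a l s r k₁ k₁₁ k₁₁₁) := by
  obtain rfl := eq_inv_of_mul_eq_one_right h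
  have hs : s ≠ 0 := left_ne_zero_of_mul_eq_one h
  constructor <;>
    simp only [dualBracket, Fin.sum_univ_five, thetaCoeff, dualCoeff, dualCoeffDeriv,
      radialBracket, coeffP, coeffM, coeffPDeriv, coeffMDeriv, Matrix.cons_val, Pi.zero_apply,
      mul_zero, zero_mul, add_zero, zero_add, sub_zero, zero_sub] <;>
    field_simp <;> ring1

variable (F₁ : FramedSurface S₁) (F₂ : FramedSurface S₂) (lam : ℝ)

/-- The frame dual to the forms `θ`. -/
def dualFrame (i : Fin 5) : VF I5 (M := Twistor S₁ S₂) := fun p =>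
  ∑ j, dualCoeff (a₂ F₁ p) lam (κ F₁ p - lam) (κ F₁ p - lam)⁻¹ (κ₁ F₁ p) (κ₁₁ F₁ p) i j
    • horizontalFrame F₁ F₂ j p

variable {F₁ F₂ lam}

namespace IsNormalized

variable (hN : IsNormalized F₁ F₂ lam)
include hN

/-- θ is built from ω with coefficients from the first surface, so it inherits expansions free of a₄
and φ. -/
theorem thetaForm_eq_sum (i : Fin 5) (p : Twistor S₁ S₂) : thetaForm F₁ F₂ lam i p =
    ∑ j, thetaCoeff (a₂ F₁ p) lam (κ F₁ p - lam)⁻¹ (κ₁ F₁ p) (κ₁₁ F₁ p) i j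
      • horizontalCoframe F₁ F₂ j p := by
  have h0 := hN.sub_ne_zero p
  have h0' : lam - κ F₁ p ≠ 0 := by rw [← neg_sub]; exact neg_ne_zero.2 h0
  have w1 := hN.omegaForm_eq_sum 0 p
  have w2 := hN.omegaForm_eq_sum 1 p
  have w3 := hN.omegaForm_eq_sum 2 p
  have w4 := hN.omegaForm_eq_sum 3 p
  have w5 := hN.omegaForm_eq_sum 4 p
  simp only [omegaForm, Fin.sum_univ_five, omegaCoeff, Matrix.cons_val] at w1 w2 w3 w4 w5
  fin_cases i <;>
    simp only [thetaForm, θ₄, θ₅, Fin.sum_univ_five, thetaCoeff, Matrix.cons_val, Pi.sub_apply,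
      Pi.neg_apply, Fin.zero_eta, Fin.mk_one, Fin.reduceFinMk, w1, w2, w3, w4, w5] <;>
    match_scalars <;> field_simp <;> ring

theorem hasRadialDeriv_dualCoeff {κ₁₁₁ : Twistor S₁ S₂ → ℝ}
    (h₁₁ : HasRadialDeriv F₁ F₂ (κ₁₁ F₁) κ₁₁₁) (i j : Fin 5) :
    HasRadialDeriv F₁ F₂
      (fun p => dualCoeff (a₂ F₁ p) lam (κ F₁ p - lam) (κ F₁ p - lam)⁻¹ (κ₁ F₁ p) (κ₁₁ F₁ p) i j)
      fun p => dualCoeffDeriv (a₂ F₁ p) lam (κ F₁ p - lam) (κ F₁ p - lam)⁻¹ (κ₁ F₁ p) (κ₁₁ F₁ p)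
        (κ₁₁₁ p) i j := by
  have ha := hN.hasRadialDeriv_a₂
  have hs := hN.hasRadialDeriv_sub
  have hr := hs.inv hN.sub_ne_zero
  have h₁ := hN.hasRadialDeriv_κ₁
  have hc := fun c => HasRadialDeriv.const (F₁ := F₁) (F₂ := F₂) c
  have hn := (hc (1 / 10)).mul ((ha.mul h₁).mul hr)
  have hP : HasRadialDeriv F₁ F₂
      (fun p => coeffP (a₂ F₁ p) lam (κ F₁ p - lam) (κ F₁ p - lam)⁻¹ (κ₁ F₁ p))
      fun p => coeffPDeriv (a₂ F₁ p) lam (κ F₁ p - lam) (κ F₁ p - lam)⁻¹ (κ₁ F₁ p) (κ₁₁ F₁ p) :=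
    ((((hc (3 / 10)).mul hs).sub (hc (2 / 5 * lam))).sub hn).congr
      (fun p => by simp only [coeffP]) fun p => by simp only [coeffPDeriv]; ring
  have hM : HasRadialDeriv F₁ F₂
      (fun p => coeffM (κ F₁ p - lam)⁻¹ (κ₁ F₁ p) (κ₁₁ F₁ p))
      fun p => coeffMDeriv (κ F₁ p - lam)⁻¹ (κ₁ F₁ p) (κ₁₁ F₁ p) (κ₁₁₁ p) :=
    (((hc (1 / 10)).mul (h₁₁.mul hr)).neg.add
      ((hc (1 / 2)).mul ((h₁.mul hr).mul (h₁.mul hr)))).congr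
      (fun p => by simp only [coeffM]; ring) fun p => by simp only [coeffMDeriv]; ring
  have h01 := (hM.sub ((hc (3 / 10)).mul hs)).add (hc (2 / 5 * lam))
  have h13 := (hs.add hM).sub hn
  have h2 := (h₁.mul hr).neg
  fin_cases i <;> fin_cases j
  exacts [hP,
    h01.congr (fun p => by simp [dualCoeff]) fun p => by simp [dualCoeffDeriv],
    hP,
    (h01.add hs).congr (fun p => by simp [dualCoeff]; ring) fun p => by simp [dualCoeffDeriv]; ring,
    h₁.neg,
    ((hc 2).mul hP).congr (fun p => by simp [dualCoeff]) fun p => by simp [dualCoeffDeriv],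
    (hM.sub hn).congr (fun p => by simp [dualCoeff])
      fun p => by simp [dualCoeffDeriv, coeffPDeriv]; ring,
    (((hc 2).mul hP).sub hs).congr (fun p => by simp [dualCoeff])
      fun p => by simp [dualCoeffDeriv],
    h13.congr (fun p => by simp [dualCoeff]) fun p => by simp [dualCoeffDeriv, coeffPDeriv]; ring,
    h₁.neg, hc _,
    h2.congr (fun p => by simp [dualCoeff]) fun p => by simp [dualCoeffDeriv]; ring,
    hc _,
    h2.congr (fun p => by simp [dualCoeff]) fun p => by simp [dualCoeffDeriv]; ring,
    hs, hc _, hc _, hc _, hc _, hc _, hc _, hc _, hc _, hc _, hc _]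

theorem contMDiff_thetaCoeff (i j : Fin 5) :
    ContMDiff I5 𝓘(ℝ, ℝ) ∞ (fun p : Twistor S₁ S₂ =>
      thetaCoeff (a₂ F₁ p) lam (κ F₁ p - lam)⁻¹ (κ₁ F₁ p) (κ₁₁ F₁ p) i j) := by
  have ha : ContMDiff I5 𝓘(ℝ, ℝ) ∞ (a₂ F₁ : Twistor S₁ S₂ → ℝ) := hN.hasRadialDeriv_a₂.1
  have hr : ContMDiff I5 𝓘(ℝ, ℝ) ∞ (fun p : Twistor S₁ S₂ => (κ F₁ p - lam)⁻¹) :=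
    (hN.hasRadialDeriv_sub.inv hN.sub_ne_zero).1
  have h₁ : ContMDiff I5 𝓘(ℝ, ℝ) ∞ (κ₁ F₁ : Twistor S₁ S₂ → ℝ) := hN.hasRadialDeriv_κ₁.1
  obtain ⟨_, h₁₁, -⟩ := hN.exists_hasRadialDeriv_κ₁₁
  have hc : ∀ c : ℝ, ContMDiff I5 𝓘(ℝ, ℝ) ∞ (fun _ : Twistor S₁ S₂ => c) :=
    fun c => contMDiff_const
  have t1 := (hc (2 / 5)).mul ((hc lam).mul hr)
  have t2 := (hc (4 / 5)).mul ((hc lam).mul hr)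
  have t3 := (hc (1 / 10)).mul ((h₁₁.sub (ha.mul h₁)).mul (hr.pow 2))
  have t4 := (hc (1 / 2)).mul ((h₁.pow 2).mul (hr.pow 3))
  have t5 := (hc (1 / 10)).mul (h₁₁.mul (hr.pow 2))
  have t6 := (hc (1 / 10)).mul ((ha.mul h₁).mul (hr.pow 2))
  have t7 := h₁.mul (hr.pow 2)
  have t8 := ((hc (3 / 10)).sub t1).sub t6
  fin_cases i <;> fin_cases j
  exacts [hr.neg, hr.neg, hr, hr, hc _, hr, hc _, hr.neg, hc _, hc _, hc _, t7.neg, hc _, t7, hr,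
    hc _, (((hc _).add t2).sub t3).sub t4, hc _, (((hc _).sub t2).add t3).add t4, t7,
    t8, (((hc _).sub t1).add t5).add t4, t8.neg, (((hc _).add t1).sub t5).sub t4, t7.neg]

theorem isDualFrame_theta : IsDualFrame (thetaForm F₁ F₂ lam) (dualFrame F₁ F₂ lam) := by
  obtain ⟨_, h₁₁⟩ := hN.exists_hasRadialDeriv_κ₁₁
  exact hN.isDualFrame.change (fun i j => (hN.hasRadialDeriv_dualCoeff h₁₁ i j).1)
    hN.contMDiff_thetaCoeff (fun i p => rfl) hN.thetaForm_eq_sum fun i j p =>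
      thetaCoeff_dualCoeff (mul_inv_cancel₀ (hN.sub_ne_zero p)) _ _ _ _ i j

theorem cartanRelations (p : Twistor S₁ S₂) : CartanRelations fun i j k =>
    IsDualFrame.structureFun (thetaForm F₁ F₂ lam) (dualFrame F₁ F₂ lam) i j k p := by
  obtain ⟨κ₁₁₁, h₁₁⟩ := hN.exists_hasRadialDeriv_κ₁₁
  convert cartanRelations_dualBracket (mul_inv_cancel₀ (hN.sub_ne_zero p)) (a₂ F₁ p) lam
    (κ₁ F₁ p) (κ₁₁ F₁ p) (κ₁₁₁ p) using 1
  funext i j k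
  rw [IsDualFrame.structureFun, hN.mlieBracket_of_radial (V := dualFrame F₁ F₂ lam j)
    (W := dualFrame F₁ F₂ lam k) (fun _ => rfl) (fun _ => rfl)
    (hN.hasRadialDeriv_dualCoeff h₁₁ j) (hN.hasRadialDeriv_dualCoeff h₁₁ k), hN.thetaForm_eq_sum,
    dualBracket]
  simp [hN.isDualFrame.dual, mul_comm (radialBracket _ _ _ _ _ _ _ _)]

end IsNormalized

end TwistorFrame

/-! ### Parallel transport of the null planes and the equations of the distribution. -/

section TwistorDistribution

variable {S₁ S₂ : Type*}
  [TopologicalSpace S₁] [ChartedSpace (EuclideanSpace ℝ (Fin 2)) S₁] [IsManifold (𝓡 2) ∞ S₁]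
  [TopologicalSpace S₂] [ChartedSpace (EuclideanSpace ℝ (Fin 2)) S₂] [IsManifold (𝓡 2) ∞ S₂]
  (F₁ : FramedSurface S₁) (F₂ : FramedSurface S₂)

/-! ### The twistor distribution -/

/-- The factor `sign4` undoes the minus sign of the second metric. -/
theorem baseComp_eq (p : Twistor S₁ S₂) (u : TangentSpace I5 p) : baseComp F₁ F₂ p u =
    ![σ₁ F₁ 0 p u, σ₁ F₁ 1 p u, σ₂ F₂ 0 p u, σ₂ F₂ 1 p u] := by
  have h1 : ∀ i, F₁.metric.inner p.1 u.1 (F₁.e i p.1) = σ₁ F₁ i p u := fun i =>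
    (F₁.metric.symm _ _ _).trans (σ₁_apply F₁ i p u).symm
  have h2 : ∀ i, F₂.metric.inner p.2.1 u.2.1 (F₂.e i p.2.1) = σ₂ F₂ i p u := fun i =>
    (F₂.metric.symm _ _ _).trans (σ₂_apply F₂ i p u).symm
  funext k
  fin_cases k
  · change 1 * (F₁.metric.inner p.1 u.1 (F₁.e 0 p.1) - F₂.metric.inner p.2.1 u.2.1 0) = σ₁ F₁ 0 p u
    rw [map_zero, one_mul, sub_zero]
    exact h1 0
  · change 1 * (F₁.metric.inner p.1 u.1 (F₁.e 1 p.1) - F₂.metric.inner p.2.1 u.2.1 0) = σ₁ F₁ 1 p u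
    rw [map_zero, one_mul, sub_zero]
    exact h1 1
  · change -1 * (F₁.metric.inner p.1 u.1 0 - F₂.metric.inner p.2.1 u.2.1 (F₂.e 0 p.2.1))
      = σ₂ F₂ 0 p u
    rw [map_zero, neg_one_mul, zero_sub, neg_neg]
    exact h2 0
  · change -1 * (F₁.metric.inner p.1 u.1 0 - F₂.metric.inner p.2.1 u.2.1 (F₂.e 1 p.2.1))
      = σ₂ F₂ 1 p u
    rw [map_zero, neg_one_mul, zero_sub, neg_neg]
    exact h2 1

theorem frame4_eq_prodVF (i : Fin 4) : frame4 F₁ F₂ i =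
    prodVF ((![F₁.e 0, F₁.e 1, 0, 0] : Fin 4 → VF (𝓡 2) (M := S₁)) i)
      ((![0, 0, F₂.e 0, F₂.e 1] : Fin 4 → VF (𝓡 2) (M := S₂)) i) := by
  fin_cases i <;> rfl

/-- The coefficients of the brackets of the frame `e₁, e₂, e₃, e₄`, for `a₁ = a₃ = 0`. -/
def frameBracket (a b : ℝ) (i j k : Fin 4) : ℝ :=
  (if k = 1 then (if i = 0 ∧ j = 1 then a else 0) - if i = 1 ∧ j = 0 then a else 0 else 0)
    + if k = 3 then (if i = 2 ∧ j = 3 then b else 0) - if i = 3 ∧ j = 2 then b else 0 else 0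

theorem splitMetric_mlieBracket_frame4 (h₁ : ∀ x, F₁.a 0 x = 0) (h₂ : ∀ x, F₂.a 0 x = 0)
    (i j k : Fin 4) (y : S₁ × S₂) :
    splitMetric F₁ F₂ y (mlieBracket I4 (frame4 F₁ F₂ i) (frame4 F₁ F₂ j) y) (frame4 F₁ F₂ k y) =
      sign4 k * frameBracket (F₁.a 1 y.1) (F₂.a 1 y.2) i j k := by
  have s1 : ∀ i, SmoothVF ((![F₁.e 0, F₁.e 1, 0, 0] : Fin 4 → VF (𝓡 2) (M := S₁)) i) := by
    intro i
    fin_cases i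
    exacts [F₁.smooth 0, F₁.smooth 1, smoothVF_zero, smoothVF_zero]
  have s2 : ∀ i, SmoothVF ((![0, 0, F₂.e 0, F₂.e 1] : Fin 4 → VF (𝓡 2) (M := S₂)) i) := by
    intro i
    fin_cases i
    exacts [smoothVF_zero, smoothVF_zero, F₂.smooth 0, F₂.smooth 1]
  have b1 : mlieBracket (𝓡 2) ((![F₁.e 0, F₁.e 1, 0, 0] : Fin 4 → VF (𝓡 2) (M := S₁)) i)
      ((![F₁.e 0, F₁.e 1, 0, 0] : Fin 4 → VF (𝓡 2) (M := S₁)) j) y.1 =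
      frameBracket (F₁.a 1 y.1) (F₂.a 1 y.2) i j 1 • F₁.e 1 y.1 := by
    have := F₁.bracket y.1
    have h' := mlieBracket_swap_apply (I := 𝓡 2) (V := F₁.e 1) (W := F₁.e 0) (x := y.1)
    fin_cases i <;> fin_cases j <;> simp [frameBracket, this, h', h₁]
  have b2 : mlieBracket (𝓡 2) ((![0, 0, F₂.e 0, F₂.e 1] : Fin 4 → VF (𝓡 2) (M := S₂)) i)
      ((![0, 0, F₂.e 0, F₂.e 1] : Fin 4 → VF (𝓡 2) (M := S₂)) j) y.2 =
      frameBracket (F₁.a 1 y.1) (F₂.a 1 y.2) i j 3 • F₂.e 1 y.2 := by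
    have := F₂.bracket y.2
    have h' := mlieBracket_swap_apply (I := 𝓡 2) (V := F₂.e 1) (W := F₂.e 0) (x := y.2)
    fin_cases i <;> fin_cases j <;> simp [frameBracket, this, h', h₂]
  rw [frame4_eq_prodVF, frame4_eq_prodVF, mlieBracket_prodVF (s1 i) (s1 j) (F₁.smooth 0)
    (F₁.e_ne_zero 0) (s2 i) (s2 j) (F₂.smooth 0) (F₂.e_ne_zero 0), b1, b2,
    frame4_eq_prodVF]
  have h : ∀ (c d : ℝ) (v : TangentSpace (𝓡 2) y.1) (w : TangentSpace (𝓡 2) y.2),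
      splitMetric F₁ F₂ y (c • F₁.e 1 y.1, d • F₂.e 1 y.2) (v, w) =
        c * F₁.metric.inner y.1 (F₁.e 1 y.1) v - d * F₂.metric.inner y.2 (F₂.e 1 y.2) w := by
    intro c d v w
    change F₁.metric.inner y.1 (c • F₁.e 1 y.1) v - F₂.metric.inner y.2 (d • F₂.e 1 y.2) w = _
    simp only [map_smul, smul_apply, smul_eq_mul]
  refine (h _ _ _ _).trans ?_
  fin_cases k
  · change _ * F₁.metric.inner y.1 (F₁.e 1 y.1) (F₁.e 0 y.1)
      - _ * F₂.metric.inner y.2 (F₂.e 1 y.2) 0 = _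
    rw [F₁.orthonormal, map_zero]
    simp [frameBracket]
  · change _ * F₁.metric.inner y.1 (F₁.e 1 y.1) (F₁.e 1 y.1)
      - _ * F₂.metric.inner y.2 (F₂.e 1 y.2) 0 = _
    rw [F₁.orthonormal, map_zero]
    simp [sign4]
  · change _ * F₁.metric.inner y.1 (F₁.e 1 y.1) 0
      - _ * F₂.metric.inner y.2 (F₂.e 1 y.2) (F₂.e 0 y.2) = _
    rw [F₂.orthonormal, map_zero]
    simp [frameBracket]
  · change _ * F₁.metric.inner y.1 (F₁.e 1 y.1) 0
      - _ * F₂.metric.inner y.2 (F₂.e 1 y.2) (F₂.e 1 y.2) = _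
    rw [F₂.orthonormal, map_zero]
    simp [sign4]

theorem connCoeff_frame4 (h₁ : ∀ x, F₁.a 0 x = 0) (h₂ : ∀ x, F₂.a 0 x = 0)
    (i j k : Fin 4) (y : S₁ × S₂) :
    connCoeff (splitMetric F₁ F₂) sign4 (frame4 F₁ F₂) i j k y =
      sign4 i / 2 * (sign4 i * frameBracket (F₁.a 1 y.1) (F₂.a 1 y.2) k j i
        - sign4 k * frameBracket (F₁.a 1 y.1) (F₂.a 1 y.2) j i k
        + sign4 j * frameBracket (F₁.a 1 y.1) (F₂.a 1 y.2) i k j) := by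
  simp only [connCoeff, splitMetric_mlieBracket_frame4 F₁ F₂ h₁ h₂]

/-- The connection rotates (e₁, e₂) and (e₃, e₄) separately, at rates given by a₂σ² and a₄σ⁴; the
second rotation combines with the change of φ. -/
theorem covDerivNullVec_zero (h₁ : ∀ x, F₁.a 0 x = 0) (h₂ : ∀ x, F₂.a 0 x = 0)
    (p : Twistor S₁ S₂) (u : TangentSpace I5 p) : covDerivNullVec F₁ F₂ p u 0 =
      ![0, -(a₂ F₁ p * σ₁ F₁ 1 p u),
        -(Real.sin p.2.2 * (formφ p u - a₄ F₂ p * σ₂ F₂ 1 p u)),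
        Real.cos p.2.2 * (formφ p u - a₄ F₂ p * σ₂ F₂ 1 p u)] := by
  funext i
  simp only [covDerivNullVec, connCoeff_frame4 F₁ F₂ h₁ h₂, baseComp_eq, formφ_apply]
  fin_cases i <;>
    simp [Fin.sum_univ_four, sign4, frameBracket, nullVec, a₂, a₄] <;>
    ring

theorem covDerivNullVec_one (h₁ : ∀ x, F₁.a 0 x = 0) (h₂ : ∀ x, F₂.a 0 x = 0)
    (p : Twistor S₁ S₂) (u : TangentSpace I5 p) : covDerivNullVec F₁ F₂ p u 1 =
      ![a₂ F₁ p * σ₁ F₁ 1 p u, 0,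
        -(Real.cos p.2.2 * (formφ p u - a₄ F₂ p * σ₂ F₂ 1 p u)),
        -(Real.sin p.2.2 * (formφ p u - a₄ F₂ p * σ₂ F₂ 1 p u))] := by
  funext i
  simp only [covDerivNullVec, connCoeff_frame4 F₁ F₂ h₁ h₂, baseComp_eq, formφ_apply]
  fin_cases i <;>
    simp [Fin.sum_univ_four, sign4, frameBracket, nullVec, a₂, a₄] <;>
    first | ring1 | exact Or.inl (by ring1)

theorem mem_nullPlane_iff (t x y z w : ℝ) : ![x, y, z, w] ∈ nullPlane t ↔
    z = x * Real.cos t - y * Real.sin t ∧ w = x * Real.sin t + y * Real.cos t := by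
  rw [nullPlane, Submodule.mem_span_range_iff_exists_fun]
  constructor
  · rintro ⟨c, hc⟩
    have h0 := congrFun hc 0
    have h1 := congrFun hc 1
    have h2 := congrFun hc 2
    have h3 := congrFun hc 3
    simp [Fin.sum_univ_two, nullVec] at h0 h1 h2 h3
    subst h0 h1
    exact ⟨by rw [← h2]; ring, h3.symm⟩
  · rintro ⟨rfl, rfl⟩
    refine ⟨![x, y], ?_⟩
    funext i
    fin_cases i <;> simp [Fin.sum_univ_two, nullVec]
    ring

theorem mem_twistorDistribution_iff (h₁ : ∀ x, F₁.a 0 x = 0) (h₂ : ∀ x, F₂.a 0 x = 0)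
    (p : Twistor S₁ S₂) (u : TangentSpace I5 p) : u ∈ twistorDistribution F₁ F₂ p ↔
      (σ₂ F₂ 0 p u = σ₁ F₁ 0 p u * Real.cos p.2.2 - σ₁ F₁ 1 p u * Real.sin p.2.2 ∧
        σ₂ F₂ 1 p u = σ₁ F₁ 0 p u * Real.sin p.2.2 + σ₁ F₁ 1 p u * Real.cos p.2.2) ∧
      formφ p u = a₄ F₂ p * σ₂ F₂ 1 p u - a₂ F₁ p * σ₁ F₁ 1 p u := by
  rw [twistorDistribution, Set.mem_ofPred_eq, baseComp_eq, Fin.forall_fin_two,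
    covDerivNullVec_zero F₁ F₂ h₁ h₂, covDerivNullVec_one F₁ F₂ h₁ h₂, mem_nullPlane_iff,
    mem_nullPlane_iff, mem_nullPlane_iff]
  refine and_congr_right fun _ => ⟨fun ⟨⟨h, h'⟩, _⟩ => ?_, fun h => ?_⟩
  -- The two conditions on the first section are the sin φ- and cos φ-multiples of one equation,
  -- recovered by this combination. The same equation implies the conditions on the second section.
  · linear_combination (-Real.sin p.2.2) * h + Real.cos p.2.2 * h' +
      (a₄ F₂ p * σ₂ F₂ 1 p u - a₂ F₁ p * σ₁ F₁ 1 p u - formφ p u)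
        * Real.sin_sq_add_cos_sq p.2.2
  · rw [h]
    refine ⟨⟨?_, ?_⟩, ?_, ?_⟩ <;> ring

variable {F₁ F₂} {lam : ℝ}

theorem IsNormalized.twistorDistribution_eq (hN : IsNormalized F₁ F₂ lam) (p : Twistor S₁ S₂) :
    twistorDistribution F₁ F₂ p =
      (Submodule.span ℝ {X F₁ F₂ lam 0 p, X F₁ F₂ lam 1 p} : Set (TangentSpace I5 p)) := by
  have ha : F₁.a 1 p.1 = a₂ F₁ p := rfl
  have hb : F₂.a 1 p.2.1 = a₄ F₂ p := rfl
  ext u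
  rw [mem_twistorDistribution_iff F₁ F₂ hN.a_fst hN.a_snd, SetLike.mem_coe,
    Submodule.mem_span_pair]
  constructor
  · rintro ⟨⟨h3, h4⟩, h5⟩
    -- X̃₁ and X̃₂ project to e₁ and e₂ on the first surface, which forces these coefficients.
    refine ⟨σ₁ F₁ 0 p u, σ₁ F₁ 1 p u, ?_⟩
    conv_rhs => rw [← (isDualFrame_lift F₁ F₂).expand p u]
    simp only [Fin.sum_univ_five, liftCoframe, liftFrame, Matrix.cons_val, h5, h4, h3, X, X₁, X₂,
      hN.a_fst, hN.a_snd, ha, hb]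
    module
  · rintro ⟨s, t, rfl⟩
    simp only [X, X₁, X₂, Matrix.cons_val, map_add, map_sub, map_smul, smul_eq_mul, σ₁_lift₁,
      σ₁_lift₂, σ₁_dφ, σ₂_lift₁, σ₂_lift₂, σ₂_dφ, formφ_lift₁, formφ_lift₂, formφ_dφ,
      hN.a_fst, hN.a_snd, ha, hb]
    simp only [if_true, zero_ne_one, one_ne_zero, if_false]
    refine ⟨⟨?_, ?_⟩, ?_⟩ <;> ring

end TwistorDistribution

/-! ### Invariance of θ and the conformal class. -/

section TwistorDistribution

variable {S₁ S₂ : Type*}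
  [TopologicalSpace S₁] [ChartedSpace (EuclideanSpace ℝ (Fin 2)) S₁] [IsManifold (𝓡 2) ∞ S₁]
  [TopologicalSpace S₂] [ChartedSpace (EuclideanSpace ℝ (Fin 2)) S₂] [IsManifold (𝓡 2) ∞ S₂]
  {F₁ : FramedSurface S₁} {F₂ : FramedSurface S₂} {lam : ℝ}

namespace IsNormalized

variable (hN : IsNormalized F₁ F₂ lam)
include hN

/-- On the distribution θ⁴ and θ⁵ restrict to ω₂ - ω₁ and -ω₂, whose dual basis is -X̃₁, -X̃₁ - X̃₂.
-/
theorem dualFrame_three (p : Twistor S₁ S₂) :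
    dualFrame F₁ F₂ lam 3 p = -X F₁ F₂ lam 0 p := by
  rw [hN.X_eq_sum, dualFrame]
  simp only [Fin.sum_univ_five, dualCoeff, fieldCoeff, Matrix.cons_val]
  module

theorem dualFrame_four (p : Twistor S₁ S₂) :
    dualFrame F₁ F₂ lam 4 p = -X F₁ F₂ lam 0 p - X F₁ F₂ lam 1 p := by
  rw [hN.X_eq_sum, hN.X_eq_sum, dualFrame]
  simp only [Fin.sum_univ_five, dualCoeff, fieldCoeff, Matrix.cons_val]
  module

theorem dualFrame_three_mem (p : Twistor S₁ S₂) :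
    dualFrame F₁ F₂ lam 3 p ∈ twistorDistribution F₁ F₂ p := by
  rw [hN.twistorDistribution_eq, SetLike.mem_coe, Submodule.mem_span_pair]
  exact ⟨-1, 0, by rw [hN.dualFrame_three]; module⟩

theorem dualFrame_four_mem (p : Twistor S₁ S₂) :
    dualFrame F₁ F₂ lam 4 p ∈ twistorDistribution F₁ F₂ p := by
  rw [hN.twistorDistribution_eq, SetLike.mem_coe, Submodule.mem_span_pair]
  exact ⟨-1, -1, by rw [hN.dualFrame_four]; module⟩

theorem isInvariantCoframe :
    IsInvariantCoframe (twistorDistribution F₁ F₂) (thetaForm F₁ F₂ lam) where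
  smooth := hN.isDualFrame_theta.smoothForm
  linearIndependent p := by
    rw [Fintype.linearIndependent_iff]
    intro c hc j
    have := congrArg (fun α : TangentSpace I5 p →L[ℝ] ℝ => α (dualFrame F₁ F₂ lam j p)) hc
    simpa [hN.isDualFrame_theta.dual] using this
  annihilates p v hv := by
    rw [hN.twistorDistribution_eq, SetLike.mem_coe, Submodule.mem_span_pair] at hv
    obtain ⟨s, t, rfl⟩ := hv
    have h := hN.omegaForm_X
    have h0 : ∀ i, 2 ≤ i → omegaForm F₁ F₂ lam i p
        (s • X F₁ F₂ lam 0 p + t • X F₁ F₂ lam 1 p) = 0 := by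
      intro i hi
      have i0 : i ≠ 0 := by rintro rfl; exact absurd hi (by decide)
      have i1 : i ≠ 1 := by rintro rfl; exact absurd hi (by decide)
      rw [map_add, map_smul, map_smul, h, h, if_neg i0, if_neg i1, smul_zero, smul_zero, add_zero]
    have h2 := h0 2 le_rfl
    have h3 := h0 3 (by decide)
    have h4 := h0 4 (by decide)
    refine ⟨?_, h4, ?_⟩
    · exact (congrArg₂ (· - ·) h3 h4).trans (sub_zero 0)
    · exact (congrArg Neg.neg h2).trans neg_zero
  system := hN.isDualFrame_theta.exists_cartanSystem hN.cartanRelations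

theorem distributionClass_eq : distributionClass (twistorDistribution F₁ F₂) =
    conformalClass (cartanMetric (thetaForm F₁ F₂ lam)) := by
  ext g
  constructor
  · rintro ⟨θ', hθ', f, hf, hf0, hg⟩
    obtain ⟨Ω', -, hΩ'⟩ := hθ'.system
    obtain ⟨Ω, -, hΩ⟩ := hN.isInvariantCoframe.system
    have hc := CartanSystem.conformal hN.isDualFrame_theta hΩ hΩ' hθ'.smooth
      hθ'.linearIndependent (fun p => hθ'.annihilates p _ (hN.dualFrame_three_mem p))
      fun p => hθ'.annihilates p _ (hN.dualFrame_four_mem p)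
    have hs : ContMDiff I5 𝓘(ℝ, ℝ) ∞ (fun p => θ' 2 p (dualFrame F₁ F₂ lam 2 p)) := fun p =>
      hθ'.smooth 2 p _ (hN.isDualFrame_theta.smoothVF 2 p)
    -- The conformal factor between the two metrics is the square of the nowhere vanishing diagonal
    -- entry of the transition matrix at θ³; it is smooth and positive.
    refine ⟨fun p => f p * θ' 2 p (dualFrame F₁ F₂ lam 2 p) ^ 2, hf.mul (hs.pow 2),
      fun p => mul_pos (hf0 p) (sq_pos_of_ne_zero (hc p).1), fun p v w => ?_⟩
    rw [hg, (hc p).2, mul_assoc]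
  · exact fun hg => ⟨_, hN.isInvariantCoframe, hg⟩

end IsNormalized

end TwistorDistribution

end RollingSurfaces

end

theorem proposition4p1 {S₁ S₂ : Type*}
    [TopologicalSpace S₁] [ChartedSpace (EuclideanSpace ℝ (Fin 2)) S₁] [IsManifold (𝓡 2) ∞ S₁]
    [TopologicalSpace S₂] [ChartedSpace (EuclideanSpace ℝ (Fin 2)) S₂] [IsManifold (𝓡 2) ∞ S₂]
    (F₁ : RollingSurfaces.FramedSurface S₁) (F₂ : RollingSurfaces.FramedSurface S₂)
    -- the first surface has a Killing vector field, a positive multiple of `e₂`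
    (K : RollingSurfaces.VF (𝓡 2) (M := S₁)) (hK : RollingSurfaces.IsKilling F₁.metric K)
    (h : S₁ → ℝ) (hpos : ∀ x, 0 < h x) (hKe : ∀ x, K x = h x • F₁.e 1 x)
    -- the second surface has constant curvature, and its frame has `[e₃, e₄] = a₄ e₄`
    (lam : ℝ) (hcurv : ∀ y, F₂.curv y = lam) (ha₃ : ∀ y, F₂.a 0 y = 0)
    -- the curvatures are different
    (hne : ∀ x, F₁.curv x ≠ lam) :
    -- the twistor distribution is spanned by `X̃₁`, `X̃₂`
    (∀ p : RollingSurfaces.Twistor S₁ S₂,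
      RollingSurfaces.twistorDistribution F₁ F₂ p =
        (Submodule.span ℝ {RollingSurfaces.X F₁ F₂ lam 0 p, RollingSurfaces.X F₁ F₂ lam 1 p} :
          Set (TangentSpace RollingSurfaces.I5 p))) ∧
    -- commutators
    (∀ p, VectorField.mlieBracket RollingSurfaces.I5 (RollingSurfaces.X F₁ F₂ lam 0)
        (RollingSurfaces.X F₁ F₂ lam 1) p = RollingSurfaces.X F₁ F₂ lam 2 p) ∧
    (∀ p, VectorField.mlieBracket RollingSurfaces.I5 (RollingSurfaces.X F₁ F₂ lam 0)
        (RollingSurfaces.X F₁ F₂ lam 2) p =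
      RollingSurfaces.X F₁ F₂ lam 3 p
        + RollingSurfaces.a₂ F₁ p • RollingSurfaces.X F₁ F₂ lam 2 p) ∧
    (∀ p, VectorField.mlieBracket RollingSurfaces.I5 (RollingSurfaces.X F₁ F₂ lam 1)
        (RollingSurfaces.X F₁ F₂ lam 2) p = RollingSurfaces.X F₁ F₂ lam 4 p) ∧
    -- the forms `ω₁, …, ω₅` are dual to the fields `X̃₁, …, X̃₅`
    (∀ p i j, RollingSurfaces.omegaForm F₁ F₂ lam i p (RollingSurfaces.X F₁ F₂ lam j p) =
      if i = j then 1 else 0) ∧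
    -- `θ¹, …, θ⁵` are invariant forms of the twistor distribution
    RollingSurfaces.IsInvariantCoframe (RollingSurfaces.twistorDistribution F₁ F₂)
      (RollingSurfaces.thetaForm F₁ F₂ lam) ∧
    -- the conformal class of the twistor distribution is represented by the metric built of `θ`
    RollingSurfaces.distributionClass (RollingSurfaces.twistorDistribution F₁ F₂) =
      RollingSurfaces.conformalClass
        (RollingSurfaces.cartanMetric (RollingSurfaces.thetaForm F₁ F₂ lam)) := by
  have hN : RollingSurfaces.IsNormalized F₁ F₂ lam :=
    { a_fst := RollingSurfaces.FramedSurface.a_zero_of_killing hK hpos hKe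
      dirDeriv_a := RollingSurfaces.FramedSurface.dirDeriv_one_a_one_of_killing hK hpos hKe
      dirDeriv_curv := RollingSurfaces.FramedSurface.dirDeriv_one_curv_of_killing hK hpos hKe
      a_snd := ha₃
      curv_snd := hcurv
      curv_ne := hne }
  exact ⟨hN.twistorDistribution_eq, hN.mlieBracket_X_zero_one, hN.mlieBracket_X_zero_two,
    hN.mlieBracket_X_one_two, fun p i j => hN.omegaForm_X i j p, hN.isInvariantCoframe,
    hN.distributionClass_eq⟩
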